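/- Consider formulas of first-order arithmetic over $0,1,+,\cdot,<,=$, built with the (all primitive) logical symbols $\neg,\wedge,\vee,\to,\exists,\forall$; "true" means classically true in $\mathbb N$. With each formula $A$ (with values for its free variables) we associate infinite two-player interactions. At each time $0,1,2,\dots$ one player, the *witness* or the *user*, makes a move, possibly a null move. The effective moves are the following (all others are ignored). - In $\exists x\,A(x)$, the witness may once choose a number $n$; in $A_0\vee A_1$, the witness may once choose a disjunct. The play then proceeds in the chosen formula. - In $\forall x\,A(x)$, the user may give inputs $n$, any number of them; in $A_0\wedge A_1$, the user may ask for either or both conjuncts. Each formula so opened is then played separately. - In $A\to B$, the user may launch numbered instances, any number of them, each from scratch or as a copy of the input and output of another instance up to any point of time. In each instance $A$ and $B$ are played in parallel, with the roles of the players exchanged in $A$. The requirements for $A$ are met up to time $t\in\mathbb N\cup\{\infty\}$ under the following conditions. In every case $A$ must be true; for atomic formulas and negations nothing else is required. In $\exists$ and $\vee$ formulas, if a choice was made before $t$, then the requirements for the chosen formula are met up to $t$, and if $t=\infty$ a choice must have been made. In $\forall$ and $\wedge$ formulas, the requirements for each formula opened before $t$ are met up to $t$. For $A\to B$, in each instance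 launched before $t$ and for every $s\le t$ (including $s=\infty$ if $t=\infty$), if the requirements for $A$ are met up to $s$, then those for $B$ are met up to $s$. A *narrow constructive witness* for a sentence $A$ is a code of a total recursive function that computes each next move of the witness from the finite sequence of the opponent's moves made so far, such that for every real number (that is, every infinite sequence of moves of the opponent, witness and opponent moving alternately and null moves being allowed) the requirements for $A$ are met up to time $\infty$. The sentence $A$ is *narrow constructively true* if it has a narrow constructive witness. **Theorem.** Narrow constructive arithmetical truth is $\Pi^1_1$-complete: the set of Gödel numbers of narrow constructively true arithmetical sentences is $\Pi^1_1$, i.e. of the form $\{n:\forall X\subseteq\mathbb N\ \varphi(n,X)\}$ with $\varphi$ an arithmetical formula in which the set $X$ may be used as a predicate; and every $\Pi^1_1$ set of natural numbers is many-one reducible to it by a recursive function. -/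

import Mathlib

namespace NarrowTruth

/-! ### The language of arithmetic -/

/-- Terms over `0`, `1`, `+`, `*` and the variables `v₀, v₁, …`. -/
inductive Term where
  | var (x : ℕ)
  | zero
  | one
  | add (a b : Term)
  | mul (a b : Term)

/-- First-order formulas of arithmetic, with an additional unary predicate symbol for each `p : P`.
All connectives are primitive, because they carry different constructive requirements. -/
inductive Formula (P : Type) where
  | eq (a b : Term)
  | lt (a b : Term)
  | pred (p : P) (a : Term)
  | neg (A : Formula P)
  | and (A B : Formula P)
  | or (A B : Formula P)
  | imp (A B : Formula P)
  | all (x : ℕ) (A : Formula P)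
  | ex (x : ℕ) (A : Formula P)

/-- Formulas of pure arithmetic. -/
abbrev ArithFormula : Type := Formula Empty

/-- Arithmetical formulas in which one set of natural numbers may be used as a predicate. -/
abbrev SetFormula : Type := Formula Unit

/-- Value of a term in `ℕ` under an assignment of the variables. -/
def Term.val (e : ℕ → ℕ) : Term → ℕ
  | .var x => e x
  | .zero => 0
  | .one => 1
  | .add a b => a.val e + b.val e
  | .mul a b => a.val e * b.val e

/-- Classical truth in the standard model; `I p` is the set interpreting the predicate `p`. -/
def Formula.Sat {P : Type} (I : P → Set ℕ) : Formula P → (ℕ → ℕ) → Prop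
  | .eq a b, e => a.val e = b.val e
  | .lt a b, e => a.val e < b.val e
  | .pred p a, e => a.val e ∈ I p
  | .neg A, e => ¬ A.Sat I e
  | .and A B, e => A.Sat I e ∧ B.Sat I e
  | .or A B, e => A.Sat I e ∨ B.Sat I e
  | .imp A B, e => A.Sat I e → B.Sat I e
  | .all x A, e => ∀ n : ℕ, A.Sat I (Function.update e x n)
  | .ex x A, e => ∃ n : ℕ, A.Sat I (Function.update e x n)

/-- Classical truth of a formula of pure arithmetic. -/
def ArithTrue (A : ArithFormula) (e : ℕ → ℕ) : Prop := A.Sat (fun p => p.elim) e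

def Term.vars : Term → Finset ℕ
  | .var x => {x}
  | .zero => ∅
  | .one => ∅
  | .add a b => a.vars ∪ b.vars
  | .mul a b => a.vars ∪ b.vars

def Formula.freeVars {P : Type} : Formula P → Finset ℕ
  | .eq a b => a.vars ∪ b.vars
  | .lt a b => a.vars ∪ b.vars
  | .pred _ a => a.vars
  | .neg A => A.freeVars
  | .and A B => A.freeVars ∪ B.freeVars
  | .or A B => A.freeVars ∪ B.freeVars
  | .imp A B => A.freeVars ∪ B.freeVars
  | .all x A => A.freeVars.erase x
  | .ex x A => A.freeVars.erase x

def Formula.IsSentence {P : Type} (A : Formula P) : Prop := A.freeVars = ∅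

/-- Gödel numbers of terms. -/
def Term.code : Term → ℕ
  | .var x => Nat.pair 0 x
  | .zero => Nat.pair 1 0
  | .one => Nat.pair 2 0
  | .add a b => Nat.pair 3 (Nat.pair a.code b.code)
  | .mul a b => Nat.pair 4 (Nat.pair a.code b.code)

/-- Gödel numbers of formulas of pure arithmetic. -/
def Formula.code : ArithFormula → ℕ
  | .eq a b => Nat.pair 0 (Nat.pair a.code b.code)
  | .lt a b => Nat.pair 1 (Nat.pair a.code b.code)
  | .pred p _ => p.elim
  | .neg A => Nat.pair 2 (Formula.code A)
  | .and A B => Nat.pair 3 (Nat.pair (Formula.code A) (Formula.code B))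
  | .or A B => Nat.pair 4 (Nat.pair (Formula.code A) (Formula.code B))
  | .imp A B => Nat.pair 5 (Nat.pair (Formula.code A) (Formula.code B))
  | .all x A => Nat.pair 6 (Nat.pair x (Formula.code A))
  | .ex x A => Nat.pair 7 (Nat.pair x (Formula.code A))

/-! ### Interactions -/

/-- In an interaction about a formula, one side plays the witness for the formula, the other side
uses (queries) that witness. -/
inductive Role where
  | witness
  | user

def Role.swap : Role → Role
  | .witness => .user
  | .user => .witness

/-- Moves are finite sequences of numbers; `[]` is whitespace (no move). How a move is read
depends on the formula that the interaction is about: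
* `∃x A`, `A ∨ B`: the witness plays `[n]` to choose the number `n`, respectively the disjunct
  `n ∈ {0, 1}`; afterwards `n :: m` is the move `m` in the interaction about the chosen formula.
* `∀x A`, `A ∧ B`: the user plays `[n]` to give the input `n`, respectively to ask for the conjunct
  `n ∈ {0, 1}`; afterwards `n :: m` is the move `m` in the interaction about `A(n)`, respectively
  that conjunct. Any number of inputs can be given.
* `A → B`: the user plays `[0, i, j, u]` to launch the instance number `i` as a copy of the
  instance number `j` up to time `u` (so `u = 0` launches an instance from scratch); afterwards,
  `1 :: i :: m` is the move `m` in the interaction about the antecedent `A`, and `2 :: i :: m` the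
  move `m` in the interaction about the consequent `B`, both in instance `i`.
All other moves have no effect. -/
abbrev Move : Type := List ℕ

/-- An infinite interaction: at each time `0, 1, 2, …` one of the two sides makes a move
(possibly whitespace). -/
abbrev Run : Type := ℕ → Role × Move

/-- At time `r` side `p` makes the move `m ∈ S`, and `p` made no move in `S` before. -/
def FirstMove (Γ : Run) (p : Role) (S : Set Move) (r : ℕ) (m : Move) : Prop :=
  m ∈ S ∧ Γ r = (p, m) ∧ ∀ q < r, ∀ m' ∈ S, Γ q ≠ (p, m')

/-- The part of an interaction that takes place in component `n`, which was opened at time `r`. -/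
def component (Γ : Run) (n r : ℕ) : Run := fun q =>
  match Γ q with
  | (p, k :: m) => if k = n ∧ r < q then (p, m) else (p, [])
  | (p, []) => (p, [])

/-- Instance `i` of an implication is launched at time `r`, as a copy of instance `j` up to
time `u`. A number that is in use cannot be launched again. -/
def LaunchedAt (Γ : Run) (i j u r : ℕ) : Prop :=
  FirstMove Γ .user {m | ∃ j' u', m = [0, i, j', u']} r [0, i, j, u]

/-- Instance `i` is launched before time `T`. -/
def LaunchedBefore (Γ : Run) (i T : ℕ) : Prop := ∃ r < T, ∃ j u, LaunchedAt Γ i j u r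

open Classical in
/-- The input and output in instance `i` of an implication as it stands when the moves made before
time `T` have been processed: `instanceHistory Γ T i q` is the move of time `q` in instance `i`,
with the number `i` removed. The history is blank while `i` has not been launched. Launching
copies the moves made before time `u` in instance `j`, with their times. -/
noncomputable def instanceHistory (Γ : Run) : ℕ → ℕ → Run
  | 0, _ => fun _ => (.user, [])
  | T + 1, i => fun q =>
    match Γ T with
    | (.user, [0, i', j, u]) =>
      if i' = i ∧ ¬ LaunchedBefore Γ i T then
        if q < u then instanceHistory Γ T j q else (.user, [])
      else instanceHistory Γ T i q
    | (p, k :: i' :: m) =>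
      if i' = i ∧ LaunchedBefore Γ i T ∧ (k = 1 ∨ k = 2) ∧ q = T then (p, k :: m)
      else instanceHistory Γ T i q
    | _ => instanceHistory Γ T i q

/-- The whole interaction in the instance `i` launched at time `r`. (The entry for time `q` does
not change any more once the moves up to the times `q` and `r` have been processed.) -/
noncomputable def instanceRun (Γ : Run) (i r : ℕ) : Run := fun q => instanceHistory Γ (r + q + 1) i q

/-- The interaction about the consequent in an instance. -/
def consequentRun (Δ : Run) : Run := fun q =>
  match Δ q with
  | (p, 2 :: m) => (p, m)
  | (p, _) => (p, [])

/-- The interaction about the antecedent in an instance; here the user of the implication plays the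
witness, so the roles are exchanged. -/
def antecedentRun (Δ : Run) : Run := fun q =>
  match Δ q with
  | (p, 1 :: m) => (p.swap, m)
  | (p, _) => (p.swap, [])

/-- `Met A e Γ t`: in the interaction `Γ` the requirements on a witness for the formula `A`, under
the assignment `e`, are met up to time `t`, that is, by the moves made at the times `q < t`;
`t = ⊤` is the time infinity. Once violated, the requirements stay violated. -/
def Met : ArithFormula → (ℕ → ℕ) → Run → ℕ∞ → Prop
  | .eq a b, e, _, _ => ArithTrue (.eq a b) e
  | .lt a b, e, _, _ => ArithTrue (.lt a b) e
  | .pred p _, _, _, _ => p.elim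
  | .neg A, e, _, _ => ArithTrue (.neg A) e
  | .and A B, e, Γ, t => ArithTrue (.and A B) e ∧
      (∀ r : ℕ, (r : ℕ∞) < t → FirstMove Γ .user {[0]} r [0] → Met A e (component Γ 0 r) t) ∧
      (∀ r : ℕ, (r : ℕ∞) < t → FirstMove Γ .user {[1]} r [1] → Met B e (component Γ 1 r) t)
  | .or A B, e, Γ, t => ArithTrue (.or A B) e ∧
      (t = ⊤ → ∃ r m, FirstMove Γ .witness {[0], [1]} r m) ∧
      (∀ r : ℕ, (r : ℕ∞) < t → FirstMove Γ .witness {[0], [1]} r [0] →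
        Met A e (component Γ 0 r) t) ∧
      (∀ r : ℕ, (r : ℕ∞) < t → FirstMove Γ .witness {[0], [1]} r [1] →
        Met B e (component Γ 1 r) t)
  | .imp A B, e, Γ, t => ArithTrue (.imp A B) e ∧
      ∀ i j u r : ℕ, (r : ℕ∞) < t → LaunchedAt Γ i j u r → ∀ s ≤ t,
        Met A e (antecedentRun (instanceRun Γ i r)) s →
          Met B e (consequentRun (instanceRun Γ i r)) s
  | .all x A, e, Γ, t => ArithTrue (.all x A) e ∧
      ∀ n r : ℕ, (r : ℕ∞) < t → FirstMove Γ .user {[n]} r [n] →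
        Met A (Function.update e x n) (component Γ n r) t
  | .ex x A, e, Γ, t => ArithTrue (.ex x A) e ∧
      (t = ⊤ → ∃ r m, FirstMove Γ .witness {m | ∃ n, m = [n]} r m) ∧
      ∀ n r : ℕ, (r : ℕ∞) < t → FirstMove Γ .witness {m | ∃ n', m = [n']} r [n] →
        Met A (Function.update e x n) (component Γ n r) t

/-! ### Narrow constructive truth -/

/-- An interactive function: the next move as a function of the moves of the other side so far. -/
abbrev Strategy : Type := List Move → Move

/-- The interaction of the strategy `σ` with the real number `X`, which codes the moves of the
other side. The strategy moves at even times, the other side at odd times; since both sides may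
play whitespace, neither has to wait for the other or to answer at once. -/
def play (σ : Strategy) (X : ℕ → Move) : Run := fun q =>
  if q % 2 = 0 then (.witness, σ ((List.range (q / 2)).map X)) else (.user, X (q / 2))

/-- `c` is a program for the strategy `σ`. -/
def Computes (c : Nat.Partrec.Code) (σ : Strategy) : Prop :=
  ∀ h : List Move, Encodable.encode (σ h) ∈ c.eval (Encodable.encode h)

/-- `c` is a narrow constructive witness for the sentence `A`: a code of a recursive interactive
function that meets the requirements against every real number. -/
def IsNarrowWitness (c : Nat.Partrec.Code) (A : ArithFormula) : Prop :=
  ∃ σ : Strategy, Computes c σ ∧ ∀ X : ℕ → Move, Met A (fun _ => 0) (play σ X) ⊤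

/-- Narrow constructive truth. -/
def NarrowTrue (A : ArithFormula) : Prop := ∃ c : Nat.Partrec.Code, IsNarrowWitness c A

/-- Narrow constructive arithmetical truth, as a set of Gödel numbers of sentences. -/
def narrowTruth : Set ℕ := {k | ∃ A : ArithFormula, A.IsSentence ∧ NarrowTrue A ∧ A.code = k}

/-! ### The class `Π¹₁` -/

/-- `S = {n | ∀ X ⊆ ℕ, φ(n, X)}` for an arithmetical formula `φ`. -/
def IsPi11 (S : Set ℕ) : Prop :=
  ∃ φ : SetFormula, φ.freeVars ⊆ {0} ∧
    ∀ n : ℕ, n ∈ S ↔ ∀ X : Set ℕ, φ.Sat (fun _ => X) (fun _ => n)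

/-- `S` is `Π¹₁`, and every `Π¹₁` set is many-one reducible to `S` by a recursive function. -/
def IsPi11Complete (S : Set ℕ) : Prop :=
  IsPi11 S ∧ ∀ R : Set ℕ, IsPi11 R → ManyOneReducible (fun n => n ∈ R) (fun n => n ∈ S)

end NarrowTruth

set_option linter.unusedSimpArgs false

/-! Upper bound. Truth and `Met`, uniformly in the formula, are not arithmetical, but each is the
only relation satisfying certain recursion clauses on codes (`iff_of_truthStep`, `iff_of_metStep`).
So a program meets the requirements against every real iff every set consisting of a real, truth
values and `Met` values that obeys the clauses contains the value wanted. The clauses are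
arithmetical in the set, because a first move inside a nested interaction is settled by a finite
part of the whole interaction (`exists_prefix_along`). The quantifier over programs moves behind the
set quantifier when one set codes a guess for every program (`mem_narrowTruth_iff_forall`).

Hardness. A `Π¹₁` set consists of the `n` for which an arithmetical tree `T n` has no infinite path
(`IsPi11.exists_tree`). To `n` belongs the sentence `∀c (∀s ∃k Answer → ∃y Good)`, whose matrices
are negations and so demand only truth. The input `c` is meant to be the number of the witness
program itself. Consider users who answer in the antecedent along finite branches of `T n`; if `c`
ever plays a number against one of them, one such play is singled out, and `Good` excludes just the
number played there. An answer to a finite sequence is even, extending the sequence inside the tree,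
or odd, disclosing some `y`. It is true if extensions respect the singled-out branch and if numbers
disclosed at sequences compatible with that branch are good.

If `T n` has no path, even answers followed from the empty sequence must end in an odd one
(`exists_chain`), and the number disclosed there is good (`good_of_chain`). The witness asks
everything, waits for such a chain and plays that number. Copied instances do no harm, since the
chain is copied along with the choice (`exists_chain_of_choice`).

If `T n` has a path, every program fails (`not_exists_path_of_met`). If some play is singled out,
the user repeats it truthfully, remaining silent where the branch gives no answer. This violates
nothing at finite times, but the number played is not good. If there is none, the user can
truthfully follow the infinite path, so the program must eventually play; it has then seen only
finitely many answers, and would have played against a finite branch as well. -/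

namespace NarrowTruth

/-! ### Arithmetical definability -/

/-- `P` is defined by a formula whose predicate symbols are interpreted by the first argument. -/
def Expressible {S : Type} (P : (S → Set ℕ) → (ℕ → ℕ) → Prop) : Prop :=
  ∃ φ : Formula S, ∀ I e, φ.Sat I e ↔ P I e

namespace Expressible

variable {S : Type}

/-- Simultaneous substitution by quantifiers: the values of `x`, `y`, `z` are parked in fresh
variables from `N` on before 0, 1, 2 are rebound, so nothing is captured. Other variables of `φ` are
harmless, as its truth depends on the first three values only. -/
theorem rename {P : (S → Set ℕ) → ℕ → ℕ → ℕ → Prop}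
    (h : Expressible fun I e => P I (e 0) (e 1) (e 2)) (x y z : ℕ) :
    Expressible fun I e => P I (e x) (e y) (e z) := by
  obtain ⟨φ, hφ⟩ := h
  let N := x + y + z + 3
  refine ⟨.ex N (.ex (N + 1) (.ex (N + 2) (.and (.and (.eq (.var N) (.var x))
    (.and (.eq (.var (N + 1)) (.var y)) (.eq (.var (N + 2)) (.var z))))
    (.ex 0 (.ex 1 (.ex 2 (.and (.and (.eq (.var 0) (.var N)) (.and (.eq (.var 1) (.var (N + 1)))
    (.eq (.var 2) (.var (N + 2))))) φ))))))), fun I e => ?_⟩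
  have h1 : x ≠ N := by omega
  have h2 : x ≠ N + 1 := by omega
  have h3 : x ≠ N + 2 := by omega
  have h4 : y ≠ N := by omega
  have h5 : y ≠ N + 1 := by omega
  have h6 : y ≠ N + 2 := by omega
  have h7 : z ≠ N := by omega
  have h8 : z ≠ N + 1 := by omega
  have h9 : z ≠ N + 2 := by omega
  have k1 : N ≠ 0 := by omega
  have k2 : N ≠ 1 := by omega
  have k3 : N ≠ 2 := by omega
  have k5 : N + 1 ≠ 1 := by omega
  have k6 : N + 1 ≠ 2 := by omega
  simp [Formula.Sat, hφ, Term.val, Function.update_apply, h1, h2, h3, h4, h5, h6, h7, h8, h9,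
    k1, k2, k3, k5]

theorem rename₂ {P : (S → Set ℕ) → ℕ → ℕ → Prop}
    (h : Expressible fun I e => P I (e 0) (e 1)) (x y : ℕ) :
    Expressible fun I e => P I (e x) (e y) :=
  rename (P := fun I a b _ => P I a b) h x y 0

theorem pair (x y z : ℕ) : Expressible (S := S) fun _ e => e x = Nat.pair (e y) (e z) := by
  refine rename (P := fun _ a b c => a = Nat.pair b c) ?_ x y z
  refine ⟨.or (.and (.lt (.var 1) (.var 2))
    (.eq (.var 0) (.add (.mul (.var 2) (.var 2)) (.var 1))))
    (.and (.neg (.lt (.var 1) (.var 2)))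
      (.eq (.var 0) (.add (.add (.mul (.var 1) (.var 1)) (.var 1)) (.var 2)))), fun I e => ?_⟩
  simp only [Formula.Sat, Term.val, Nat.pair]
  split_ifs with h <;> simp [h]

theorem exists_pair_iff {n : ℕ} {R : ℕ → ℕ → Prop} :
    (∃ a b, n = Nat.pair a b ∧ R a b) ↔ R n.unpair.1 n.unpair.2 := by
  constructor
  · rintro ⟨a, b, rfl, h⟩
    simpa using h
  · intro h
    exact ⟨_, _, (Nat.pair_unpair n).symm, h⟩

theorem eq_mod_iff {a d z : ℕ} : (z < d + 1 ∧ ∃ q, a = q * (d + 1) + z) ↔ z = a % (d + 1) := by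
  constructor
  · rintro ⟨h, q, rfl⟩
    rw [Nat.mul_comm, Nat.mul_add_mod, Nat.mod_eq_of_lt h]
  · rintro rfl
    exact ⟨Nat.mod_lt _ (Nat.succ_pos d), a / (d + 1), (Nat.div_add_mod' a (d + 1)).symm⟩

theorem beta (x y z : ℕ) : Expressible (S := S) fun _ e => e x = Nat.beta (e y) (e z) := by
  refine rename (P := fun _ a b c => a = Nat.beta b c) ?_ x y z
  obtain ⟨π, hπ⟩ := pair (S := S) 1 3 4
  let d : Term := .add (.mul (.add (.var 2) .one) (.var 4)) .one
  refine ⟨.ex 3 (.ex 4 (.and π (.and (.lt (.var 0) d)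
    (.ex 5 (.eq (.var 3) (.add (.mul (.var 5) d) (.var 0))))))), fun I e => ?_⟩
  simp only [Formula.Sat, hπ, Term.val, Function.update_apply, d]
  simp only [Nat.reduceEqDiff, if_false, if_true, reduceIte, OfNat.ofNat_ne_zero,
    OfNat.zero_ne_ofNat, OfNat.one_ne_ofNat, OfNat.ofNat_ne_one, zero_ne_one, one_ne_zero]
  rw [exists_pair_iff (R := fun a b => e 0 < (e 2 + 1) * b + 1 ∧
    ∃ q, a = q * ((e 2 + 1) * b + 1) + e 0), eq_mod_iff, Nat.beta]

end Expressible

/-- A partial function on `ℕ` with arithmetical graph. -/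
def ArithGraph (S : Type) (f : ℕ →. ℕ) : Prop :=
  Expressible (S := S) fun _ e => e 1 ∈ f (e 0)

theorem exists_beta (N : ℕ) (a : ℕ → ℕ) : ∃ b, ∀ i ≤ N, Nat.beta b i = a i := by
  refine ⟨Nat.unbeta ((List.range (N + 1)).map a), fun i hi => ?_⟩
  have := Nat.beta_unbeta_coe ((List.range (N + 1)).map a) ⟨i, by simp; omega⟩
  simpa using this

/-- Gödel's β function replaces the course of values of a recursion by a single number, so that
primitive recursion becomes first-order definable. -/
theorem mem_natRec_iff {f : Part ℕ} {g : ℕ → ℕ → Part ℕ} {n m : ℕ} :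
    m ∈ (n.rec f fun y IH => IH.bind (g y) : Part ℕ) ↔
      ∃ b, Nat.beta b 0 ∈ f ∧ (∀ y < n, Nat.beta b (y + 1) ∈ g y (Nat.beta b y)) ∧
        m = Nat.beta b n := by
  have key : ∀ n m, m ∈ (n.rec f fun y IH => IH.bind (g y) : Part ℕ) ↔
      ∃ a : ℕ → ℕ, a 0 ∈ f ∧ (∀ y < n, a (y + 1) ∈ g y (a y)) ∧ m = a n := by
    intro n
    induction n with
    | zero => exact fun m => ⟨fun h => ⟨fun _ => m, h, by simp⟩, by rintro ⟨a, h, -, rfl⟩; exact h⟩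
    | succ n ih =>
      intro m
      simp only [Part.mem_bind_iff, ih]
      constructor
      · rintro ⟨_, ⟨a, h0, h1, rfl⟩, h⟩
        refine ⟨fun i => if i ≤ n then a i else m, by simpa using h0, fun y hy => ?_, by simp⟩
        rcases Nat.lt_or_ge y n with hy' | hy'
        · simpa [hy'.le, Nat.succ_le_of_lt hy'] using h1 y hy'
        · obtain rfl : y = n := by omega
          simpa using h
      · rintro ⟨a, h0, h1, rfl⟩
        exact ⟨a n, ⟨a, h0, fun y hy => h1 y (by omega), rfl⟩, h1 n (by omega)⟩
  rw [key]
  constructor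
  · rintro ⟨a, h0, h1, rfl⟩
    obtain ⟨b, hb⟩ := exists_beta n a
    refine ⟨b, by rwa [hb 0 (by omega)], fun y hy => ?_, (hb n le_rfl).symm⟩
    rw [hb _ (by omega), hb _ (by omega)]
    exact h1 y hy
  · rintro ⟨b, h⟩
    exact ⟨Nat.beta b, h⟩

theorem _root_.Nat.Partrec.arithGraph {S : Type} {f : ℕ →. ℕ} (hf : Nat.Partrec f) :
    ArithGraph S f := by
  have ren {f : ℕ →. ℕ} (h : ArithGraph S f) (x y : ℕ) :
      Expressible (S := S) fun _ e => e y ∈ f (e x) :=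
    Expressible.rename₂ (P := fun _ a b => b ∈ f a) h x y
  induction hf with
  | zero => exact ⟨.eq (.var 1) .zero, fun I e => by simp [Formula.Sat, Term.val, pure, PFun.pure]⟩
  | succ =>
    exact ⟨.eq (.var 1) (.add (.var 0) .one), fun I e => by simp [Formula.Sat, Term.val]⟩
  | left =>
    obtain ⟨π, hπ⟩ := Expressible.pair (S := S) 0 2 3
    refine ⟨.ex 2 (.ex 3 (.and π (.eq (.var 1) (.var 2)))), fun I e => ?_⟩
    simp only [Formula.Sat, hπ, Term.val, Function.update_apply]
    simpa using Expressible.exists_pair_iff (R := fun a _ => e 1 = a)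
  | right =>
    obtain ⟨π, hπ⟩ := Expressible.pair (S := S) 0 2 3
    refine ⟨.ex 2 (.ex 3 (.and π (.eq (.var 1) (.var 3)))), fun I e => ?_⟩
    simp only [Formula.Sat, hπ, Term.val, Function.update_apply]
    simpa using Expressible.exists_pair_iff (R := fun _ b => e 1 = b)
  | pair _ _ hf hg =>
    obtain ⟨π, hπ⟩ := Expressible.pair (S := S) 1 2 3
    obtain ⟨φ, hφ⟩ := ren hf 0 2
    obtain ⟨ψ, hψ⟩ := ren hg 0 3
    refine ⟨.ex 2 (.ex 3 (.and π (.and φ ψ))), fun I e => ?_⟩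
    simp [Formula.Sat, hπ, hφ, hψ, Seq.seq, Part.mem_bind_iff, Function.update_apply]
    grind
  | comp _ _ hf hg =>
    obtain ⟨φ, hφ⟩ := ren hf 2 1
    obtain ⟨ψ, hψ⟩ := ren hg 0 2
    refine ⟨.ex 2 (.and ψ φ), fun I e => ?_⟩
    simp only [Formula.Sat, hφ, hψ, Function.update_apply]
    simp only [if_true, OfNat.zero_ne_ofNat, OfNat.one_ne_ofNat, if_false]
    exact Part.mem_bind_iff.symm
  | @prec f g _ _ hf hg =>
    obtain ⟨π, hπ⟩ := Expressible.pair (S := S) 0 2 3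
    obtain ⟨β₀, hβ₀⟩ := Expressible.beta (S := S) 5 4 6
    obtain ⟨φ, hφ⟩ := ren hf 2 5
    obtain ⟨β₁, hβ₁⟩ := Expressible.beta (S := S) 7 4 6
    obtain ⟨β₂, hβ₂⟩ := Expressible.beta (S := S) 8 4 9
    obtain ⟨π₁, hπ₁⟩ := Expressible.pair (S := S) 10 6 7
    obtain ⟨π₂, hπ₂⟩ := Expressible.pair (S := S) 11 2 10
    obtain ⟨ψ, hψ⟩ := ren hg 11 8
    obtain ⟨β₃, hβ₃⟩ := Expressible.beta (S := S) 1 4 3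
    refine ⟨.ex 2 (.ex 3 (.and π (.ex 4 (.and
      (.ex 5 (.and (.ex 6 (.and (.eq (.var 6) .zero) β₀)) φ)) (.and
      (.all 6 (.imp (.lt (.var 6) (.var 3)) (.ex 7 (.ex 8 (.and β₁ (.and
        (.ex 9 (.and (.eq (.var 9) (.add (.var 6) .one)) β₂))
        (.ex 10 (.ex 11 (.and π₁ (.and π₂ ψ))))))))))
      β₃))))), fun I e => ?_⟩
    simp only [Formula.Sat, hπ, hβ₀, hφ, hβ₁, hβ₂, hπ₁, hπ₂, hψ, hβ₃, Term.val,
      Function.update_apply]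
    simp only [Nat.reduceEqDiff, if_false, if_true, reduceIte, OfNat.ofNat_ne_zero,
      OfNat.zero_ne_ofNat, OfNat.one_ne_ofNat, OfNat.ofNat_ne_one, zero_ne_one, one_ne_zero,
      Nat.unpaired]
    rw [Expressible.exists_pair_iff (R := fun a n => ∃ b, (∃ v, (∃ z, z = 0 ∧ v = Nat.beta b z) ∧
      v ∈ f a) ∧ (∀ y < n, ∃ v w, v = Nat.beta b y ∧ (∃ z, z = y + 1 ∧ w = Nat.beta b z) ∧
        ∃ p q, p = Nat.pair y v ∧ q = Nat.pair a p ∧ w ∈ g q) ∧ e 1 = Nat.beta b n)]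
    refine Iff.trans ?_ (mem_natRec_iff (g := fun y i => g (Nat.pair _ (Nat.pair y i)))).symm
    simp
  | @rfind f _ hf =>
    obtain ⟨π₁, hπ₁⟩ := Expressible.pair (S := S) 3 0 2
    obtain ⟨φ, hφ⟩ := ren hf 3 4
    refine ⟨.all 2 (.and (.imp (.eq (.var 2) (.var 1))
        (.ex 3 (.and π₁ (.ex 4 (.and (.eq (.var 4) .zero) φ)))))
      (.imp (.lt (.var 2) (.var 1))
        (.ex 3 (.and π₁ (.ex 4 (.and (.lt .zero (.var 4)) φ)))))), fun I e => ?_⟩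
    simp only [Formula.Sat, hπ₁, hφ, Term.val, Function.update_apply]
    simp only [Nat.reduceEqDiff, if_false, if_true, reduceIte, OfNat.ofNat_ne_zero,
      OfNat.zero_ne_ofNat, OfNat.one_ne_ofNat, OfNat.ofNat_ne_one, zero_ne_one, one_ne_zero]
    refine Iff.trans ?_ Nat.mem_rfind.symm
    simp only [forall_and, forall_eq, exists_eq_left, Part.map_eq_map, Part.mem_map_iff, eq_comm (a := true),
      eq_comm (a := false), decide_eq_true_eq, decide_eq_false_iff_not, exists_eq_right]
    refine and_congr Iff.rfl ?_
    refine forall₂_congr fun m _ => ⟨?_, ?_⟩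
    · rintro ⟨v, h1, h2⟩
      exact ⟨v, h2, h1.ne'⟩
    · rintro ⟨v, h2, h1⟩
      exact ⟨v, Nat.pos_of_ne_zero h1, h2⟩

/-! ### Closure properties of arithmetical predicates on coded data -/

variable {S : Type} {α β γ : Type} [Primcodable α] [Primcodable β] [Primcodable γ]

open Encodable

/-- `P` is arithmetical in the sets given by its first argument. -/
def Arith (P : (S → Set ℕ) → α → Prop) : Prop :=
  ∃ φ : Formula S, ∀ I e a, e 0 = encode a → (φ.Sat I e ↔ P I a)

namespace Arith

variable {P Q : (S → Set ℕ) → α → Prop}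

theorem of_iff (h : Arith P) (hPQ : ∀ I a, Q I a ↔ P I a) : Arith Q := by
  obtain ⟨φ, hφ⟩ := h
  exact ⟨φ, fun I e a ha => (hφ I e a ha).trans (hPQ I a).symm⟩

theorem and (hP : Arith P) (hQ : Arith Q) : Arith fun I a => P I a ∧ Q I a := by
  obtain ⟨φ, hφ⟩ := hP
  obtain ⟨ψ, hψ⟩ := hQ
  exact ⟨.and φ ψ, fun I e a h => by simp [Formula.Sat, hφ I e a h, hψ I e a h]⟩

theorem or (hP : Arith P) (hQ : Arith Q) : Arith fun I a => P I a ∨ Q I a := by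
  obtain ⟨φ, hφ⟩ := hP
  obtain ⟨ψ, hψ⟩ := hQ
  exact ⟨.or φ ψ, fun I e a h => by simp [Formula.Sat, hφ I e a h, hψ I e a h]⟩

theorem imp (hP : Arith P) (hQ : Arith Q) : Arith fun I a => P I a → Q I a := by
  obtain ⟨φ, hφ⟩ := hP
  obtain ⟨ψ, hψ⟩ := hQ
  exact ⟨.imp φ ψ, fun I e a h => by simp [Formula.Sat, hφ I e a h, hψ I e a h]⟩

theorem not (hP : Arith P) : Arith fun I a => ¬ P I a := by
  obtain ⟨φ, hφ⟩ := hP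
  exact ⟨.neg φ, fun I e a h => by simp [Formula.Sat, hφ I e a h]⟩

theorem iff (hP : Arith P) (hQ : Arith Q) : Arith fun I a => (P I a ↔ Q I a) :=
  ((hP.imp hQ).and (hQ.imp hP)).of_iff fun _ _ => iff_def

theorem expressible (hP : Arith P) (x : ℕ) :
    ∃ φ : Formula S, ∀ I e a, e x = encode a → (φ.Sat I e ↔ P I a) := by
  obtain ⟨φ, hφ⟩ := hP
  refine ⟨.ex (x + 1) (.and (.eq (.var (x + 1)) (.var x))
    (.ex 0 (.and (.eq (.var 0) (.var (x + 1))) φ))), fun I e a h => ?_⟩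
  simp [Formula.Sat, Term.val, hφ I _ a, h]

theorem graph {f : α →. β} (hf : Partrec f) :
    Arith (S := S) fun _ (p : α × β) => p.2 ∈ f p.1 := by
  obtain ⟨φ, hφ⟩ := Expressible.rename₂
    (S := S)
    (P := fun _ a b => b ∈ (Part.bind (decode (α := α) a : Part α) fun a => (f a).map encode))
    hf.arithGraph 1 2
  obtain ⟨π, hπ⟩ := Expressible.pair (S := S) 0 1 2
  refine ⟨.ex 1 (.ex 2 (.and π φ)), fun I e ⟨a, b⟩ h => ?_⟩
  simp only [Formula.Sat, hπ, hφ, Function.update_apply]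
  simp only [Nat.reduceEqDiff, if_false, if_true, reduceIte, OfNat.ofNat_ne_zero,
    OfNat.zero_ne_ofNat, OfNat.one_ne_ofNat, OfNat.ofNat_ne_one, zero_ne_one, one_ne_zero]
  rw [Expressible.exists_pair_iff (R := fun a b =>
    b ∈ (Part.bind (decode (α := α) a : Part α) fun a => (f a).map encode)), h]
  simp [encode_inj, encode_prod_val]

theorem comp {P : (S → Set ℕ) → β → Prop} (hP : Arith P) {f : α → β} (hf : Computable f) :
    Arith fun I a => P I (f a) := by
  obtain ⟨φ, hφ⟩ := hf.partrec.arithGraph (S := S)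
  obtain ⟨ψ, hψ⟩ := hP.expressible 1
  refine ⟨.ex 1 (.and φ ψ), fun I e a h => ?_⟩
  simp only [Formula.Sat, hφ, Function.update_apply, h]
  simp only [if_true, zero_ne_one, if_false, reduceIte, encodek, Part.coe_some, Part.bind_some,
    PFun.coe_val, Part.map_some, Part.mem_some_iff]
  constructor
  · rintro ⟨_, rfl, h'⟩
    exact (hψ I _ _ (by simp)).1 h'
  · exact fun h' => ⟨_, rfl, (hψ I _ _ (by simp)).2 h'⟩

theorem of_computablePred {p : α → Prop} (hp : ComputablePred p) :
    Arith (S := S) fun _ a => p a := by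
  obtain ⟨_, hp⟩ := hp
  refine ((graph hp.partrec).comp (Computable.id.pair (Computable.const true))).of_iff
    fun _ a => ?_
  simp

theorem of_primrecPred {p : α → Prop} (hp : PrimrecPred p) : Arith (S := S) fun _ a => p a :=
  of_computablePred hp.computablePred

theorem exists' {P : (S → Set ℕ) → α → β → Prop}
    (hP : Arith fun I (p : α × β) => P I p.1 p.2) : Arith fun I a => ∃ b, P I a b := by
  obtain ⟨φ, hφ⟩ := hP.expressible 2
  obtain ⟨π, hπ⟩ := Expressible.pair (S := S) 2 0 1
  obtain ⟨ρ, hρ⟩ := (of_primrecPred (S := S) (Primcodable.mem_range_encode (α := β))).expressible 1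
  -- `ρ` restricts the quantifier to codes of elements of `β`; nothing is known of `φ` at other
  -- numbers.
  refine ⟨.ex 1 (.and ρ (.ex 2 (.and π φ))), fun I e a h => ?_⟩
  simp only [Formula.Sat, hπ, Function.update_apply]
  simp only [Nat.reduceEqDiff, if_false, if_true, reduceIte, OfNat.ofNat_ne_zero,
    OfNat.zero_ne_ofNat, OfNat.one_ne_ofNat, OfNat.ofNat_ne_one, zero_ne_one, one_ne_zero,
    exists_eq_left]
  constructor
  · rintro ⟨m, h1, h2⟩
    obtain ⟨b, rfl⟩ := (hρ I _ m (by simp)).1 h1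
    exact ⟨b, (hφ I _ (a, b) (by simp [h])).1 h2⟩
  · rintro ⟨b, hb⟩
    exact ⟨encode b, (hρ I _ (encode b) (by simp)).2 ⟨b, rfl⟩,
      (hφ I _ (a, b) (by simp [h])).2 hb⟩

theorem forall' {P : (S → Set ℕ) → α → β → Prop}
    (hP : Arith fun I (p : α × β) => P I p.1 p.2) : Arith fun I a => ∀ b, P I a b :=
  (exists' (P := fun I a b => ¬ P I a b) hP.not).not.of_iff fun I a => by simp

theorem mem_set (s : S) {f : α → ℕ} (hf : Computable f) : Arith fun I a => f a ∈ I s :=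
  Arith.comp (P := fun I n => n ∈ I s) ⟨.pred s (.var 0), fun I e a h => by
    simp [Formula.Sat, Term.val, h]⟩ hf

theorem mem_partrec {f : β →. γ} (hf : Partrec f) {g : α → β} (hg : Computable g) {h : α → γ}
    (hh : Computable h) : Arith (S := S) fun _ a => h a ∈ f (g a) :=
  (graph hf).comp (hg.pair hh)

end Arith

/-- The constructions above leave stray free variables that do not influence truth. Since `ℕ` is
nonempty, each can be bound by a vacuous existential quantifier. -/
theorem Formula.exists_closure {φ : Formula S} {P : (S → Set ℕ) → (ℕ → ℕ) → Prop} {V : Finset ℕ}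
    (hφ : ∀ I e, φ.Sat I e ↔ P I e)
    (hP : ∀ I e e', (∀ x ∈ V, e x = e' x) → (P I e ↔ P I e')) :
    ∃ ψ : Formula S, ψ.freeVars ⊆ V ∧ ∀ I e, ψ.Sat I e ↔ P I e := by
  suffices ∀ (W : Finset ℕ) (φ : Formula S), (∀ I e, φ.Sat I e ↔ P I e) → φ.freeVars ⊆ V ∪ W →
      ∃ ψ : Formula S, ψ.freeVars ⊆ V ∧ ∀ I e, ψ.Sat I e ↔ P I e from
    this φ.freeVars φ hφ Finset.subset_union_right
  intro W
  induction W using Finset.induction_on with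
  | empty => exact fun φ h1 h2 => ⟨φ, by simpa using h2, h1⟩
  | insert x W _ ih =>
    intro φ h1 h2
    by_cases hx : x ∈ V
    · exact ih φ h1 (h2.trans fun y => by simp only [Finset.mem_union, Finset.mem_insert]; grind)
    · refine ih (.ex x φ) (fun I e => ?_) fun y => ?_
      · simp only [Formula.Sat, h1]
        have (n : ℕ) : P I (Function.update e x n) ↔ P I e := hP _ _ _ fun y hy => by
          rw [Function.update_of_ne]
          rintro rfl
          exact hx hy
        simp [this]
      · have := @h2 y
        simp only [Formula.freeVars, Finset.mem_erase, Finset.mem_union, Finset.mem_insert] at this ⊢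
        tauto

theorem Arith.exists_formula {P : (S → Set ℕ) → ℕ → Prop} (hP : Arith P) :
    ∃ φ : Formula S, φ.freeVars ⊆ {0} ∧ ∀ I n, φ.Sat I (fun _ => n) ↔ P I n := by
  obtain ⟨φ, hφ⟩ := hP
  obtain ⟨ψ, h1, h2⟩ := Formula.exists_closure (φ := φ) (P := fun I e => P I (e 0)) (V := {0})
    (fun I e => hφ I e _ rfl) fun I e e' h => by simp [h 0 (by simp)]
  exact ⟨ψ, h1, fun I n => h2 I _⟩

end NarrowTruth

/-! ### Primitive recursive functions, in a form suitable for `fun_prop` -/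

attribute [fun_prop] Primrec PrimrecPred
attribute [fun_prop] Primrec.id Primrec.const Primrec.comp Primrec.pair

namespace NarrowTruth.Prim

variable {α β γ δ : Type} [Primcodable α] [Primcodable β] [Primcodable γ] [Primcodable δ]

@[fun_prop] theorem fst {f : α → β × γ} (hf : Primrec f) : Primrec fun a => (f a).1 :=
  Primrec.fst.comp hf

@[fun_prop] theorem snd {f : α → β × γ} (hf : Primrec f) : Primrec fun a => (f a).2 :=
  Primrec.snd.comp hf

@[fun_prop] theorem add {f g : α → ℕ} (hf : Primrec f) (hg : Primrec g) :
    Primrec fun a => f a + g a := Primrec.nat_add.comp hf hg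

@[fun_prop] theorem sub {f g : α → ℕ} (hf : Primrec f) (hg : Primrec g) :
    Primrec fun a => f a - g a := Primrec.nat_sub.comp hf hg

@[fun_prop] theorem mul {f g : α → ℕ} (hf : Primrec f) (hg : Primrec g) :
    Primrec fun a => f a * g a := Primrec.nat_mul.comp hf hg

@[fun_prop] theorem div {f g : α → ℕ} (hf : Primrec f) (hg : Primrec g) :
    Primrec fun a => f a / g a := Primrec.nat_div.comp hf hg

@[fun_prop] theorem mod {f g : α → ℕ} (hf : Primrec f) (hg : Primrec g) :
    Primrec fun a => f a % g a := Primrec.nat_mod.comp hf hg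

@[fun_prop] theorem natPair {f g : α → ℕ} (hf : Primrec f) (hg : Primrec g) :
    Primrec fun a => Nat.pair (f a) (g a) := Primrec₂.natPair.comp hf hg

@[fun_prop] theorem unpair {f : α → ℕ} (hf : Primrec f) : Primrec fun a => Nat.unpair (f a) :=
  Primrec.unpair.comp hf

@[fun_prop] theorem encode {f : α → β} (hf : Primrec f) : Primrec fun a => Encodable.encode (f a) :=
  Primrec.encode.comp hf

@[fun_prop] theorem ofNat {β : Type} [Denumerable β] {f : α → ℕ} (hf : Primrec f) :
    Primrec fun a => Denumerable.ofNat β (f a) := (Primrec.ofNat β).comp hf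

@[fun_prop] theorem some {f : α → β} (hf : Primrec f) : Primrec fun a => some (f a) :=
  Primrec.option_some.comp hf

@[fun_prop] theorem inl {f : α → β} (hf : Primrec f) : Primrec fun a => (Sum.inl (f a) : β ⊕ γ) :=
  Primrec.sumInl.comp hf

@[fun_prop] theorem inr {f : α → γ} (hf : Primrec f) : Primrec fun a => (Sum.inr (f a) : β ⊕ γ) :=
  Primrec.sumInr.comp hf

@[fun_prop] theorem sumElim {f : α → β → δ} {g : α → γ → δ} {h : α → β ⊕ γ}
    (hf : Primrec fun p : α × β => f p.1 p.2) (hg : Primrec fun p : α × γ => g p.1 p.2)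
    (hh : Primrec h) : Primrec fun a => Sum.elim (f a) (g a) (h a) :=
  (Primrec.sumCasesOn (f := h) (g := f) (h := g) hh hf hg).of_eq fun a => by
    cases h a <;> rfl

@[fun_prop] theorem cons {f : α → β} {g : α → List β} (hf : Primrec f) (hg : Primrec g) :
    Primrec fun a => f a :: g a := Primrec.list_cons.comp hf hg

@[fun_prop] theorem append {f g : α → List β} (hf : Primrec f) (hg : Primrec g) :
    Primrec fun a => f a ++ g a := Primrec.list_append.comp hf hg

@[fun_prop] theorem tail {f : α → List β} (hf : Primrec f) : Primrec fun a => (f a).tail :=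
  Primrec.list_tail.comp hf

@[fun_prop] theorem head? {f : α → List β} (hf : Primrec f) : Primrec fun a => (f a).head? :=
  Primrec.list_head?.comp hf

@[fun_prop] theorem reverse {f : α → List β} (hf : Primrec f) : Primrec fun a => (f a).reverse :=
  Primrec.list_reverse.comp hf

@[fun_prop] theorem length {f : α → List β} (hf : Primrec f) : Primrec fun a => (f a).length :=
  Primrec.list_length.comp hf

@[fun_prop] theorem take {f : α → ℕ} {g : α → List β} (hf : Primrec f) (hg : Primrec g) :
    Primrec fun a => (g a).take (f a) := Primrec.list_take.comp hf hg

@[fun_prop] theorem range {f : α → ℕ} (hf : Primrec f) : Primrec fun a => List.range (f a) :=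
  Primrec.list_range.comp hf

@[fun_prop] theorem getD {f : α → List β} {g : α → ℕ} {d : β} (hf : Primrec f) (hg : Primrec g) :
    Primrec fun a => (f a).getD (g a) d := (Primrec.list_getD d).comp hf hg

@[fun_prop] theorem getElem? {f : α → List β} {g : α → ℕ} (hf : Primrec f) (hg : Primrec g) :
    Primrec fun a => (f a)[g a]? := Primrec.list_getElem?.comp hf hg

@[fun_prop] theorem map {f : α → List β} {g : α → β → γ} (hf : Primrec f)
    (hg : Primrec fun p : α × β => g p.1 p.2) : Primrec fun a => (f a).map (g a) :=
  Primrec.list_map hf hg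

@[fun_prop] theorem foldl {f : α → List β} {g : α → γ} {h : α → γ → β → γ} (hf : Primrec f)
    (hg : Primrec g) (hh : Primrec fun p : α × γ × β => h p.1 p.2.1 p.2.2) :
    Primrec fun a => (f a).foldl (h a) (g a) :=
  Primrec.list_foldl (h := fun a p => h a p.1 p.2) hf hg hh

@[fun_prop] theorem foldr {f : α → List β} {g : α → γ} {h : α → β → γ → γ} (hf : Primrec f)
    (hg : Primrec g) (hh : Primrec fun p : α × β × γ => h p.1 p.2.1 p.2.2) :
    Primrec fun a => (f a).foldr (h a) (g a) :=
  Primrec.list_foldr (h := fun a p => h a p.1 p.2) hf hg hh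

@[fun_prop] theorem ite {p : α → Prop} [DecidablePred p] {f g : α → β} (hp : PrimrecPred p)
    (hf : Primrec f) (hg : Primrec g) : Primrec fun a => if p a then f a else g a :=
  Primrec.ite hp hf hg

@[fun_prop] theorem eq {f g : α → β} (hf : Primrec f) (hg : Primrec g) :
    PrimrecPred fun a => f a = g a := Primrec.eq.comp hf hg

@[fun_prop] theorem lt {f g : α → ℕ} (hf : Primrec f) (hg : Primrec g) :
    PrimrecPred fun a => f a < g a := Primrec.nat_lt.comp hf hg

@[fun_prop] theorem le {f g : α → ℕ} (hf : Primrec f) (hg : Primrec g) :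
    PrimrecPred fun a => f a ≤ g a := Primrec.nat_le.comp hf hg

@[fun_prop] theorem and {p q : α → Prop} (hp : PrimrecPred p) (hq : PrimrecPred q) :
    PrimrecPred fun a => p a ∧ q a := PrimrecPred.and hp hq

@[fun_prop] theorem or {p q : α → Prop} (hp : PrimrecPred p) (hq : PrimrecPred q) :
    PrimrecPred fun a => p a ∨ q a := PrimrecPred.or hp hq

@[fun_prop] theorem not {p : α → Prop} (hp : PrimrecPred p) : PrimrecPred fun a => ¬ p a :=
  PrimrecPred.not hp

@[fun_prop] theorem exists_mem {f : α → List β} {p : α → β → Prop} (hf : Primrec f)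
    (hp : PrimrecPred fun q : α × β => p q.1 q.2) : PrimrecPred fun a => ∃ b ∈ f a, p a b :=
  (PrimrecRel.exists_mem_list (R := fun b a => p a b)
    (hp.comp (Primrec.snd.pair Primrec.fst))).comp hf .id

@[fun_prop] theorem forall_mem {f : α → List β} {p : α → β → Prop} (hf : Primrec f)
    (hp : PrimrecPred fun q : α × β => p q.1 q.2) : PrimrecPred fun a => ∀ b ∈ f a, p a b :=
  (PrimrecRel.forall_mem_list (R := fun b a => p a b)
    (hp.comp (Primrec.snd.pair Primrec.fst))).comp hf .id

@[fun_prop] theorem exists_lt {f : α → ℕ} {p : α → ℕ → Prop} (hf : Primrec f)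
    (hp : PrimrecPred fun q : α × ℕ => p q.1 q.2) : PrimrecPred fun a => ∃ n < f a, p a n :=
  (exists_mem (range hf) hp).of_eq fun a => by simp

@[fun_prop] theorem forall_lt {f : α → ℕ} {p : α → ℕ → Prop} (hf : Primrec f)
    (hp : PrimrecPred fun q : α × ℕ => p q.1 q.2) : PrimrecPred fun a => ∀ n < f a, p a n :=
  (forall_mem (range hf) hp).of_eq fun a => by simp

end NarrowTruth.Prim

namespace NarrowTruth

/-! ### Finite parts of interactions -/

def Role.equivBool : Role ≃ Bool where
  toFun | .witness => true | .user => false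
  invFun | true => .witness | false => .user
  left_inv p := by cases p <;> rfl
  right_inv b := by cases b <;> rfl

instance : Primcodable Role := Primcodable.ofEquiv Bool Role.equivBool

instance : DecidableEq Role := Role.equivBool.decidableEq

instance : Finite Role := .of_equiv Bool Role.equivBool.symm

@[fun_prop] theorem Role.primrec_swap {α : Type} [Primcodable α] {f : α → Role} (hf : Primrec f) :
    Primrec fun a => (f a).swap := (Primrec.dom_finite Role.swap).comp hf

abbrev Trace : Type := List (Role × Move)

def blank : Role × Move := (.user, [])

/-- The moves made before time `N`. -/
def Run.prefix (Γ : Run) (N : ℕ) : Trace := (List.range N).map Γ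

@[simp] theorem Run.length_prefix (Γ : Run) (N : ℕ) : (Γ.prefix N).length = N := by
  simp [Run.prefix]

theorem Run.getElem?_prefix (Γ : Run) {N q : ℕ} (h : q < N) : (Γ.prefix N)[q]? = some (Γ q) := by
  simp [Run.prefix, h]

theorem Run.getD_prefix (Γ : Run) {N q : ℕ} (h : q < N) (d : Role × Move) :
    (Γ.prefix N).getD q d = Γ q := by
  simp [Run.prefix, h]

theorem Run.reverse_prefix_succ (Γ : Run) (N : ℕ) :
    (Γ.prefix (N + 1)).reverse = Γ N :: (Γ.prefix N).reverse := by
  simp [Run.prefix, List.range_succ]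

/-- The effect of passing to component `n`, opened at time `r`, on the move `x` of time `q`. -/
def componentStep (n r q : ℕ) (x : Role × Move) : Role × Move :=
  (x.1, if x.2.head? = some n ∧ r < q then x.2.tail else [])

theorem component_apply (Γ : Run) (n r q : ℕ) :
    component Γ n r q = componentStep n r q (Γ q) := by
  unfold component componentStep
  rcases Γ q with ⟨p, _ | ⟨k, m⟩⟩
  · simp
  · simp only [List.head?_cons, Option.some.injEq, List.tail_cons]
    split_ifs <;> rfl

def antecedentStep (x : Role × Move) : Role × Move :=
  (x.1.swap, if x.2.head? = some 1 then x.2.tail else [])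

def consequentStep (x : Role × Move) : Role × Move :=
  (x.1, if x.2.head? = some 2 then x.2.tail else [])

theorem antecedentRun_apply (Δ : Run) (q : ℕ) : antecedentRun Δ q = antecedentStep (Δ q) := by
  unfold antecedentRun antecedentStep
  rcases Δ q with ⟨p, _ | ⟨k, m⟩⟩
  · simp
  · by_cases h : k = 1
    · subst h; simp
    · simp [h]

theorem consequentRun_apply (Δ : Run) (q : ℕ) : consequentRun Δ q = consequentStep (Δ q) := by
  unfold consequentRun consequentStep
  rcases Δ q with ⟨p, _ | ⟨k, m⟩⟩
  · simp
  · by_cases h : k = 2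
    · subst h; simp
    · simp [h]

def IsLaunch (i : ℕ) (x : Role × Move) : Prop :=
  x.1 = .user ∧ x.2.length = 4 ∧ x.2.getD 0 0 = 0 ∧ x.2.getD 1 0 = i

theorem isLaunch_iff {i : ℕ} {x : Role × Move} :
    IsLaunch i x ↔ ∃ j u, x = (.user, [0, i, j, u]) := by
  obtain ⟨p, m⟩ := x
  constructor
  · rintro ⟨rfl, h1, h2, h3⟩
    match m, h1 with
    | [a, b, c, d], _ =>
      simp only [List.getD_cons_zero, List.getD_cons_succ] at h2 h3
      exact ⟨c, d, by simp [h2, h3]⟩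
  · rintro ⟨j, u, h⟩
    cases h
    simp [IsLaunch]

instance (i : ℕ) (x : Role × Move) : Decidable (IsLaunch i x) := by
  unfold IsLaunch; infer_instance

/-- The demand that the launch be the first one with its number costs nothing: the least time of a
launching move satisfies it. -/
theorem launchedBefore_iff {Γ : Run} {i T : ℕ} :
    LaunchedBefore Γ i T ↔ ∃ r < T, IsLaunch i (Γ r) := by
  classical
  constructor
  · rintro ⟨r, hr, j, u, -, h, -⟩
    exact ⟨r, hr, isLaunch_iff.2 ⟨j, u, h⟩⟩
  · intro h
    have hs := Nat.find_spec h
    obtain ⟨j, u, h1⟩ := isLaunch_iff.1 hs.2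
    refine ⟨Nat.find h, hs.1, j, u, ⟨j, u, rfl⟩, h1, ?_⟩
    rintro q hq m' ⟨j', u', rfl⟩ h2
    exact Nat.find_min h hq ⟨hq.trans hs.1, isLaunch_iff.2 ⟨j', u', h2⟩⟩

/-- What the move `x` that follows the moves `l` (latest move first) does to the entry for time
`q` in instance `i`: either the entry is `x`, up to its tags, or that of an instance at an earlier
time. -/
def historyStep (q : ℕ) (l : Trace) (i : ℕ) (x : Role × Move) : ℕ ⊕ (Role × Move) :=
  if IsLaunch i x then
    if ∃ y ∈ l, IsLaunch i y then .inl i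
    else if q < x.2.getD 3 0 then .inl (x.2.getD 2 0) else .inr blank
  else if (2 ≤ x.2.length ∧ x.2.getD 1 0 = i) ∧ (∃ y ∈ l, IsLaunch i y) ∧
      (x.2.head? = some 1 ∨ x.2.head? = some 2) ∧ q = l.length then
    .inr (x.1, x.2.take 1 ++ x.2.tail.tail)
  else .inl i

section

variable {q i : ℕ} {l : Trace} {x : Role × Move}

theorem historyStep_of_launched (hx : IsLaunch i x) (hl : ∃ y ∈ l, IsLaunch i y) :
    historyStep q l i x = .inl i := by
  rw [historyStep, if_pos hx, if_pos hl]

theorem historyStep_of_launch {j u : ℕ} (hl : ¬ ∃ y ∈ l, IsLaunch i y) :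
    historyStep q l i (.user, [0, i, j, u]) = if q < u then .inl j else .inr blank := by
  rw [historyStep, if_pos (isLaunch_iff.2 ⟨j, u, rfl⟩), if_neg hl]
  rfl

theorem historyStep_of_move {p : Role} {k : ℕ} {m : Move} (hl : ∃ y ∈ l, IsLaunch i y)
    (hk : k = 1 ∨ k = 2) (hq : q = l.length) :
    historyStep q l i (p, k :: i :: m) = .inr (p, k :: m) := by
  rw [historyStep, if_neg, if_pos ⟨by simp, hl, by simpa using hk, hq⟩]
  · rfl
  · rintro ⟨-, -, h, -⟩
    simp at h
    omega

theorem historyStep_of_not (hx : ¬ IsLaunch i x) (h : ¬ ∃ p k m, x = (p, k :: i :: m) ∧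
    (∃ y ∈ l, IsLaunch i y) ∧ (k = 1 ∨ k = 2) ∧ q = l.length) :
    historyStep q l i x = .inl i := by
  rw [historyStep, if_neg hx, if_neg]
  rintro ⟨⟨h1, h2⟩, h3, h4, h5⟩
  obtain ⟨p, m⟩ := x
  match m, h1 with
  | k :: i' :: m, _ =>
    simp only [List.getD_cons_succ, List.getD_cons_zero] at h2
    exact h ⟨p, k, m, by rw [h2], h3, by simpa using h4, h5⟩

end

theorem exists_isLaunch_iff {Γ : Run} {i T : ℕ} :
    (∃ y ∈ (Γ.prefix T).reverse, IsLaunch i y) ↔ LaunchedBefore Γ i T := by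
  rw [launchedBefore_iff]
  simp [Run.prefix]

/-- Each step back in time either settles an entry or refers it to one instance at the preceding
time. This is tail recursion, hence computable by a fold over the moves. -/
theorem instanceHistory_succ (Γ : Run) (T i q : ℕ) :
    instanceHistory Γ (T + 1) i q =
      (historyStep q (Γ.prefix T).reverse i (Γ T)).elim (fun j => instanceHistory Γ T j q) id := by
  rw [instanceHistory]
  split
  · next i' j u h =>
    rw [h]
    by_cases hi : i' = i
    · subst hi
      by_cases hb : LaunchedBefore Γ i' T
      · rw [historyStep_of_launched (isLaunch_iff.2 ⟨j, u, rfl⟩) (exists_isLaunch_iff.2 hb)]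
        simp [hb]
      · rw [historyStep_of_launch (by rwa [exists_isLaunch_iff])]
        by_cases hu : q < u <;> simp [hb, hu, blank]
    · rw [historyStep_of_not]
      · simp [hi]
      · simp [isLaunch_iff, hi]
      · rintro ⟨p, k, m, h1, -, h2, -⟩
        simp at h1
        exact hi h1.2.2.1
  · next p k i' m hn h =>
    rw [h]
    have h1 : ¬ IsLaunch i (p, k :: i' :: m) := by
      rw [isLaunch_iff]
      rintro ⟨j, u, h'⟩
      simp only [Prod.mk.injEq, List.cons.injEq] at h'
      exact hn j u h'.1 h'.2.1 h'.2.2.2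
    beta_reduce
    by_cases hi : i' = i ∧ LaunchedBefore Γ i T ∧ (k = 1 ∨ k = 2) ∧ q = T
    · rw [if_pos hi]
      obtain ⟨rfl, h2, h3, h4⟩ := hi
      rw [historyStep_of_move (exists_isLaunch_iff.2 h2) h3 (by simpa using h4)]
      rfl
    · rw [if_neg hi, historyStep_of_not h1]
      · rfl
      · rintro ⟨p', k', m', h2, h3, h4, h5⟩
        cases h2
        exact hi ⟨rfl, exists_isLaunch_iff.1 h3, h4, by simpa using h5⟩
  · next hn h2 =>
    rw [historyStep_of_not]
    · rfl
    · rw [isLaunch_iff]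
      rintro ⟨j, u, h'⟩
      exact hn i j u h'
    · rintro ⟨p, k, m, h, -⟩
      exact h2 p k i m h

/-- The computation of `instanceHistory` from the moves made so far, the latest one first. -/
def historyEntry (l : Trace) (i q : ℕ) : Role × Move :=
  Sum.elim (fun _ => blank) id
    (l.foldl (fun s x => (s.1.tail, Sum.elim (fun i => historyStep q s.1.tail i x) Sum.inr s.2))
      (l, (Sum.inl i : ℕ ⊕ (Role × Move)))).2

theorem historyEntry_reverse_prefix (Γ : Run) (T i q : ℕ) :
    historyEntry (Γ.prefix T).reverse i q = instanceHistory Γ T i q := by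
  -- An entry that has been found passes unchanged through the rest of the fold.
  have hr (y : Role × Move) (l l' : Trace) :
      (l.foldl (fun s x => (s.1.tail, Sum.elim (fun i => historyStep q s.1.tail i x) Sum.inr s.2))
        (l', (Sum.inr y : ℕ ⊕ (Role × Move)))).2 = Sum.inr y := by
    induction l generalizing l' with
    | nil => rfl
    | cons x l ih => exact ih _
  induction T generalizing i with
  | zero => rfl
  | succ T ih =>
    rw [instanceHistory_succ, Run.reverse_prefix_succ]
    simp only [historyEntry, List.foldl_cons, List.tail_cons, Sum.elim_inl]
    rcases historyStep q (Γ.prefix T).reverse i (Γ T) with j | y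
    · exact ih j
    · simp only [hr]
      rfl

@[fun_prop] theorem primrec_componentStep {α : Type} [Primcodable α] {n r q : α → ℕ}
    {x : α → Role × Move} (hn : Primrec n) (hr : Primrec r) (hq : Primrec q) (hx : Primrec x) :
    Primrec fun a => componentStep (n a) (r a) (q a) (x a) := by
  unfold componentStep; fun_prop

@[fun_prop] theorem primrec_antecedentStep {α : Type} [Primcodable α]
    {x : α → Role × Move} (hx : Primrec x) : Primrec fun a => antecedentStep (x a) := by
  unfold antecedentStep; fun_prop

@[fun_prop] theorem primrec_consequentStep {α : Type} [Primcodable α]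
    {x : α → Role × Move} (hx : Primrec x) : Primrec fun a => consequentStep (x a) := by
  unfold consequentStep; fun_prop

@[fun_prop] theorem primrecPred_isLaunch {α : Type} [Primcodable α] {i : α → ℕ}
    {x : α → Role × Move} (hi : Primrec i) (hx : Primrec x) :
    PrimrecPred fun a => IsLaunch (i a) (x a) := by
  unfold IsLaunch; fun_prop

@[fun_prop] theorem primrec_historyStep {α : Type} [Primcodable α] {q i : α → ℕ} {l : α → Trace}
    {x : α → Role × Move} (hq : Primrec q) (hl : Primrec l) (hi : Primrec i) (hx : Primrec x) :
    Primrec fun a => historyStep (q a) (l a) (i a) (x a) := by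
  unfold historyStep; fun_prop

@[fun_prop] theorem primrec_historyEntry {α : Type} [Primcodable α] {q i : α → ℕ} {l : α → Trace}
    (hl : Primrec l) (hi : Primrec i) (hq : Primrec q) :
    Primrec fun a => historyEntry (l a) (i a) (q a) := by
  unfold historyEntry
  have : Primrec fun p : α × (Role × Move) => id p.2 := Primrec.snd
  fun_prop

/-! ### Operations on finite parts of interactions -/

def Trace.component (n r : ℕ) (L : Trace) : Trace :=
  (List.range L.length).map fun q => componentStep n r q (L.getD q blank)

def Trace.instance (i : ℕ) (L : Trace) : Trace :=
  (List.range L.length).map fun q => historyEntry L.reverse i q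

@[fun_prop] theorem Trace.primrec_component {α : Type} [Primcodable α] {n r : α → ℕ}
    {L : α → Trace} (hn : Primrec n) (hr : Primrec r) (hL : Primrec L) :
    Primrec fun a => Trace.component (n a) (r a) (L a) := by
  unfold Trace.component; fun_prop

@[fun_prop] theorem Trace.primrec_instance {α : Type} [Primcodable α] {i : α → ℕ}
    {L : α → Trace} (hi : Primrec i) (hL : Primrec L) :
    Primrec fun a => Trace.instance (i a) (L a) := by
  unfold Trace.instance; fun_prop

theorem prefix_component (Γ : Run) (n r N : ℕ) :
    Run.prefix (component Γ n r) N = Trace.component n r (Γ.prefix N) := by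
  unfold Trace.component
  rw [Run.length_prefix, Run.prefix]
  refine List.map_congr_left fun q hq => ?_
  rw [component_apply, Run.getD_prefix _ (List.mem_range.1 hq)]

theorem prefix_instanceHistory (Γ : Run) (i N : ℕ) :
    Run.prefix (instanceHistory Γ N i) N = Trace.instance i (Γ.prefix N) := by
  unfold Trace.instance
  rw [Run.length_prefix, Run.prefix]
  exact List.map_congr_left fun q _ => (historyEntry_reverse_prefix Γ N i q).symm

theorem prefix_antecedentRun (Δ : Run) (N : ℕ) :
    Run.prefix (antecedentRun Δ) N = (Δ.prefix N).map antecedentStep := by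
  simp [Run.prefix, antecedentRun_apply]

theorem prefix_consequentRun (Δ : Run) (N : ℕ) :
    Run.prefix (consequentRun Δ) N = (Δ.prefix N).map consequentStep := by
  simp [Run.prefix, consequentRun_apply]

theorem LaunchedAt.launchedBefore {Γ : Run} {i j u r T : ℕ} (h : LaunchedAt Γ i j u r)
    (hT : r < T) : LaunchedBefore Γ i T := ⟨r, hT, j, u, h⟩

/-- Later moves do not change the earlier entries of an instance. -/
theorem instanceHistory_eq_of_le {Γ : Run} {i j u r q T T' : ℕ} (h : LaunchedAt Γ i j u r)
    (hr : r < T) (hq : q < T) (hT : T ≤ T') :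
    instanceHistory Γ T' i q = instanceHistory Γ T i q := by
  induction T', hT using Nat.le_induction with
  | base => rfl
  | succ T' hT ih =>
    have hl : ∃ y ∈ (Γ.prefix T').reverse, IsLaunch i y :=
      exists_isLaunch_iff.2 (h.launchedBefore (hr.trans_le hT))
    rw [instanceHistory_succ, ← ih]
    by_cases hx : IsLaunch i (Γ T')
    · rw [historyStep_of_launched hx hl]
      rfl
    · rw [historyStep_of_not hx]
      · rfl
      · rintro ⟨_, _, _, _, _, _, h⟩
        simp at h
        omega

end NarrowTruth

/-! ### Normal form of `Π¹₁` sets by arithmetical trees -/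

namespace NarrowTruth

variable {α β γ : Type} [Primcodable α] [Primcodable β] [Primcodable γ]

/-! ### Assignments as lists -/

/-- The assignment coded by a list. -/
def env (l : List ℕ) (x : ℕ) : ℕ := l.getD x 0

/-- The length leaves room for the index `x` and for all old values; the gap is filled with the
default value 0. -/
def envUpdate (l : List ℕ) (x n : ℕ) : List ℕ :=
  (List.range (l.length + x + 1)).map fun y => if y = x then n else l.getD y 0

theorem env_update (l : List ℕ) (x n : ℕ) :
    env (envUpdate l x n) = Function.update (env l) x n := by
  funext y
  simp only [env, envUpdate, Function.update_apply]
  by_cases h : y < l.length + x + 1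
  · simp [h]
  · rw [if_neg (by omega), List.getD_eq_default _ _ (by simp; omega),
      List.getD_eq_default _ _ (by omega)]

@[fun_prop] theorem primrec_env {l : α → List ℕ} {x : α → ℕ} (hl : Primrec l) (hx : Primrec x) :
    Primrec fun a => env (l a) (x a) := by
  unfold env; fun_prop

@[fun_prop] theorem primrec_envUpdate {l : α → List ℕ} {x n : α → ℕ} (hl : Primrec l)
    (hx : Primrec x) (hn : Primrec n) : Primrec fun a => envUpdate (l a) (x a) (n a) := by
  unfold envUpdate; fun_prop

theorem Term.primrec_val (t : Term) {l : α → List ℕ} (hl : Primrec l) :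
    Primrec fun a => t.val (env (l a)) := by
  induction t with
  | var x => simp only [Term.val]; fun_prop
  | zero => simp only [Term.val]; fun_prop
  | one => simp only [Term.val]; fun_prop
  | add a b iha ihb => exact Prim.add iha ihb
  | mul a b iha ihb => exact Prim.mul iha ihb

/-! ### Skolem functions -/

/-- The first `m` values of `f`. -/
def initial (f : ℕ → ℕ) (m : ℕ) : List ℕ := (List.range m).map f

@[simp] theorem length_initial (f : ℕ → ℕ) (m : ℕ) : (initial f m).length = m := by simp [initial]

theorem take_initial (f : ℕ → ℕ) {m n : ℕ} (h : m ≤ n) :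
    (initial f n).take m = initial f m := by
  simp [initial, ← List.map_take, List.take_range, h]

theorem map_initial (g f : ℕ → ℕ) (m : ℕ) : (initial f m).map g = initial (fun i => g (f i)) m := by
  simp [initial]

/-- `P` is of the form `∃ f, ∀ m, D (a, g ↾ m, f ↾ m)` with arithmetical `D`. -/
def Sigma11 (P : α → (ℕ → ℕ) → Prop) : Prop :=
  ∃ D : α × List ℕ × List ℕ → Prop, Arith (S := Empty) (fun _ => D) ∧
    ∀ a g, P a g ↔ ∃ f, ∀ m, D (a, initial g m, initial f m)

namespace Sigma11

theorem comp {P : β → (ℕ → ℕ) → Prop} (hP : Sigma11 P) {h : α → β} (hh : Primrec h) :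
    Sigma11 fun a g => P (h a) g := by
  obtain ⟨D, hD, hPD⟩ := hP
  exact ⟨fun p => D (h p.1, p.2), hD.comp (f := fun p : α × List ℕ × List ℕ => (h p.1, p.2))
    (Primrec.to_comp (by fun_prop)), fun a g => hPD (h a) g⟩

theorem of_primrecPred {p : α → Prop} (hp : PrimrecPred p) : Sigma11 fun a _ => p a :=
  ⟨fun q => p q.1, Arith.of_primrecPred (hp.comp Primrec.fst), fun a g => by simp⟩

/-- The value at `t a` is tested once the initial segment of `g` is long enough; shorter segments
impose nothing. -/
theorem of_apply (p : ℕ → Prop) (hp : PrimrecPred p) {t : α → ℕ} (ht : Primrec t) :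
    Sigma11 fun a g => p (g (t a)) := by
  refine ⟨fun q => t q.1 < q.2.1.length → p (q.2.1.getD (t q.1) 0),
    (Arith.of_primrecPred (by fun_prop)).imp (Arith.of_primrecPred
      (hp.comp (f := fun q : α × List ℕ × List ℕ => q.2.1.getD (t q.1) 0) (by fun_prop))),
    fun a g => ⟨fun h => ⟨g, fun m hm => ?_⟩, fun ⟨f, h⟩ => ?_⟩⟩
  · simp only [length_initial] at hm
    simpa [initial, hm] using h
  · simpa [initial] using h (t a + 1)

theorem and {P Q : α → (ℕ → ℕ) → Prop} (hP : Sigma11 P) (hQ : Sigma11 Q) :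
    Sigma11 fun a g => P a g ∧ Q a g := by
  obtain ⟨D, hD, hPD⟩ := hP
  obtain ⟨E, hE, hQE⟩ := hQ
  refine ⟨fun p => D (p.1, p.2.1, p.2.2.map fun n => n.unpair.1) ∧
    E (p.1, p.2.1, p.2.2.map fun n => n.unpair.2),
    (hD.comp (f := fun p : α × List ℕ × List ℕ => (p.1, p.2.1, p.2.2.map fun n => n.unpair.1))
      (Primrec.to_comp (by fun_prop))).and
    (hE.comp (f := fun p : α × List ℕ × List ℕ => (p.1, p.2.1, p.2.2.map fun n => n.unpair.2))
      (Primrec.to_comp (by fun_prop))), fun a g => ?_⟩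
  simp only [hPD, hQE, map_initial]
  constructor
  · rintro ⟨⟨f, hf⟩, f', hf'⟩
    exact ⟨fun i => Nat.pair (f i) (f' i), fun m => by simpa using ⟨hf m, hf' m⟩⟩
  · rintro ⟨f, hf⟩
    exact ⟨⟨_, fun m => (hf m).1⟩, _, fun m => (hf m).2⟩

theorem initial_succ (f : ℕ → ℕ) (m : ℕ) :
    initial f (m + 1) = f 0 :: initial (fun i => f (i + 1)) m := by
  simp [initial, List.range_succ_eq_map, Function.comp_def]

/-- The number `n` becomes the value at 0 of the new Skolem function, and the old function is
shifted by one. The segment of `g` is shortened by one to match. -/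
theorem exists' {P : α → ℕ → (ℕ → ℕ) → Prop} (hP : Sigma11 fun (p : α × ℕ) g => P p.1 p.2 g) :
    Sigma11 fun a g => ∃ n, P a n g := by
  obtain ⟨D, hD, hPD⟩ := hP
  refine ⟨fun p => 0 < p.2.2.length →
      D ((p.1, p.2.2.getD 0 0), p.2.1.take (p.2.2.length - 1), p.2.2.tail),
    (Arith.of_primrecPred (by fun_prop)).imp (hD.comp (f := fun p : α × List ℕ × List ℕ =>
      ((p.1, p.2.2.getD 0 0), p.2.1.take (p.2.2.length - 1), p.2.2.tail))
      (Primrec.to_comp (by fun_prop))), fun a g => ⟨?_, ?_⟩⟩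
  · rintro ⟨n, h⟩
    obtain ⟨f, hf⟩ := (hPD (a, n) g).1 h
    refine ⟨fun i => i.casesOn n f, fun m hm => ?_⟩
    obtain ⟨m, rfl⟩ : ∃ k, m = k + 1 := ⟨m - 1, by simp at hm; omega⟩
    simpa [take_initial g (Nat.le_succ m), initial_succ (fun i => i.casesOn n f)] using hf m
  · rintro ⟨f, hf⟩
    refine ⟨f 0, (hPD (a, f 0) g).2 ⟨fun i => f (i + 1), fun m => ?_⟩⟩
    simpa [initial_succ f m, take_initial g (Nat.le_succ m)] using hf (m + 1)

theorem ite {P Q : α → (ℕ → ℕ) → Prop} {c : α → Prop} (hc : PrimrecPred c) (hP : Sigma11 P)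
    (hQ : Sigma11 Q) : Sigma11 fun a g => (c a ∧ P a g) ∨ (¬ c a ∧ Q a g) := by
  obtain ⟨D, hD, hPD⟩ := hP
  obtain ⟨E, hE, hQE⟩ := hQ
  refine ⟨fun p => (c p.1 ∧ D p) ∨ (¬ c p.1 ∧ E p),
    ((Arith.of_primrecPred (hc.comp Primrec.fst)).and hD).or
      ((Arith.of_primrecPred (hc.comp Primrec.fst)).not.and hE), fun a g => ?_⟩
  simp only [hPD, hQE]
  by_cases h : c a <;> simp [h]

/-- The choice of a disjunct is a number and is absorbed like any other existential quantifier. -/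
theorem or {P Q : α → (ℕ → ℕ) → Prop} (hP : Sigma11 P) (hQ : Sigma11 Q) :
    Sigma11 fun a g => P a g ∨ Q a g := by
  have := exists' (P := fun a n g => (n = 0 ∧ P a g) ∨ (¬ n = 0 ∧ Q a g))
    (ite (α := α × ℕ) (c := fun p => p.2 = 0) (by fun_prop) (hP.comp Primrec.fst)
      (hQ.comp Primrec.fst))
  convert this using 3 with a g
  constructor
  · rintro (h | h)
    · exact ⟨0, by simpa using h⟩
    · exact ⟨1, by simpa using h⟩
  · rintro ⟨n, h | h⟩ <;> tauto

/-- Countably many Skolem functions are interleaved along `Nat.pair`. A finite segment is tested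
against exactly those `n` and lengths for which it contains all the data. -/
theorem forall' {P : α → ℕ → (ℕ → ℕ) → Prop} (hP : Sigma11 fun (p : α × ℕ) g => P p.1 p.2 g) :
    Sigma11 fun a g => ∀ n, P a n g := by
  obtain ⟨D, hD, hPD⟩ := hP
  refine ⟨fun p => ∀ q : ℕ × ℕ, (q.2 ≤ p.2.1.length ∧ ∀ j < q.2, Nat.pair q.1 j < p.2.2.length) →
      D ((p.1, q.1), p.2.1.take q.2, (List.range q.2).map fun j => p.2.2.getD (Nat.pair q.1 j) 0),
    Arith.forall' ((Arith.of_primrecPred (by fun_prop)).imp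
      (hD.comp (f := fun p : (α × List ℕ × List ℕ) × (ℕ × ℕ) => ((p.1.1, p.2.1),
        p.1.2.1.take p.2.2, (List.range p.2.2).map fun j => p.1.2.2.getD (Nat.pair p.2.1 j) 0))
      (Primrec.to_comp (by fun_prop)))), fun a g => ?_⟩
  constructor
  · intro h
    choose f hf using fun n => (hPD (a, n) g).1 (h n)
    refine ⟨fun i => f i.unpair.1 i.unpair.2, fun m ⟨n, k⟩ ⟨h1, h2⟩ => ?_⟩
    simp only [length_initial] at h1 h2
    convert hf n k using 4
    · exact take_initial g h1
    · refine List.map_congr_left fun j hj => ?_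
      simp [initial, h2 j (List.mem_range.1 hj)]
  · rintro ⟨f, hf⟩ n
    refine (hPD (a, n) g).2 ⟨fun j => f (Nat.pair n j), fun k => ?_⟩
    obtain ⟨N, hN⟩ : ∃ N, k ≤ N ∧ ∀ j < k, Nat.pair n j < N := by
      refine ⟨k + Nat.pair n k, by omega, fun j hj => ?_⟩
      have := Nat.pair_lt_pair_right n hj
      omega
    convert hf N (n, k) (by simpa using hN) using 3
    · exact (take_initial g hN.1).symm
    · refine (List.map_congr_left fun j hj => ?_).symm
      simp [initial, hN.2 j (List.mem_range.1 hj)]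

/-- Skolemization of `φ` and of its negation in one induction, because negation and implication
exchange the two. The set is represented by the zeros of `g`. -/
theorem sat (φ : SetFormula) :
    Sigma11 (fun (l : List ℕ) g => φ.Sat (fun _ => {i | g i = 0}) (env l)) ∧
      Sigma11 (fun (l : List ℕ) g => ¬ φ.Sat (fun _ => {i | g i = 0}) (env l)) := by
  induction φ with
  | eq a b =>
    simp only [Formula.Sat]
    have := Prim.eq (a.primrec_val (.id (α := List ℕ))) (b.primrec_val .id)
    exact ⟨of_primrecPred this, of_primrecPred this.not⟩
  | lt a b =>
    simp only [Formula.Sat]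
    have := Prim.lt (a.primrec_val (.id (α := List ℕ))) (b.primrec_val .id)
    exact ⟨of_primrecPred this, of_primrecPred this.not⟩
  | pred _ a =>
    simp only [Formula.Sat, Set.mem_ofPred_eq]
    have := a.primrec_val (.id (α := List ℕ))
    exact ⟨of_apply (fun n => n = 0) (by fun_prop) this,
      of_apply (fun n => ¬ n = 0) (by fun_prop) this⟩
  | neg A ih => simpa only [Formula.Sat, not_not] using ih.symm
  | and A B ihA ihB =>
    simp only [Formula.Sat, not_and_or]
    exact ⟨ihA.1.and ihB.1, ihA.2.or ihB.2⟩
  | or A B ihA ihB =>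
    simp only [Formula.Sat, not_or]
    exact ⟨ihA.1.or ihB.1, ihA.2.and ihB.2⟩
  | imp A B ihA ihB =>
    simp only [Formula.Sat, imp_iff_not_or, not_or, not_not]
    exact ⟨ihA.2.or ihB.1, ihA.1.and ihB.2⟩
  | all x A ih =>
    simp only [Formula.Sat, not_forall, ← env_update]
    exact ⟨forall' (ih.1.comp (h := fun p : List ℕ × ℕ => envUpdate p.1 x p.2) (by fun_prop)),
      exists' (ih.2.comp (h := fun p : List ℕ × ℕ => envUpdate p.1 x p.2) (by fun_prop))⟩
  | ex x A ih =>
    simp only [Formula.Sat, not_exists, ← env_update]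
    exact ⟨exists' (ih.1.comp (h := fun p : List ℕ × ℕ => envUpdate p.1 x p.2) (by fun_prop)),
      forall' (ih.2.comp (h := fun p : List ℕ × ℕ => envUpdate p.1 x p.2) (by fun_prop))⟩

end Sigma11

theorem Formula.sat_congr {S : Type} {I : S → Set ℕ} {φ : Formula S} {e e' : ℕ → ℕ}
    (h : ∀ x ∈ φ.freeVars, e x = e' x) : φ.Sat I e ↔ φ.Sat I e' := by
  have ht : ∀ (t : Term) (e e' : ℕ → ℕ), (∀ x ∈ t.vars, e x = e' x) → t.val e = t.val e' := by
    intro t e e' h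
    induction t with
    | var x => exact h x (by simp [Term.vars])
    | zero => rfl
    | one => rfl
    | add a b iha ihb =>
      simp only [Term.val]
      rw [iha fun x hx => h x (by simp [Term.vars, hx]), ihb fun x hx => h x (by simp [Term.vars, hx])]
    | mul a b iha ihb =>
      simp only [Term.val]
      rw [iha fun x hx => h x (by simp [Term.vars, hx]), ihb fun x hx => h x (by simp [Term.vars, hx])]
  induction φ generalizing e e' with
  | eq a b =>
    simp only [Formula.Sat]
    rw [ht a e e' fun x hx => h x (by simp [freeVars, hx]),
      ht b e e' fun x hx => h x (by simp [freeVars, hx])]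
  | lt a b =>
    simp only [Formula.Sat]
    rw [ht a e e' fun x hx => h x (by simp [freeVars, hx]),
      ht b e e' fun x hx => h x (by simp [freeVars, hx])]
  | pred _ a =>
    simp only [Formula.Sat]
    rw [ht a e e' fun x hx => h x (by simp [freeVars, hx])]
  | neg A ih => exact not_congr (ih h)
  | and A B ihA ihB =>
    exact and_congr (ihA fun x hx => h x (by simp [freeVars, hx]))
      (ihB fun x hx => h x (by simp [freeVars, hx]))
  | or A B ihA ihB =>
    exact or_congr (ihA fun x hx => h x (by simp [freeVars, hx]))
      (ihB fun x hx => h x (by simp [freeVars, hx]))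
  | imp A B ihA ihB =>
    exact imp_congr (ihA fun x hx => h x (by simp [freeVars, hx]))
      (ihB fun x hx => h x (by simp [freeVars, hx]))
  | all x A ih =>
    refine forall_congr' fun n => ih fun y hy => ?_
    by_cases hyx : y = x
    · simp [hyx]
    · simpa [hyx] using h y (by simp [freeVars, hy, hyx])
  | ex x A ih =>
    refine exists_congr fun n => ih fun y hy => ?_
    by_cases hyx : y = x
    · simp [hyx]
    · simpa [hyx] using h y (by simp [freeVars, hy, hyx])

/-- Normal form: a `Π¹₁` set is given by the well-foundedness of arithmetical trees. -/
theorem IsPi11.exists_tree {R : Set ℕ} (hR : IsPi11 R) :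
    ∃ T : ℕ × List ℕ → Prop, Arith (S := Empty) (fun _ => T) ∧
      (∀ n l m, T (n, l) → T (n, l.take m)) ∧
      ∀ n, n ∈ R ↔ ¬ ∃ f : ℕ → ℕ, ∀ m, T (n, initial f m) := by
  obtain ⟨φ, hφ, hR⟩ := hR
  obtain ⟨D, hD, h⟩ := (Sigma11.sat φ).2
  -- A node lists pairs: a value of the function representing the set, and a Skolem value. Requiring
  -- `D` of all initial segments makes the relation closed under initial segments without changing
  -- its infinite paths.
  refine ⟨fun p => ∀ m : ℕ, D ([p.1], (p.2.take m).map fun k => k.unpair.1,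
    (p.2.take m).map fun k => k.unpair.2), Arith.forall' (hD.comp (f := fun p : (ℕ × List ℕ) × ℕ =>
      ([p.1.1], (p.1.2.take p.2).map fun k => k.unpair.1, (p.1.2.take p.2).map fun k => k.unpair.2))
      (Primrec.to_comp (by fun_prop))), fun n l m h k => ?_, fun n => ?_⟩
  · simpa only [List.take_take] using h (min k m)
  · rw [hR, ← not_iff_not, not_not, not_forall]
    have (X : Set ℕ) : φ.Sat (fun _ => X) (fun _ => n) ↔ φ.Sat (fun _ => X) (env [n]) :=
      Formula.sat_congr fun x hx => by
        obtain rfl : x = 0 := by simpa using hφ hx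
        rfl
    simp only [this]
    constructor
    · rintro ⟨X, hX⟩
      classical
      -- Members get the value 0, because the set is read off as the set of zeros.
      obtain ⟨f, hf⟩ := (h [n] fun i => if i ∈ X then 0 else 1).1 (by simpa using hX)
      refine ⟨fun i => Nat.pair (if i ∈ X then 0 else 1) (f i), fun m k => ?_⟩
      have h1 : (initial (fun i => Nat.pair (if i ∈ X then 0 else 1) (f i)) m).take k =
          initial (fun i => Nat.pair (if i ∈ X then 0 else 1) (f i)) (min k m) := by
        rw [← take_initial _ (min_le_right k m), List.take_eq_take_min]
        simp
      simp only [h1, map_initial, Nat.unpair_pair]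
      exact hf _
    · rintro ⟨f, hf⟩
      refine ⟨_, (h [n] fun i => (f i).unpair.1).2 ⟨fun i => (f i).unpair.2, fun m => ?_⟩⟩
      have := hf m m
      rwa [take_initial _ le_rfl, map_initial, map_initial] at this

end NarrowTruth

/-! ### Hardness: the game sentence of a tree -/

namespace NarrowTruth

open Encodable Denumerable

/-! ### A family of sentences -/

def numeral : ℕ → Term
  | 0 => .zero
  | n + 1 => .add (numeral n) .one

@[simp] theorem val_numeral (e : ℕ → ℕ) (n : ℕ) : (numeral n).val e = n := by
  induction n with
  | zero => rfl
  | succ n ih => simp [numeral, Term.val, ih]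

@[simp] theorem vars_numeral (n : ℕ) : (numeral n).vars = ∅ := by
  induction n with
  | zero => rfl
  | succ n ih => simp [numeral, Term.vars, ih]

theorem primrec_code_numeral : Primrec fun n => (numeral n).code := by
  have : Primrec₂ fun (_ m : ℕ) => Nat.pair 3 (Nat.pair m (Nat.pair 2 0)) := by
    unfold Primrec₂; fun_prop
  refine (Primrec.nat_rec₁ (Term.code .zero) this).of_eq fun n => ?_
  induction n with
  | zero => rfl
  | succ n ih => simp only [numeral, Term.code, ← ih]

/-- An arithmetical predicate of numbers, with the first number given by a numeral. -/
theorem Arith.exists_negated_instance {P : ℕ × ℕ × ℕ × ℕ → Prop} {V : Finset ℕ}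
    (hP : Arith (S := Empty) fun _ => P)
    (hV : ∀ e e' : ℕ → ℕ, (∀ x ∈ V, e x = e' x) → (P (e 4, e 1, e 2, e 3) ↔ P (e' 4, e' 1, e' 2, e' 3))) :
    ∃ φ : ArithFormula, φ.freeVars ⊆ V ∧
      ∀ n e, ArithTrue (.neg (.ex 4 (.and (.eq (.var 4) (numeral n)) φ))) e ↔
        P (n, e 1, e 2, e 3) := by
  -- The matrix expresses the complement of `P`, so that the negation in front of it expresses `P`;
  -- a negated formula carries no requirement beyond truth.
  obtain ⟨φ, hφ⟩ := hP.not
  obtain ⟨π₁, hπ₁⟩ := Expressible.pair (S := Empty) 5 2 3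
  obtain ⟨π₂, hπ₂⟩ := Expressible.pair (S := Empty) 6 1 5
  obtain ⟨π₃, hπ₃⟩ := Expressible.pair (S := Empty) 0 4 6
  obtain ⟨ψ, h1, h2⟩ := Formula.exists_closure (V := V)
    (φ := .ex 5 (.ex 6 (.ex 0 (.and (.and π₁ (.and π₂ π₃)) φ))))
    (P := fun _ e => ¬ P (e 4, e 1, e 2, e 3)) (fun I e => by
      simp only [Formula.Sat, hπ₁, hπ₂, hπ₃, Function.update_apply]
      simp only [Nat.reduceEqDiff, if_false, if_true, reduceIte, OfNat.ofNat_ne_zero,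
        OfNat.zero_ne_ofNat, OfNat.one_ne_ofNat, OfNat.ofNat_ne_one, zero_ne_one, one_ne_zero]
      constructor
      · rintro ⟨_, _, _, ⟨rfl, rfl, rfl⟩, h⟩
        exact (hφ I _ (e 4, e 1, e 2, e 3) (by simp)).1 h
      · intro h
        exact ⟨_, _, _, ⟨rfl, rfl, rfl⟩, (hφ I _ (e 4, e 1, e 2, e 3) (by simp)).2 h⟩)
    fun _ e e' h => not_congr (hV e e' h)
  refine ⟨ψ, h1, fun n e => ?_⟩
  simp [ArithTrue, Formula.Sat, h2, Term.val]

/-- `∀c (∀s ∃k ¬A → ∃y ¬B)`, with variables `c = v₁`, `s = v₂` and `k = y = v₃`. -/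
def gameSentence (A B : ArithFormula) : ArithFormula :=
  .all 1 (.imp (.all 2 (.ex 3 (.neg A))) (.ex 3 (.neg B)))

/-- The requirements for `∀s ∃k a(s, k)`, apart from truth, are met up to time `t`. -/
def AntecedentMet (a : ℕ → ℕ → Prop) (D : Run) (t : ℕ∞) : Prop :=
  ∀ s r : ℕ, (r : ℕ∞) < t → FirstMove D .user {[s]} r [s] →
    (t = ⊤ → ∃ r' m, FirstMove (component D s r) .witness {m | ∃ n, m = [n]} r' m) ∧
      ∀ k r' : ℕ, (r' : ℕ∞) < t →
        FirstMove (component D s r) .witness {m | ∃ n, m = [n]} r' [k] → a s k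

/-- The requirements for `∃y b(y)`, apart from truth, are met up to time `t`. -/
def ConsequentMet (b : ℕ → Prop) (D : Run) (t : ℕ∞) : Prop :=
  (t = ⊤ → ∃ r m, FirstMove D .witness {m | ∃ n, m = [n]} r m) ∧
    ∀ y r : ℕ, (r : ℕ∞) < t → FirstMove D .witness {m | ∃ n, m = [n]} r [y] → b y

/-- By `ha` and `hb`, the antecedent and the consequent are classically true for every `c`, so all
truth clauses hold and only the conditions on choices remain. -/
theorem met_gameSentence_iff {A B : ArithFormula} {a : ℕ → ℕ → ℕ → Prop} {b : ℕ → ℕ → Prop}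
    (hA : ∀ e, ArithTrue (.neg A) e ↔ a (e 1) (e 2) (e 3))
    (hB : ∀ e, ArithTrue (.neg B) e ↔ b (e 1) (e 3))
    (ha : ∀ c s, ∃ k, a c s k) (hb : ∀ c, ∃ y, b c y) (e : ℕ → ℕ) (Γ : Run) :
    Met (gameSentence A B) e Γ ⊤ ↔
      ∀ c r, FirstMove Γ .user {[c]} r [c] → ∀ i j u r', LaunchedAt (component Γ c r) i j u r' →
        ∀ t, AntecedentMet (a c) (antecedentRun (instanceRun (component Γ c r) i r')) t →
          ConsequentMet (b c) (consequentRun (instanceRun (component Γ c r) i r')) t := by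
  have hA' (e : ℕ → ℕ) : ¬ A.Sat (fun p => p.elim) e ↔ a (e 1) (e 2) (e 3) := hA e
  have hB' (e : ℕ → ℕ) : ¬ B.Sat (fun p => p.elim) e ↔ b (e 1) (e 3) := hB e
  simp only [gameSentence, Met, hA, hB]
  simp [ArithTrue, Formula.Sat, hA', hB', ha, hb, AntecedentMet, ConsequentMet]

/-! ### First moves -/

theorem exists_firstMove {Γ : Run} {p : Role} {S : Set Move}
    (h : ∃ r m, m ∈ S ∧ Γ r = (p, m)) : ∃ r m, FirstMove Γ p S r m := by
  classical
  obtain ⟨m, h1, h2⟩ := Nat.find_spec h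
  exact ⟨Nat.find h, m, h1, h2, fun q hq m' hm' hΓ => Nat.find_min h hq ⟨m', hm', hΓ⟩⟩

theorem exists_firstMove_singleton {Γ : Run} {p : Role} {m : Move} {r : ℕ}
    (h : Γ r = (p, m)) : ∃ r, FirstMove Γ p {m} r m := by
  obtain ⟨r, m', h⟩ := exists_firstMove (S := {m}) ⟨r, m, rfl, h⟩
  obtain rfl : m' = m := h.1
  exact ⟨r, h⟩

theorem component_eq_iff {Γ : Run} {n r q k : ℕ} {p : Role} {m : Move} :
    component Γ n r q = (p, k :: m) ↔ r < q ∧ Γ q = (p, n :: k :: m) := by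
  rw [component_apply, componentStep]
  rcases Γ q with ⟨p', _ | ⟨k', m'⟩⟩
  · simp
  · simp only [List.head?_cons, Option.some.injEq, List.tail_cons, Prod.mk.injEq, List.cons.injEq]
    split_ifs with h
    · simp only [h]
      tauto
    · simp
      tauto

theorem antecedentRun_eq_iff {Δ : Run} {q k : ℕ} {p : Role} {m : Move} :
    antecedentRun Δ q = (p, k :: m) ↔ Δ q = (p.swap, 1 :: k :: m) := by
  rw [antecedentRun_apply, antecedentStep]
  rcases Δ q with ⟨p', _ | ⟨k', m'⟩⟩
  · simp
  · have : p'.swap = p ↔ p' = p.swap := by cases p <;> cases p' <;> simp [Role.swap]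
    by_cases h : k' = 1 <;> simp [h, this]

theorem consequentRun_eq_iff {Δ : Run} {q k : ℕ} {p : Role} {m : Move} :
    consequentRun Δ q = (p, k :: m) ↔ Δ q = (p, 2 :: k :: m) := by
  rw [consequentRun_apply, consequentStep]
  rcases Δ q with ⟨p', _ | ⟨k', m'⟩⟩
  · simp
  · by_cases h : k' = 2 <;> simp [h]

theorem instanceHistory_blank {Γ : Run} {T i q : ℕ} (h : T ≤ q) :
    instanceHistory Γ T i q = blank := by
  induction T generalizing i with
  | zero => rfl
  | succ T ih =>
    rw [instanceHistory_succ, historyStep]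
    split_ifs with h1 h2 h3 h4
    · exact ih (by omega)
    · exact ih (by omega)
    · rfl
    · simp at h4
      omega
    · exact ih (by omega)

theorem LaunchedAt.launchedBefore_iff {Γ : Run} {i j u r T : ℕ} (h : LaunchedAt Γ i j u r) :
    LaunchedBefore Γ i T ↔ r < T := by
  refine ⟨?_, fun h' => h.launchedBefore h'⟩
  rintro ⟨r', hr', j', u', h'⟩
  by_contra hT
  exact h.2.2 r' (by omega) _ h'.1 h'.2.1

theorem instanceRun_of_lt {Γ : Run} {i j u r q : ℕ} (h : LaunchedAt Γ i j u r) (hq : r < q) :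
    instanceRun Γ i r q = instanceHistory Γ (q + 1) i q :=
  instanceHistory_eq_of_le h (by omega) (by omega) (by omega)

/-- Entries later than the launch cannot come from the copied history, so they are exactly the moves
addressed to the instance. -/
theorem instanceRun_eq_iff_of_lt {Γ : Run} {i j u r q k : ℕ} {p : Role} {m : Move}
    (h : LaunchedAt Γ i j u r) (hq : r < q) :
    instanceRun Γ i r q = (p, k :: m) ↔ (k = 1 ∨ k = 2) ∧ Γ q = (p, k :: i :: m) := by
  rw [instanceRun_of_lt h hq, instanceHistory_succ]
  have hl : ∃ y ∈ (Γ.prefix q).reverse, IsLaunch i y :=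
    exists_isLaunch_iff.2 (h.launchedBefore hq)
  by_cases h1 : IsLaunch i (Γ q)
  · rw [historyStep_of_launched h1 hl, Sum.elim_inl, instanceHistory_blank le_rfl]
    obtain ⟨j', u', h1⟩ := isLaunch_iff.1 h1
    rw [h1]
    simp only [blank, Prod.mk.injEq, reduceCtorEq, and_false, List.cons.injEq, false_iff, not_and]
    omega
  · by_cases h2 : ∃ p' k' m', Γ q = (p', k' :: i :: m') ∧ (∃ y ∈ (Γ.prefix q).reverse,
      IsLaunch i y) ∧ (k' = 1 ∨ k' = 2) ∧ q = (Γ.prefix q).reverse.length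
    · obtain ⟨p', k', m', h3, h4, h5, h6⟩ := h2
      rw [h3, historyStep_of_move h4 h5 h6]
      simp only [Sum.elim_inr, id, Prod.mk.injEq, List.cons.injEq]
      constructor
      · rintro ⟨rfl, rfl, rfl⟩
        exact ⟨h5, by simp⟩
      · rintro ⟨-, rfl, rfl, -, rfl⟩
        exact ⟨rfl, rfl, rfl⟩
    · rw [historyStep_of_not h1 h2, Sum.elim_inl, instanceHistory_blank le_rfl]
      simp only [blank, Prod.mk.injEq, reduceCtorEq, and_false, false_iff]
      rintro ⟨h3, h4⟩
      exact h2 ⟨p, k, m, h4, hl, h3, by simp⟩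

theorem instanceRun_of_le {Γ : Run} {i j r q : ℕ} (h : LaunchedAt Γ i j 0 r) (hq : q ≤ r) :
    instanceRun Γ i r q = blank := by
  have : instanceRun Γ i r q = instanceHistory Γ (r + 1) i q :=
    instanceHistory_eq_of_le h (by omega) (by omega) (by omega)
  rw [this, instanceHistory_succ, h.2.1, historyStep_of_launch]
  · simp
  · rw [exists_isLaunch_iff, h.launchedBefore_iff]
    omega

theorem instanceRun_eq_iff_of_launch {Γ : Run} {i j r q k : ℕ} {p : Role} {m : Move}
    (h : LaunchedAt Γ i j 0 r) :
    instanceRun Γ i r q = (p, k :: m) ↔ r < q ∧ (k = 1 ∨ k = 2) ∧ Γ q = (p, k :: i :: m) := by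
  rcases lt_or_ge r q with hq | hq
  · simp [instanceRun_eq_iff_of_lt h hq, hq]
  · simp [instanceRun_of_le h hq, blank, hq.not_gt]

/-! ### The user's side -/

theorem play_eq_witness_iff {σ : Strategy} {X : ℕ → Move} {q : ℕ} {m : Move} :
    play σ X q = (.witness, m) ↔ ∃ i, q = 2 * i ∧ σ ((List.range i).map X) = m := by
  unfold play
  split_ifs with h
  · simp only [Prod.mk.injEq, true_and]
    constructor
    · rintro rfl
      exact ⟨q / 2, by omega, rfl⟩
    · rintro ⟨i, rfl, rfl⟩
      simp
  · simp only [Prod.mk.injEq, reduceCtorEq, false_and, false_iff, not_exists, not_and]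
    intro i hi
    omega

theorem play_eq_user_iff {σ : Strategy} {X : ℕ → Move} {q : ℕ} {m : Move} :
    play σ X q = (.user, m) ↔ ∃ i, q = 2 * i + 1 ∧ X i = m := by
  unfold play
  split_ifs with h
  · simp only [Prod.mk.injEq, reduceCtorEq, false_and, false_iff, not_exists, not_and]
    intro i hi
    omega
  · simp only [Prod.mk.injEq, true_and]
    constructor
    · rintro rfl
      exact ⟨q / 2, by omega, rfl⟩
    · rintro ⟨i, rfl, rfl⟩
      congr 1
      omega

/-- The user opens component `c` and one instance of the implication in it, and then goes on
answering all inputs `s` with `ρ s`. -/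
def userReal (c : ℕ) (ρ : ℕ → List ℕ) (i : ℕ) : Move :=
  if i = 0 then [c] else if i = 1 then [c, 0, 0, 0, 0]
  else c :: 1 :: 0 :: (i - 2).unpair.1 :: ρ (i - 2).unpair.1

section

variable {σ : Strategy} {c : ℕ} {ρ : ℕ → List ℕ}

theorem firstMove_userReal : FirstMove (play σ (userReal c ρ)) .user {[c]} 1 [c] := by
  refine ⟨rfl, play_eq_user_iff.2 ⟨0, by simp [userReal]⟩, ?_⟩
  rintro q hq m - h
  obtain ⟨i, hi, -⟩ := play_eq_user_iff.1 h
  omega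

theorem launchedAt_userReal :
    LaunchedAt (component (play σ (userReal c ρ)) c 1) 0 0 0 3 := by
  refine ⟨⟨0, 0, rfl⟩, ?_, ?_⟩
  · rw [component_eq_iff, play_eq_user_iff]
    exact ⟨by omega, 1, by simp [userReal]⟩
  · rintro q hq _ ⟨j, u, rfl⟩ h
    rw [component_eq_iff, play_eq_user_iff] at h
    obtain ⟨h1, i, h2, -⟩ := h
    omega

/-- The instance that the user launches. -/
noncomputable def userInstance (σ : Strategy) (c : ℕ) (ρ : ℕ → List ℕ) : Run :=
  instanceRun (component (play σ (userReal c ρ)) c 1) 0 3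

theorem userInstance_eq_witness_iff {q k : ℕ} {m : Move} :
    userInstance σ c ρ q = (.witness, k :: m) ↔ (k = 1 ∨ k = 2) ∧
      ∃ i, 2 ≤ i ∧ q = 2 * i ∧ σ ((List.range i).map (userReal c ρ)) = c :: k :: 0 :: m := by
  rw [userInstance, instanceRun_eq_iff_of_launch launchedAt_userReal, component_eq_iff,
    play_eq_witness_iff]
  constructor
  · rintro ⟨h1, h2, -, i, rfl, h3⟩
    exact ⟨h2, i, by omega, rfl, h3⟩
  · rintro ⟨h2, i, h1, rfl, h3⟩
    exact ⟨by omega, h2, by omega, i, rfl, h3⟩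

theorem userInstance_eq_user_iff {q k : ℕ} {m : Move} :
    userInstance σ c ρ q = (.user, k :: m) ↔
      ∃ i, q = 2 * (i + 2) + 1 ∧ k = 1 ∧ m = i.unpair.1 :: ρ i.unpair.1 := by
  rw [userInstance, instanceRun_eq_iff_of_launch launchedAt_userReal, component_eq_iff,
    play_eq_user_iff]
  constructor
  · rintro ⟨h1, h2, -, i, rfl, h3⟩
    obtain ⟨i, rfl⟩ : ∃ k, i = k + 2 := ⟨i - 2, by omega⟩
    simp only [userReal, Nat.add_eq_zero_iff, OfNat.ofNat_ne_zero, and_false, if_false,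
      Nat.add_sub_cancel, show ¬ i + 2 = 1 by omega, List.cons.injEq, true_and] at h3
    exact ⟨i, rfl, h3.1.symm, h3.2.symm⟩
  · rintro ⟨i, rfl, rfl, rfl⟩
    exact ⟨by omega, by simp, by omega, i + 2, rfl, by simp [userReal]⟩

theorem antecedentMet_userInstance {a : ℕ → ℕ → Prop} (ha : ∀ s k, ρ s = [k] → a s k) {t : ℕ∞}
    (ht : t = ⊤ → ∀ s, ∃ k, ρ s = [k]) :
    AntecedentMet a (antecedentRun (userInstance σ c ρ)) t := by
  intro s r hr h
  constructor
  · intro h'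
    obtain ⟨k, hk⟩ := ht h' s
    -- Only answers given after the opening time `r` count. The user repeats every answer infinitely
    -- often, and the index `Nat.pair s r`, being at least `r`, gives one that is late enough.
    refine exists_firstMove ⟨2 * (Nat.pair s r + 2) + 1, [k], ⟨k, rfl⟩, ?_⟩
    rw [component_eq_iff, antecedentRun_eq_iff]
    refine ⟨?_, userInstance_eq_user_iff.2 ⟨Nat.pair s r, rfl, rfl, by simp [hk]⟩⟩
    have := Nat.right_le_pair s r
    omega
  · rintro k r' - ⟨-, h', -⟩
    rw [component_eq_iff, antecedentRun_eq_iff] at h'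
    obtain ⟨-, h'⟩ := h'
    obtain ⟨i, -, -, h'⟩ := userInstance_eq_user_iff.1 h'
    simp only [List.cons.injEq] at h'
    exact ha s k (by rw [h'.1, ← h'.2])

theorem consequent_userInstance_eq_iff {q y : ℕ} :
    consequentRun (userInstance σ c ρ) q = (.witness, [y]) ↔
      ∃ i, 2 ≤ i ∧ q = 2 * i ∧ σ ((List.range i).map (userReal c ρ)) = [c, 2, 0, y] := by
  rw [consequentRun_eq_iff, userInstance_eq_witness_iff]
  simp

end

end NarrowTruth

namespace NarrowTruth

open Encodable Denumerable

/-! ### The diagonal predicates -/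

abbrev IsPrefix (l b : List ℕ) : Prop := b.take l.length = l

/-- The answer to `s` of a user who follows the finite branch `b`: an even number extends a proper
initial segment of `b`, an odd number is given off the branch. -/
def branchAnswer (b : List ℕ) (s : ℕ) : List ℕ :=
  if (ofNat (List ℕ) s).length < b.length ∧ IsPrefix (ofNat (List ℕ) s) b then
    [2 * b.getD (ofNat (List ℕ) s).length 0]
  else if IsPrefix b (ofNat (List ℕ) s) then [] else [1]

/-- The answer to `s` of a user who follows the infinite branch `f`. -/
def pathAnswer (f : ℕ → ℕ) (s : ℕ) : List ℕ :=
  if initial f (ofNat (List ℕ) s).length = ofNat (List ℕ) s then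
    [2 * f (ofNat (List ℕ) s).length] else [1]

theorem branchAnswer_initial {f : ℕ → ℕ} {s m : ℕ} (h : (ofNat (List ℕ) s).length < m) :
    branchAnswer (initial f m) s = pathAnswer f s := by
  unfold branchAnswer pathAnswer
  set l := ofNat (List ℕ) s
  simp only [IsPrefix, length_initial, h, true_and, take_initial f h.le]
  split_ifs with h1 h2
  · simp [initial, h]
  · have := congrArg List.length h2
    simp at this
    omega
  · rfl

theorem userReal_congr {c : ℕ} {ρ ρ' : ℕ → List ℕ} {t : ℕ} (h : ∀ s < t, ρ s = ρ' s) :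
    (List.range t).map (userReal c ρ) = (List.range t).map (userReal c ρ') := by
  refine List.map_congr_left fun i hi => ?_
  have hi := List.mem_range.1 hi
  unfold userReal
  split_ifs
  · rfl
  · rfl
  · rw [h _ (by have := Nat.unpair_left_le (i - 2); omega)]

/-- The first `t` moves involve only answers to inputs `s < t`, that is, to finitely many sequences.
A branch longer than all of them cannot be told from `f`. -/
theorem exists_branch {f : ℕ → ℕ} (c t : ℕ) :
    ∃ m, (List.range t).map (userReal c (branchAnswer (initial f m))) =
      (List.range t).map (userReal c (pathAnswer f)) := by
  refine ⟨(Finset.range t).sup (fun s => (ofNat (List ℕ) s).length) + 1,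
    userReal_congr fun s hs => branchAnswer_initial (Nat.lt_succ_of_le ?_)⟩
  exact Finset.le_sup (f := fun s => (ofNat (List ℕ) s).length) (Finset.mem_range.2 hs)

section

variable (T : ℕ × List ℕ → Prop)

def branchOf (w : ℕ) : List ℕ := ofNat (List ℕ) w.unpair.1

/-- Against a user who follows the branch coded in `w`, which is in the tree `T n`, the program `c`
plays `y` in the consequent at the time coded in `w`. -/
def Plays (n c w y : ℕ) : Prop :=
  T (n, branchOf w) ∧ 2 ≤ w.unpair.2 ∧
    encode ([c, 2, 0, y] : Move) ∈ (ofNat Nat.Partrec.Code c).eval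
      (encode ((List.range w.unpair.2).map (userReal c (branchAnswer (branchOf w)))))

/-- Minimality in the code `w` singles out one play for the diagonalization. As `Nat.pair` increases
in its second argument, it is also the earliest play against its own branch. -/
def FirstPlay (n c w : ℕ) : Prop :=
  (∃ y, Plays T n c w y) ∧ ∀ w' < w, ¬ ∃ y, Plays T n c w' y

/-- `y` is not what the program `c` plays first. -/
def Good (n c y : ℕ) : Prop := ∀ w, FirstPlay T n c w → ¬ Plays T n c w y

/-- `k` is a true answer to `s`. -/
def Answer (n c s k : ℕ) : Prop :=
  (k % 2 = 0 → T (n, ofNat (List ℕ) s ++ [k / 2]) ∧ ∀ w, FirstPlay T n c w →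
    ((ofNat (List ℕ) s).length < (branchOf w).length ∧ IsPrefix (ofNat (List ℕ) s) (branchOf w)) →
      IsPrefix (ofNat (List ℕ) s ++ [k / 2]) (branchOf w)) ∧
  (k % 2 = 1 → ∀ w, FirstPlay T n c w → Good T n c (k / 2) ∨
    ¬ (IsPrefix (ofNat (List ℕ) s) (branchOf w) ∨ IsPrefix (branchOf w) (ofNat (List ℕ) s)))

variable {T}

theorem FirstPlay.unique {n c w w' : ℕ} (h : FirstPlay T n c w) (h' : FirstPlay T n c w') :
    w = w' := by
  rcases lt_trichotomy w w' with h1 | h1 | h1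
  · exact (h'.2 w h1 h.1).elim
  · exact h1
  · exact (h.2 w' h1 h'.1).elim

theorem exists_firstPlay {n c w y : ℕ} (h : Plays T n c w y) :
    ∃ w' ≤ w, FirstPlay T n c w' := by
  classical
  have h' : ∃ w, ∃ y, Plays T n c w y := ⟨w, y, h⟩
  exact ⟨Nat.find h', Nat.find_min' h' ⟨y, h⟩, Nat.find_spec h', fun _ => Nat.find_min h'⟩

theorem Plays.unique {n c w y y' : ℕ} (h : Plays T n c w y) (h' : Plays T n c w y') : y = y' := by
  have := Part.mem_unique h.2.2 h'.2.2
  simpa using this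

theorem exists_good (n c : ℕ) : ∃ y, Good T n c y := by
  by_cases h : ∃ w y, FirstPlay T n c w ∧ Plays T n c w y
  · obtain ⟨w, y, h1, h2⟩ := h
    refine ⟨y + 1, fun w' h3 h4 => ?_⟩
    obtain rfl := h1.unique h3
    have := h2.unique h4
    omega
  · exact ⟨0, fun w h1 h2 => h ⟨w, 0, h1, h2⟩⟩

/-- Disclosing a good number is true at every sequence, so the antecedent is classically true
whatever the tree. -/
theorem exists_answer (n c s : ℕ) : ∃ k, Answer T n c s k := by
  obtain ⟨y, hy⟩ := exists_good (T := T) n c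
  refine ⟨2 * y + 1, fun h => by omega, fun _ w _ => .inl ?_⟩
  rwa [show (2 * y + 1) / 2 = y by omega]

theorem arith_plays (hT : Arith (S := Empty) fun _ => T) :
    Arith (S := Empty) fun _ (p : ℕ × ℕ × ℕ × ℕ) => Plays T p.1 p.2.1 p.2.2.1 p.2.2.2 := by
  refine .and (hT.comp (f := fun p : ℕ × ℕ × ℕ × ℕ => (p.1, branchOf p.2.2.1))
    (Primrec.to_comp (by unfold branchOf; fun_prop)))
    (.and (.of_primrecPred (by fun_prop)) (Arith.mem_partrec
      (f := fun q : Nat.Partrec.Code × ℕ => q.1.eval q.2) Nat.Partrec.Code.eval_part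
      (g := fun p : ℕ × ℕ × ℕ × ℕ => (ofNat Nat.Partrec.Code p.2.1,
        encode ((List.range p.2.2.1.unpair.2).map
          (userReal p.2.1 (branchAnswer (branchOf p.2.2.1))))))
      (h := fun p => encode ([p.2.1, 2, 0, p.2.2.2] : Move)) ?_ ?_))
  · refine Primrec.to_comp ?_
    unfold userReal branchAnswer branchOf IsPrefix
    fun_prop
  · exact Primrec.to_comp (by fun_prop)

theorem arith_firstPlay (hT : Arith (S := Empty) fun _ => T) :
    Arith (S := Empty) fun _ (p : ℕ × ℕ × ℕ) => FirstPlay T p.1 p.2.1 p.2.2 := by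
  refine .and (.exists' ((arith_plays hT).comp (f := fun p : (ℕ × ℕ × ℕ) × ℕ =>
      (p.1.1, p.1.2.1, p.1.2.2, p.2)) (Primrec.to_comp (by fun_prop))))
    (.forall' (.imp (.of_primrecPred (by fun_prop)) (.not (.exists' ((arith_plays hT).comp
      (f := fun p : ((ℕ × ℕ × ℕ) × ℕ) × ℕ => (p.1.1.1, p.1.1.2.1, p.1.2, p.2))
      (Primrec.to_comp (by fun_prop)))))))

theorem arith_good (hT : Arith (S := Empty) fun _ => T) :
    Arith (S := Empty) fun _ (p : ℕ × ℕ × ℕ) => Good T p.1 p.2.1 p.2.2 :=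
  .forall' (.imp ((arith_firstPlay hT).comp (f := fun p : (ℕ × ℕ × ℕ) × ℕ =>
      (p.1.1, p.1.2.1, p.2)) (Primrec.to_comp (by fun_prop)))
    (.not ((arith_plays hT).comp (f := fun p : (ℕ × ℕ × ℕ) × ℕ =>
      (p.1.1, p.1.2.1, p.2, p.1.2.2)) (Primrec.to_comp (by fun_prop)))))

theorem arith_answer (hT : Arith (S := Empty) fun _ => T) :
    Arith (S := Empty) fun _ (p : ℕ × ℕ × ℕ × ℕ) => Answer T p.1 p.2.1 p.2.2.1 p.2.2.2 := by
  have hF : Arith (S := Empty) fun _ (p : (ℕ × ℕ × ℕ × ℕ) × ℕ) =>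
      FirstPlay T p.1.1 p.1.2.1 p.2 :=
    (arith_firstPlay hT).comp (f := fun p : (ℕ × ℕ × ℕ × ℕ) × ℕ => (p.1.1, p.1.2.1, p.2))
      (Primrec.to_comp (by fun_prop))
  refine .and (.imp (.of_primrecPred (by fun_prop)) (.and
    (hT.comp (f := fun p : ℕ × ℕ × ℕ × ℕ => (p.1, ofNat (List ℕ) p.2.2.1 ++ [p.2.2.2 / 2]))
      (Primrec.to_comp (by fun_prop)))
    (.forall' (.imp hF (.of_primrecPred ?_)))))
    (.imp (.of_primrecPred (by fun_prop)) (.forall' (.imp hF (.or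
      ((arith_good hT).comp (f := fun p : (ℕ × ℕ × ℕ × ℕ) × ℕ =>
        (p.1.1, p.1.2.1, p.1.2.2.2 / 2)) (Primrec.to_comp (by fun_prop)))
      (.of_primrecPred ?_)))))
  · unfold branchOf IsPrefix
    simp only [imp_iff_not_or]
    fun_prop
  · unfold branchOf IsPrefix
    fun_prop

/-- Extensions along the branch stay in the tree because it is closed under initial segments. Off
the branch, the odd answer 1 is true by incompatibility. At the end of the branch and beyond it, an
odd answer would have to disclose a good number; there this user gives no answer. -/
theorem FirstPlay.branchAnswer_true (hT : ∀ n l m, T (n, l) → T (n, l.take m)) {n c w s k : ℕ}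
    (hw : FirstPlay T n c w) (h : branchAnswer (branchOf w) s = [k]) : Answer T n c s k := by
  unfold branchAnswer at h
  set l := ofNat (List ℕ) s with hl
  set b := branchOf w with hb
  have hbT : T (n, b) := hw.1.choose_spec.1
  unfold Answer
  rw [← hl]
  split_ifs at h with h1 h2
  · obtain rfl : 2 * b.getD l.length 0 = k := by simpa using h
    have h3 : l ++ [b.getD l.length 0] = b.take (l.length + 1) := by
      rw [List.take_succ_eq_append_getElem h1.1, h1.2, List.getD_eq_getElem _ _ h1.1]
    have h4 : 2 * b.getD l.length 0 / 2 = b.getD l.length 0 := by omega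
    refine ⟨fun _ => ?_, fun h => by omega⟩
    rw [h4, h3]
    refine ⟨hT _ _ _ hbT, fun w' hw' _ => ?_⟩
    obtain rfl := hw.unique hw'
    rw [← hb, IsPrefix, List.length_take, min_eq_left h1.1]
  · obtain rfl : 1 = k := by simpa using h
    refine ⟨fun h => by omega, fun _ w' hw' => .inr ?_⟩
    obtain rfl := hw.unique hw'
    rw [← hb]
    rintro (h3 | h3)
    · refine h1 ⟨?_, h3⟩
      by_contra h4
      refine h2 ?_
      have : b = l := by rwa [IsPrefix, List.take_of_length_le (not_lt.1 h4)] at h3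
      simp [this, IsPrefix]
    · exact h2 h3

/-- Without a first play, all conditions on answers are vacuous, except that extensions must stay in
the tree. -/
theorem pathAnswer_true {n c s k : ℕ} {f : ℕ → ℕ} (hf : ∀ m, T (n, initial f m))
    (hw : ¬ ∃ w, FirstPlay T n c w) (h : pathAnswer f s = [k]) : Answer T n c s k := by
  unfold pathAnswer at h
  unfold Answer
  set l := ofNat (List ℕ) s with hl
  split_ifs at h with h1
  · obtain rfl : 2 * f l.length = k := by simpa using h
    refine ⟨fun _ => ⟨?_, fun w h => (hw ⟨w, h⟩).elim⟩, fun _ w h => (hw ⟨w, h⟩).elim⟩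
    have : 2 * f l.length / 2 = f l.length := by omega
    have h2 : initial f (l.length + 1) = l ++ [f l.length] := by
      conv_rhs => rw [← h1]
      simp [initial, List.range_succ]
    rw [this, ← h2]
    exact hf _
  · obtain rfl : 1 = k := by simpa using h
    exact ⟨fun h => by omega, fun _ w h => (hw ⟨w, h⟩).elim⟩

/-- If the tree has a path, no program meets the requirements. -/
theorem not_exists_path_of_met (hT : ∀ n l m, T (n, l) → T (n, l.take m)) {n : ℕ} {σ : Strategy}
    {code : Nat.Partrec.Code} (hσ : Computes code σ)
    (h : ∀ X c r, FirstMove (play σ X) .user {[c]} r [c] → ∀ i j u r',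
      LaunchedAt (component (play σ X) c r) i j u r' → ∀ t,
        AntecedentMet (Answer T n c)
          (antecedentRun (instanceRun (component (play σ X) c r) i r')) t →
        ConsequentMet (Good T n c)
          (consequentRun (instanceRun (component (play σ X) c r) i r')) t) :
    ¬ ∃ f : ℕ → ℕ, ∀ m, T (n, initial f m) := by
  rintro ⟨f, hf⟩
  -- Diagonalization: the user's input is the number of the program itself.
  set c := encode code with hc
  have hplays {w y : ℕ} : Plays T n c w y ↔ T (n, branchOf w) ∧ 2 ≤ w.unpair.2 ∧
      σ ((List.range w.unpair.2).map (userReal c (branchAnswer (branchOf w)))) = [c, 2, 0, y] := by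
    unfold Plays
    rw [hc, ofNat_encode, ← hc]
    refine and_congr Iff.rfl (and_congr Iff.rfl ⟨fun h => ?_, fun h => ?_⟩)
    · have := Part.mem_unique h (hσ _)
      exact (encode_injective this).symm
    · rw [← h]
      exact hσ _
  have hmet (ρ : ℕ → List ℕ) := h (userReal c ρ) c 1 firstMove_userReal 0 0 0 3 launchedAt_userReal
  by_cases hw : ∃ w, FirstPlay T n c w
  · obtain ⟨w, hw⟩ := hw
    obtain ⟨y, hy⟩ := hw.1
    obtain ⟨h1, h2, h3⟩ := hplays.1 hy
    set b := branchOf w with hb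
    set t := w.unpair.2 with ht
    -- Time `2 * t + 1` is just after the move in which the program plays `y`. At a finite time
    -- unanswered inputs violate nothing, so the silences of `branchAnswer` are allowed, while `y`
    -- already has to be good.
    refine ((hmet (branchAnswer b) (2 * t + 1 : ℕ) (antecedentMet_userInstance
      (fun s k => hw.branchAnswer_true hT)
      fun h => (ENat.natCast_ne_top _ h).elim)).2 y (2 * t) (by norm_cast; omega)
      ⟨⟨y, rfl⟩, consequent_userInstance_eq_iff.2 ⟨t, h2, rfl, h3⟩, ?_⟩) w hw hy
    rintro q hq _ ⟨y', rfl⟩ h4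
    obtain ⟨t', h5, rfl, h6⟩ := consequent_userInstance_eq_iff.1 h4
    -- An earlier choice in this play would be a play against the same branch at a smaller time,
    -- hence with a smaller code than `w`.
    refine hw.2 (Nat.pair (encode b) t') ?_ ⟨y', hplays.2 ?_⟩
    · have h7 : w = Nat.pair (encode b) t := by
        rw [hb, branchOf, encode_ofNat, ht, Nat.pair_unpair]
      conv_rhs => rw [h7]
      exact Nat.pair_lt_pair_right _ (by omega)
    · simpa [branchOf] using ⟨h1, h5, h6⟩
  -- The user who follows the path answers every input, so the requirements on the antecedent are
  -- met up to infinity and the program has to choose.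
  · obtain ⟨r, _, ⟨y, rfl⟩, h1, -⟩ := (hmet (pathAnswer f) ⊤ (antecedentMet_userInstance
      (fun s k => pathAnswer_true hf hw) fun _ s => by
        unfold pathAnswer
        split_ifs <;> exact ⟨_, rfl⟩)).1 rfl
    obtain ⟨t, h2, rfl, h3⟩ := consequent_userInstance_eq_iff.1 h1
    -- Up to the choice, a finite part of the path produces the same moves, and this finite branch
    -- lies in the tree.
    obtain ⟨m, hm⟩ := exists_branch (f := f) c t
    have : Plays T n c (Nat.pair (encode (initial f m)) t) y := by
      refine hplays.2 ?_
      simp only [branchOf, Nat.unpair_pair, ofNat_encode, hm]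
      exact ⟨hf m, h2, h3⟩
    obtain ⟨w, -, hw'⟩ := exists_firstPlay this
    exact hw ⟨w, hw'⟩

end

end NarrowTruth

namespace NarrowTruth

open Encodable Denumerable

/-! ### The witness's side -/

/-- In the finite interaction `L` about `∀s ∃k …`, the input `s` has been answered by `k`. -/
def Trace.Answered (L : Trace) (s k : ℕ) : Prop :=
  ∃ r < L.length, (L.getD r blank = (.user, [s]) ∧ ∀ q < r, ¬ L.getD q blank = (.user, [s])) ∧
    ∃ q < L.length, (r < q ∧ L.getD q blank = (.witness, [s, k])) ∧
      ∀ q' < q, ¬ (r < q' ∧ (L.getD q' blank).1 = .witness ∧ (L.getD q' blank).2.length = 2 ∧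
        (L.getD q' blank).2.head? = some s)

theorem answered_prefix_iff {D : Run} {N s k : ℕ} :
    (D.prefix N).Answered s k ↔ ∃ r < N, FirstMove D .user {[s]} r [s] ∧
      ∃ q < N, FirstMove (component D s r) .witness {m | ∃ n, m = [n]} q [k] := by
  unfold Trace.Answered
  rw [Run.length_prefix]
  refine exists_congr fun r => and_congr_right fun hr => and_congr ?_ (exists_congr fun q =>
    and_congr_right fun hq => ?_)
  · rw [Run.getD_prefix _ hr]
    constructor
    · rintro ⟨h1, h2⟩
      refine ⟨rfl, h1, ?_⟩
      rintro q hq m rfl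
      have := h2 q hq
      rwa [Run.getD_prefix _ (hq.trans hr)] at this
    · rintro ⟨-, h1, h2⟩
      refine ⟨h1, fun q hq => ?_⟩
      rw [Run.getD_prefix _ (hq.trans hr)]
      exact h2 q hq _ rfl
  · rw [Run.getD_prefix _ hq]
    unfold FirstMove
    rw [component_eq_iff]
    have key : ∀ q' < q, (¬ (r < q' ∧ ((D.prefix N).getD q' blank).1 = .witness ∧
        ((D.prefix N).getD q' blank).2.length = 2 ∧
        ((D.prefix N).getD q' blank).2.head? = some s)) ↔
        ∀ m' ∈ {m : Move | ∃ n, m = [n]}, component D s r q' ≠ (.witness, m') := by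
      intro q' hq'
      rw [Run.getD_prefix _ (hq'.trans hq)]
      constructor
      · rintro h _ ⟨n, rfl⟩ h'
        obtain ⟨h1, h2⟩ := component_eq_iff.1 h'
        exact h (by simp [h1, h2])
      · rintro h ⟨h1, h2, h3, h4⟩
        rcases hD : D q' with ⟨p, m⟩
        rw [hD] at h2 h3 h4
        match m, h3 with
        | [x, y], _ =>
          simp only [List.head?_cons, Option.some.injEq] at h2 h4
          subst h2 h4
          exact h [y] ⟨y, rfl⟩ (component_eq_iff.2 ⟨h1, hD⟩)
    constructor
    · rintro ⟨h1, h2⟩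
      exact ⟨⟨k, rfl⟩, h1, fun q' hq' => (key q' hq').1 (h2 q' hq')⟩
    · rintro ⟨-, h1, h2⟩
      exact ⟨h1, fun q' hq' => (key q' hq').2 (h2 q' hq')⟩

/-- The answers along the sequence `l` extend it by its next entry, and the answer to `l` itself
is the odd number given by `y`. -/
def Trace.Chain (L : Trace) (s y : ℕ) : Prop :=
  L.Answered s (2 * y + 1) ∧ ∀ j < (ofNat (List ℕ) s).length,
    L.Answered (encode ((ofNat (List ℕ) s).take j)) (2 * (ofNat (List ℕ) s).getD j 0)

/-- The schedule of the witness: at every step one of five numbers `(flag, c, i, s, y)`; each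
such tuple has its turn infinitely often. -/
def schedule (N : ℕ) : ℕ × ℕ × ℕ × ℕ × ℕ :=
  (N.unpair.2.unpair.1, N.unpair.2.unpair.2.unpair.1, N.unpair.2.unpair.2.unpair.2.unpair.1,
    N.unpair.2.unpair.2.unpair.2.unpair.2.unpair.1, N.unpair.2.unpair.2.unpair.2.unpair.2.unpair.2)

theorem exists_schedule (x : ℕ × ℕ × ℕ × ℕ × ℕ) (M : ℕ) : ∃ N ≥ M, schedule N = x :=
  ⟨Nat.pair M (Nat.pair x.1 (Nat.pair x.2.1 (Nat.pair x.2.2.1 (Nat.pair x.2.2.2.1 x.2.2.2.2)))),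
    Nat.left_le_pair _ _, by simp only [schedule, Nat.unpair_pair]⟩

@[fun_prop] theorem primrec_schedule {α : Type} [Primcodable α] {N : α → ℕ} (hN : Primrec N) :
    Primrec fun a => schedule (N a) := by
  unfold schedule; fun_prop

attribute [irreducible] schedule

/-- The moves of the witness, with the choices in consequents left out. -/
def baseMove (N : ℕ) : Move :=
  if (schedule N).1 = 0 then [(schedule N).2.1, 1, (schedule N).2.2.1, (schedule N).2.2.2.1]
  else [(schedule N).2.1, 2, (schedule N).2.2.1]

/-- The play as reconstructed from the user's moves alone. With placeholders for the choices in
consequents the strategy need not be evaluated recursively at earlier stages, and antecedents are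
unaffected. -/
def baseTrace (h : List Move) : Trace :=
  (List.range (2 * h.length)).map fun q =>
    if q % 2 = 0 then (.witness, baseMove (q / 2)) else (.user, h.getD (q / 2) [])

def antecedentTrace (h : List Move) (c i : ℕ) : Trace :=
  (Trace.instance i (Trace.component c ((baseTrace h).findIdx fun x => x = (.user, [c]))
    (baseTrace h))).map antecedentStep

open Classical in
-- Neither the end `s` of a chain nor the number `y` is computed: the schedule proposes all
-- combinations, and a choice is made only when a chain already supports it.
noncomputable def witnessStrategy (h : List Move) : Move :=
  if ¬ (schedule h.length).1 = 0 ∧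
      (antecedentTrace h (schedule h.length).2.1 (schedule h.length).2.2.1).Chain
        (schedule h.length).2.2.2.1 (schedule h.length).2.2.2.2 then
    [(schedule h.length).2.1, 2, (schedule h.length).2.2.1, (schedule h.length).2.2.2.2]
  else baseMove h.length

section

variable {α : Type} [Primcodable α]

@[fun_prop] theorem primrec_baseMove {N : α → ℕ} (hN : Primrec N) :
    Primrec fun a => baseMove (N a) := by
  unfold baseMove; fun_prop

@[fun_prop] theorem primrec_baseTrace {h : α → List Move} (hh : Primrec h) :
    Primrec fun a => baseTrace (h a) := by
  unfold baseTrace; fun_prop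

@[fun_prop] theorem primrec_findIdx {L : α → Trace} {x : α → Role × Move} (hL : Primrec L)
    (hx : Primrec x) : Primrec fun a => (L a).findIdx fun y => y = x a := by
  refine Primrec.list_findIdx (p := fun a y => decide (y = x a)) hL ?_
  exact PrimrecPred.decide (p := fun p : α × (Role × Move) => p.2 = x p.1) (by fun_prop)

@[fun_prop] theorem primrec_antecedentTrace {h : α → List Move} {c i : α → ℕ} (hh : Primrec h)
    (hc : Primrec c) (hi : Primrec i) : Primrec fun a => antecedentTrace (h a) (c a) (i a) := by
  unfold antecedentTrace; fun_prop

@[fun_prop] theorem primrecPred_answered {L : α → Trace} {s k : α → ℕ} (hL : Primrec L)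
    (hs : Primrec s) (hk : Primrec k) : PrimrecPred fun a => (L a).Answered (s a) (k a) := by
  unfold Trace.Answered; fun_prop

@[fun_prop] theorem primrecPred_chain {L : α → Trace} {s y : α → ℕ} (hL : Primrec L)
    (hs : Primrec s) (hy : Primrec y) : PrimrecPred fun a => (L a).Chain (s a) (y a) := by
  unfold Trace.Chain; fun_prop

end

theorem primrec_witnessStrategy : Primrec witnessStrategy := by
  classical
  unfold witnessStrategy; fun_prop

theorem exists_computes_witnessStrategy : ∃ c, Computes c witnessStrategy := by
  have := Partrec.nat_iff.1 (Computable.partrec (Primrec.to_comp (α := ℕ) (f := fun n =>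
    encode (witnessStrategy (ofNat (List Move) n)))
    (Primrec.encode.comp (primrec_witnessStrategy.comp (Primrec.ofNat _)))))
  obtain ⟨c, hc⟩ := Nat.Partrec.Code.exists_code.1 this
  refine ⟨c, fun h => ?_⟩
  rw [hc]
  simp

/-- Moves in consequents made by the witness do not influence antecedents. -/
theorem antecedent_instanceHistory_congr {Γ Γ' : Run} (h : ∀ q, Γ q = Γ' q ∨
    ∃ i m m', Γ q = (.witness, 2 :: i :: m) ∧ Γ' q = (.witness, 2 :: i :: m')) (T i : ℕ) :
    antecedentRun (instanceHistory Γ T i) = antecedentRun (instanceHistory Γ' T i) := by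
  have hL (i : ℕ) (q : ℕ) : IsLaunch i (Γ q) ↔ IsLaunch i (Γ' q) := by
    rcases h q with h | ⟨_, _, _, h1, h2⟩
    · rw [h]
    · rw [h1, h2]
      simp [IsLaunch]
  have hB (i T : ℕ) : (∃ y ∈ (Γ.prefix T).reverse, IsLaunch i y) ↔
      ∃ y ∈ (Γ'.prefix T).reverse, IsLaunch i y := by
    simp [Run.prefix, hL]
  funext q
  rw [antecedentRun_apply, antecedentRun_apply]
  induction T generalizing i with
  | zero => rfl
  | succ T ih =>
    rw [instanceHistory_succ, instanceHistory_succ]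
    rcases h T with h | ⟨i', m, m', h1, h2⟩
    · have : historyStep q (Γ.prefix T).reverse i (Γ T) =
          historyStep q (Γ'.prefix T).reverse i (Γ' T) := by
        unfold historyStep
        rw [h]
        simp only [List.length_reverse, Run.length_prefix]
        by_cases hb : ∃ y ∈ (Γ'.prefix T).reverse, IsLaunch i y
        · have hb' := (hB i T).2 hb
          simp only [hb, hb']
        · have hb' := mt (hB i T).1 hb
          simp only [hb, hb']
      rw [this]
      rcases historyStep q (Γ'.prefix T).reverse i (Γ' T) with j | x
      · exact ih j
      · rfl
    · have hx : ¬ IsLaunch i (Γ T) := by rw [h1]; simp [IsLaunch]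
      have hx' : ¬ IsLaunch i (Γ' T) := by rw [h2]; simp [IsLaunch]
      by_cases hi : i' = i ∧ (∃ y ∈ (Γ'.prefix T).reverse, IsLaunch i y) ∧ q = T
      · obtain ⟨rfl, hb, rfl⟩ := hi
        rw [h1, h2, historyStep_of_move hb (.inr rfl) (by simp),
          historyStep_of_move ((hB _ _).2 hb) (.inr rfl) (by simp)]
        rfl
      · rw [historyStep_of_not hx, historyStep_of_not hx']
        · exact ih i
        · rintro ⟨p, k, m, h3, h4, -, h5⟩
          rw [h2] at h3
          cases h3
          exact hi ⟨rfl, h4, by simpa using h5⟩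
        · rintro ⟨p, k, m, h3, h4, -, h5⟩
          rw [h1] at h3
          cases h3
          exact hi ⟨rfl, (hB _ _).1 h4, by simpa using h5⟩

theorem baseTrace_eq (X : ℕ → Move) (N : ℕ) :
    baseTrace ((List.range N).map X) =
      (play (fun h => baseMove h.length) X).prefix (2 * N) := by
  unfold baseTrace Run.prefix
  simp only [List.length_map, List.length_range]
  refine List.map_congr_left fun q hq => ?_
  have hq := List.mem_range.1 hq
  unfold play
  have : q / 2 < N := by omega
  simp [this]

theorem componentStep_cons {n r q k : ℕ} {p : Role} {m : Move} :
    componentStep n r q (p, k :: m) = (p, if k = n ∧ r < q then m else []) := by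
  simp [componentStep]

/-- What the strategy reconstructs is the actual antecedent: the real and the placeholder moves
differ only behind the tags of a consequent. -/
theorem antecedentTrace_eq {X : ℕ → Move} {N c r : ℕ} (i : ℕ) (hr : r < 2 * N)
    (h : FirstMove (play witnessStrategy X) .user {[c]} r [c]) :
    antecedentTrace ((List.range N).map X) c i =
      (antecedentRun (instanceHistory (component (play witnessStrategy X) c r) (2 * N) i)).prefix
        (2 * N) := by
  set M := play (fun h => baseMove h.length) X with hM
  have hu (q : ℕ) (m : Move) : play witnessStrategy X q = (.user, m) ↔ M q = (.user, m) := by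
    rw [play_eq_user_iff, hM, play_eq_user_iff]
  have hidx : (M.prefix (2 * N)).findIdx (fun x => x = (.user, [c])) = r := by
    have hr' : r < (M.prefix (2 * N)).length := by simpa using hr
    rw [List.findIdx_eq hr']
    constructor
    · simpa [Run.prefix] using (hu r _).1 h.2.1
    · intro q hq
      simpa [Run.prefix] using fun h' => h.2.2 q hq [c] rfl ((hu q _).2 h')
  unfold antecedentTrace
  rw [baseTrace_eq, ← hM, hidx, ← prefix_component, ← prefix_instanceHistory,
    ← prefix_antecedentRun]
  congr 1
  symm
  refine antecedent_instanceHistory_congr (fun q => ?_) _ _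
  rw [component_apply, component_apply]
  rcases Nat.even_or_odd' q with ⟨t, rfl | rfl⟩
  · have h1 : play witnessStrategy X (2 * t) = (.witness, witnessStrategy ((List.range t).map X)) :=
      play_eq_witness_iff.2 ⟨t, rfl, rfl⟩
    have h2 : M (2 * t) = (.witness, baseMove t) :=
      play_eq_witness_iff.2 ⟨t, rfl, by simp⟩
    rw [h1, h2]
    unfold witnessStrategy
    simp only [List.length_map, List.length_range]
    split_ifs with h3
    · rw [baseMove, if_neg (by simpa using h3.1)]
      rw [componentStep_cons, componentStep_cons]
      split_ifs
      · exact .inr ⟨_, _, _, rfl, rfl⟩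
      · exact .inl rfl
    · exact .inl rfl
  · have h1 : play witnessStrategy X (2 * t + 1) = (.user, X t) :=
      play_eq_user_iff.2 ⟨t, rfl, rfl⟩
    rw [h1, (hu _ _).1 h1]
    exact .inl rfl

theorem prefix_antecedentRun_congr {Δ Δ' : Run} {N : ℕ} (h : ∀ q < N, Δ q = Δ' q) :
    Run.prefix (antecedentRun Δ) N = Run.prefix (antecedentRun Δ') N := by
  refine List.map_congr_left fun q hq => ?_
  rw [antecedentRun_apply, antecedentRun_apply, h q (List.mem_range.1 hq)]

theorem witnessStrategy_eq_iff {h : List Move} {c i y : ℕ} :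
    witnessStrategy h = [c, 2, i, y] ↔ ∃ k s, schedule h.length = (k + 1, c, i, s, y) ∧
      (antecedentTrace h c i).Chain s y := by
  rcases hs : schedule h.length with ⟨k', c', i', s', y'⟩
  unfold witnessStrategy baseMove
  simp only [hs]
  split_ifs with h1 h2
  · simp only [hs] at h1
    obtain ⟨k, rfl⟩ := Nat.exists_eq_succ_of_ne_zero h1.1
    simp only [List.cons.injEq, Prod.mk.injEq]
    constructor
    · rintro ⟨rfl, -, rfl, rfl, -⟩
      exact ⟨k, s', by simp, h1.2⟩
    · rintro ⟨k'', s'', ⟨-, rfl, rfl, -, rfl⟩, -⟩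
      simp
  · simp [h2]
  · simp only [List.cons.injEq, reduceCtorEq, and_false, Prod.mk.injEq, false_iff, not_exists]
    rintro k s ⟨⟨rfl, rfl, rfl, rfl, rfl⟩, h3⟩
    simp only [hs] at h1
    exact h1 ⟨by simp, h3⟩

/-- Every choice of the witness in a consequent is preceded by a chain of answers. -/
theorem exists_chain_of_choice {X : ℕ → Move} {c r : ℕ}
    (h : FirstMove (play witnessStrategy X) .user {[c]} r [c]) {T i q y : ℕ}
    (hq : instanceHistory (component (play witnessStrategy X) c r) T i q = (.witness, [2, y])) :
    ∃ s, ((antecedentRun (instanceHistory (component (play witnessStrategy X) c r) T i)).prefix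
      q).Chain s y := by
  set Γ := component (play witnessStrategy X) c r with hΓ
  induction T generalizing i q with
  | zero => simp [instanceHistory] at hq
  | succ T ih =>
    have same (hs : ∀ q, historyStep q (Γ.prefix T).reverse i (Γ T) = .inl i) :
        ∃ s, ((antecedentRun (instanceHistory Γ (T + 1) i)).prefix q).Chain s y := by
      have : instanceHistory Γ (T + 1) i = instanceHistory Γ T i := by
        funext q'
        rw [instanceHistory_succ, hs, Sum.elim_inl]
      rw [this] at hq ⊢
      exact ih hq
    by_cases hL : IsLaunch i (Γ T)
    · by_cases hb : ∃ y ∈ (Γ.prefix T).reverse, IsLaunch i y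
      · exact same fun q => historyStep_of_launched hL hb
      -- A copied choice at `q < u` brings with it the whole antecedent of instance `j` before `q`,
      -- including its chain.
      · obtain ⟨j, u, hT⟩ := isLaunch_iff.1 hL
        have hh (q' : ℕ) : instanceHistory Γ (T + 1) i q' =
            if q' < u then instanceHistory Γ T j q' else blank := by
          rw [instanceHistory_succ, hT, historyStep_of_launch hb]
          split_ifs <;> rfl
        rw [hh] at hq
        split_ifs at hq with hu
        · obtain ⟨s, hs⟩ := ih hq
          refine ⟨s, ?_⟩
          rwa [prefix_antecedentRun_congr fun q' hq' => (hh q').trans (if_pos (hq'.trans hu))]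
        · simp [blank] at hq
    · by_cases hb : ∃ y ∈ (Γ.prefix T).reverse, IsLaunch i y
      · have hh (q' : ℕ) (hq' : q' ≠ T) :
            instanceHistory Γ (T + 1) i q' = instanceHistory Γ T i q' := by
          rw [instanceHistory_succ, historyStep_of_not hL]
          · rfl
          · rintro ⟨_, _, _, _, _, _, h'⟩
            exact hq' (by simpa using h')
        by_cases hqT : q = T
        · subst hqT
          rw [prefix_antecedentRun_congr fun q' hq' => hh q' hq'.ne]
          obtain ⟨j, u, r', hl⟩ : ∃ j u r', LaunchedAt Γ i j u r' ∧ r' < q := by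
            obtain ⟨r', h1, j, u, h2⟩ := exists_isLaunch_iff.1 hb
            exact ⟨j, u, r', h2, h1⟩
          rw [← instanceRun_of_lt hl.1 hl.2, instanceRun_eq_iff_of_lt hl.1 hl.2, hΓ,
            component_eq_iff, play_eq_witness_iff] at hq
          -- A fresh choice falls on a turn `q = 2 * N` of the witness, and the strategy has checked
          -- the chain among the moves before that time.
          obtain ⟨-, hr, N, rfl, hN⟩ := hq
          obtain ⟨k, s, -, hs⟩ := witnessStrategy_eq_iff.1 hN
          rw [antecedentTrace_eq i hr h] at hs
          exact ⟨s, hs⟩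
        · rw [hh q hqT] at hq
          have : q < T := by
            by_contra h'
            rw [instanceHistory_blank (not_lt.1 h')] at hq
            simp [blank] at hq
          obtain ⟨s, hs⟩ := ih hq
          refine ⟨s, ?_⟩
          rwa [prefix_antecedentRun_congr fun q' hq' => hh q' (hq'.trans this).ne]
      · exact same fun q => historyStep_of_not hL fun ⟨_, _, _, _, h', _⟩ => hb h'

section

variable {T : ℕ × List ℕ → Prop} {n c : ℕ}

/-- Induction along the chain: the empty sequence is compatible with the singled-out branch, and
true even answers cannot leave it before its end. At the last sequence the excuse of incompatibility
thus fails, and a true odd answer must disclose a good number. -/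
theorem good_of_chain {s y : ℕ} (h1 : Answer T n c s (2 * y + 1))
    (h2 : ∀ j < (ofNat (List ℕ) s).length, Answer T n c (encode ((ofNat (List ℕ) s).take j))
      (2 * (ofNat (List ℕ) s).getD j 0)) : Good T n c y := by
  intro w hw
  set l := ofNat (List ℕ) s with hl
  have hcompat : ∀ j ≤ l.length,
      IsPrefix (l.take j) (branchOf w) ∨ IsPrefix (branchOf w) (l.take j) := by
    intro j hj
    induction j with
    | zero => simp [IsPrefix]
    | succ j ih =>
      have h3 : l.take (j + 1) = l.take j ++ [l.getD j 0] := by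
        rw [List.take_succ_eq_append_getElem hj, List.getD_eq_getElem _ _ hj]
      have h4 : 2 * l.getD j 0 / 2 = l.getD j 0 := by omega
      by_cases h5 : IsPrefix (branchOf w) (l.take j)
      · right
        have h6 : (branchOf w).length ≤ j := by
          have := congrArg List.length h5
          simp at this
          omega
        rw [IsPrefix, List.take_take, min_eq_left (by omega)]
        rwa [IsPrefix, List.take_take, min_eq_left h6] at h5
      · left
        have h6 : IsPrefix (l.take j) (branchOf w) := (ih (by omega)).resolve_right h5
        have h7 := ((h2 j hj).1 (by omega)).2 w hw
        rw [ofNat_encode, h4, ← h3] at h7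
        refine h7 ⟨?_, h6⟩
        by_contra h8
        refine h5 ?_
        have : branchOf w = l.take j := by
          rwa [IsPrefix, List.take_of_length_le (not_lt.1 h8)] at h6
        rw [this, IsPrefix, List.take_length]
  have h3 := h1.2 (by omega) w hw
  rw [show (2 * y + 1) / 2 = y by omega, ← hl] at h3
  refine h3.resolve_right (not_not.2 ?_) w hw
  simpa using hcompat l.length le_rfl

/-- Following `κ` from the empty sequence, even answers forever would trace an infinite path of the
tree; the first odd answer ends the chain. -/
theorem exists_chain (hT : ∀ n l m, T (n, l) → T (n, l.take m))
    (hn : ¬ ∃ f : ℕ → ℕ, ∀ m, T (n, initial f m)) {κ : ℕ → ℕ}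
    (hκ : ∀ s, Answer T n c s (κ s)) :
    ∃ s y, κ s = 2 * y + 1 ∧ ∀ j < (ofNat (List ℕ) s).length,
      κ (encode ((ofNat (List ℕ) s).take j)) = 2 * (ofNat (List ℕ) s).getD j 0 := by
  classical
  -- `L m` is the sequence reached after `m` steps when half of each answer, rounded down, is
  -- appended; it equals `initial f m`.
  let L : ℕ → List ℕ := fun m => m.rec [] fun _ l => l ++ [κ (encode l) / 2]
  have hL (m : ℕ) : L (m + 1) = L m ++ [κ (encode (L m)) / 2] := rfl
  let f : ℕ → ℕ := fun m => κ (encode (L m)) / 2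
  have hf (m : ℕ) : initial f m = L m := by
    induction m with
    | zero => rfl
    | succ m ih => rw [hL, ← ih, initial, List.range_succ, List.map_append, ← initial, ih]; rfl
  have hodd : ∃ m, κ (encode (L m)) % 2 = 1 := by
    by_contra h
    push Not at h
    refine hn ⟨f, fun m => ?_⟩
    have h1 := ((hκ (encode (L m))).1 (by have := h m; omega)).1
    rw [ofNat_encode, ← hL, ← hf (m + 1)] at h1
    have := hT _ _ m h1
    rwa [take_initial _ (Nat.le_succ m)] at this
  set m := Nat.find hodd with hm
  have hspec : κ (encode (L m)) % 2 = 1 := Nat.find_spec hodd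
  refine ⟨encode (L m), κ (encode (L m)) / 2, by omega, fun j hj => ?_⟩
  rw [ofNat_encode] at hj ⊢
  rw [← hf, length_initial] at hj
  have h1 : (L m).take j = L j := by rw [← hf, ← hf, take_initial _ hj.le]
  have h2 : (L m).getD j 0 = κ (encode (L j)) / 2 := by
    rw [← hf]
    simp [initial, hj, f]
  rw [h1, h2]
  have := Nat.find_min hodd hj
  omega

/-- At infinity the witness must have found a chain, by the absence of paths. At every time its
choices are justified by answers given earlier, which are true as long as the antecedent's
requirements are met. -/
theorem consequentMet_of_antecedentMet (hT : ∀ n l m, T (n, l) → T (n, l.take m))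
    (hn : ¬ ∃ f : ℕ → ℕ, ∀ m, T (n, initial f m)) {X : ℕ → Move} {r : ℕ}
    (h : FirstMove (play witnessStrategy X) .user {[c]} r [c]) {i j u r' : ℕ}
    (h' : LaunchedAt (component (play witnessStrategy X) c r) i j u r') {t : ℕ∞}
    (ha : AntecedentMet (Answer T n c)
      (antecedentRun (instanceRun (component (play witnessStrategy X) c r) i r')) t) :
    ConsequentMet (Good T n c)
      (consequentRun (instanceRun (component (play witnessStrategy X) c r) i r')) t := by
  set Γ := component (play witnessStrategy X) c r with hΓ
  set Δ := instanceRun Γ i r' with hΔ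
  have hpre {N N' : ℕ} (h1 : r' < N') (h2 : N ≤ N') :
      (antecedentRun (instanceHistory Γ N' i)).prefix N = (antecedentRun Δ).prefix N := by
    refine prefix_antecedentRun_congr fun q hq => ?_
    rw [hΔ, instanceRun]
    rcases le_total (r' + q + 1) N' with h3 | h3
    · exact instanceHistory_eq_of_le h' (by omega) (by omega) h3
    · exact (instanceHistory_eq_of_le h' h1 (by omega) h3).symm
  have hΔw {N k : ℕ} {m : Move} (hr : r < 2 * N) (hr' : r' < 2 * N) (hk : k = 1 ∨ k = 2)
      (hN : witnessStrategy ((List.range N).map X) = c :: k :: i :: m) :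
      Δ (2 * N) = (.witness, k :: m) := by
    rw [hΔ, instanceRun_eq_iff_of_lt h' hr', hΓ, component_eq_iff, play_eq_witness_iff]
    exact ⟨hk, hr, N, rfl, hN⟩
  constructor
  · rintro rfl
    have hask (s : ℕ) : ∃ r₀, FirstMove (antecedentRun Δ) .user {[s]} r₀ [s] := by
      obtain ⟨N, hN, hs⟩ := exists_schedule (0, c, i, s, 0) (r + r' + 1)
      refine exists_firstMove_singleton (r := 2 * N) ?_
      rw [antecedentRun_eq_iff]
      refine hΔw (by omega) (by omega) (.inl rfl) ?_
      unfold witnessStrategy baseMove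
      simp [hs]
    have hans (s : ℕ) : ∃ k N, ∀ N' ≥ N, ((antecedentRun Δ).prefix N').Answered s k := by
      obtain ⟨r₀, hr₀⟩ := hask s
      obtain ⟨r₁, _, hr₁⟩ := (ha s r₀ (ENat.natCast_lt_top r₀) hr₀).1 rfl
      obtain ⟨k, rfl⟩ := hr₁.1
      exact ⟨k, r₀ + r₁ + 1, fun N' hN' =>
        answered_prefix_iff.2 ⟨r₀, by omega, hr₀, r₁, by omega, hr₁⟩⟩
    choose κ M hκ using hans
    have hκ' (s : ℕ) : Answer T n c s (κ s) := by
      obtain ⟨r₀, -, hr₀, r₁, -, hr₁⟩ := answered_prefix_iff.1 (hκ s _ le_rfl)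
      exact (ha s r₀ (ENat.natCast_lt_top r₀) hr₀).2 _ r₁ (ENat.natCast_lt_top r₁) hr₁
    obtain ⟨s, y, hy, hs⟩ := exists_chain hT hn hκ'
    obtain ⟨K, hK⟩ : ∃ K, ∀ j < (ofNat (List ℕ) s).length,
        M (encode ((ofNat (List ℕ) s).take j)) ≤ K :=
      ⟨(Finset.range (ofNat (List ℕ) s).length).sup fun j =>
        M (encode ((ofNat (List ℕ) s).take j)), fun j hj =>
          Finset.le_sup (f := fun j => M (encode ((ofNat (List ℕ) s).take j)))
            (Finset.mem_range.2 hj)⟩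
    -- A turn proposing this chain, late enough for the component to be open, the instance launched
    -- and all the answers of the chain given.
    obtain ⟨N, hN, hsch⟩ := exists_schedule (1, c, i, s, y) (r + r' + K + M s + 1)
    refine exists_firstMove ⟨2 * N, [y], ⟨y, rfl⟩, ?_⟩
    rw [consequentRun_eq_iff]
    refine hΔw (by omega) (by omega) (.inr rfl) (witnessStrategy_eq_iff.2 ⟨0, s, ?_, ?_⟩)
    · simpa using hsch
    · rw [antecedentTrace_eq i (by omega) h, ← hΓ, hpre (by omega) le_rfl]
      refine ⟨?_, fun j hj => ?_⟩
      · rw [← hy]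
        exact hκ s _ (by omega)
      · rw [← hs j hj]
        exact hκ _ _ (by have := hK j hj; omega)
  -- The supporting chain lies before the time `q` of the choice, hence before `t`, where the
  -- antecedent's requirements guarantee true answers.
  · rintro y q hq ⟨-, hy, -⟩
    rw [consequentRun_eq_iff] at hy
    have hy' : instanceHistory Γ (r' + q + 1) i q = (.witness, [2, y]) := hy
    obtain ⟨s, h1, h2⟩ := exists_chain_of_choice h hy'
    rw [← hΓ, hpre (by omega) (by omega)] at h1 h2
    have htrue {s k : ℕ} (hs : ((antecedentRun Δ).prefix q).Answered s k) : Answer T n c s k := by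
      obtain ⟨r₀, h3, hr₀, r₁, h4, hr₁⟩ := answered_prefix_iff.1 hs
      exact (ha s r₀ (lt_trans (by exact_mod_cast h3) hq) hr₀).2 k r₁
        (lt_trans (by exact_mod_cast h4) hq) hr₁
    exact good_of_chain (htrue h1) fun j hj => htrue (h2 j hj)

end

end NarrowTruth

/-! ### Gödel numbers and the many-one reduction -/

namespace NarrowTruth

open Encodable Denumerable

/-! ### Decoding -/

theorem unpair_right_lt {a : ℕ} (h : 0 < a.unpair.1) : a.unpair.2 < a := by
  have := Nat.add_le_pair a.unpair.1 a.unpair.2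
  rw [Nat.pair_unpair] at this
  omega

theorem left_lt {a : ℕ} (h : 0 < a.unpair.1) : a.unpair.2.unpair.1 < a :=
  (Nat.unpair_left_le _).trans_lt (unpair_right_lt h)

theorem right_lt {a : ℕ} (h : 0 < a.unpair.1) : a.unpair.2.unpair.2 < a :=
  (Nat.unpair_right_le _).trans_lt (unpair_right_lt h)

/-- The term with a given code; every number is read as the code of a term. -/
def Term.ofCode (a : ℕ) : Term :=
  if a.unpair.1 = 0 then .var a.unpair.2
  else if a.unpair.1 = 1 then .zero
  else if a.unpair.1 = 2 then .one
  else if a.unpair.1 = 3 then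
    .add (Term.ofCode a.unpair.2.unpair.1) (Term.ofCode a.unpair.2.unpair.2)
  else .mul (Term.ofCode a.unpair.2.unpair.1) (Term.ofCode a.unpair.2.unpair.2)
termination_by a
decreasing_by
  all_goals first | exact left_lt (by omega) | exact right_lt (by omega)

/-- The formula with a given code; every number is read as the code of a formula. -/
def Formula.ofCode (a : ℕ) : ArithFormula :=
  if a.unpair.1 = 0 then
    .eq (Term.ofCode a.unpair.2.unpair.1) (Term.ofCode a.unpair.2.unpair.2)
  else if a.unpair.1 = 1 then
    .lt (Term.ofCode a.unpair.2.unpair.1) (Term.ofCode a.unpair.2.unpair.2)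
  else if a.unpair.1 = 2 then .neg (Formula.ofCode a.unpair.2)
  else if a.unpair.1 = 3 then
    .and (Formula.ofCode a.unpair.2.unpair.1) (Formula.ofCode a.unpair.2.unpair.2)
  else if a.unpair.1 = 4 then
    .or (Formula.ofCode a.unpair.2.unpair.1) (Formula.ofCode a.unpair.2.unpair.2)
  else if a.unpair.1 = 5 then
    .imp (Formula.ofCode a.unpair.2.unpair.1) (Formula.ofCode a.unpair.2.unpair.2)
  else if a.unpair.1 = 6 then .all a.unpair.2.unpair.1 (Formula.ofCode a.unpair.2.unpair.2)
  else .ex a.unpair.2.unpair.1 (Formula.ofCode a.unpair.2.unpair.2)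
termination_by a
decreasing_by
  all_goals first
    | exact unpair_right_lt (by omega) | exact left_lt (by omega) | exact right_lt (by omega)

theorem Term.ofCode_code (t : Term) : Term.ofCode t.code = t := by
  induction t <;> rw [Term.ofCode] <;> simp [Term.code, *]

theorem Formula.ofCode_code (A : ArithFormula) : Formula.ofCode A.code = A := by
  induction A with
  | pred p => exact p.elim
  | _ => rw [Formula.ofCode]; simp [Formula.code, Term.ofCode_code, *]

theorem Formula.code_injective : Function.Injective (Formula.code : ArithFormula → ℕ) :=
  Function.LeftInverse.injective Formula.ofCode_code

/-- Every `Π¹₁` set is reducible to narrow constructive truth. -/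
theorem manyOneReducible_narrowTruth {R : Set ℕ} (hR : IsPi11 R) :
    ManyOneReducible (fun n => n ∈ R) fun n => n ∈ narrowTruth := by
  obtain ⟨T, hTa, hT, hRT⟩ := hR.exists_tree
  obtain ⟨A, hAV, hA⟩ := (arith_answer hTa).exists_negated_instance (V := {1, 2, 3, 4})
    fun e e' h => by
      simp [h 1 (by simp), h 2 (by simp), h 3 (by simp), h 4 (by simp)]
  -- Variable 2 must not be free in `B`: the quantifier over `s` stands in the antecedent only and
  -- would not bind it in the consequent.
  obtain ⟨B, hBV, hB⟩ := Arith.exists_negated_instance (V := {1, 3, 4})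
    (P := fun p => Good T p.1 p.2.1 p.2.2.2)
    ((arith_good hTa).comp (f := fun p : ℕ × ℕ × ℕ × ℕ => (p.1, p.2.1, p.2.2.2))
      (Primrec.to_comp (by fun_prop)))
    fun e e' h => by
      simp [h 1 (by simp), h 3 (by simp), h 4 (by simp)]
  let G : ℕ → ArithFormula := fun n => gameSentence
    (.ex 4 (.and (.eq (.var 4) (numeral n)) A)) (.ex 4 (.and (.eq (.var 4) (numeral n)) B))
  have hGs (n : ℕ) : (G n).IsSentence := by
    have hA' (x : ℕ) := @hAV x
    have hB' (x : ℕ) := @hBV x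
    simp only [Finset.mem_insert, Finset.mem_singleton] at hA' hB'
    ext x
    simp only [G, gameSentence, Formula.freeVars, Term.vars, vars_numeral, Finset.mem_erase,
      Finset.mem_union, Finset.mem_singleton, Finset.notMem_empty, or_false, iff_false]
    grind
  have hGc : Primrec fun n => (G n).code := by
    have := primrec_code_numeral
    simp only [G, gameSentence, Formula.code]
    fun_prop
  have hmet (n : ℕ) (e : ℕ → ℕ) (Γ : Run) := met_gameSentence_iff
    (a := fun c s k => Answer T n c s k) (b := fun c y => Good T n c y)
    (hA n) (hB n) (exists_answer n) (exists_good n) e Γ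
  have hG (n : ℕ) : n ∈ R ↔ NarrowTrue (G n) := by
    rw [hRT]
    constructor
    · intro h
      obtain ⟨c, hc⟩ := exists_computes_witnessStrategy
      exact ⟨c, witnessStrategy, hc, fun X => (hmet n _ _).2 fun c r h1 i j u r' h2 t h3 =>
        consequentMet_of_antecedentMet hT h h1 h2 h3⟩
    · rintro ⟨c, σ, hσ, h⟩
      exact not_exists_path_of_met hT hσ fun X => (hmet n _ _).1 (h X)
  refine ⟨fun n => (G n).code, hGc.to_comp, fun n => (hG n).trans ⟨fun h => ⟨G n, hGs n, h, rfl⟩, ?_⟩⟩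
  rintro ⟨A, -, h1, h2⟩
  rwa [← Formula.code_injective h2]

end NarrowTruth

/-! ### Upper bound: narrow constructive truth is `Π¹₁` -/

namespace NarrowTruth

open Encodable Denumerable

variable {α : Type} [Primcodable α]

/-! ### Codes are handled by recursive functions -/

/-- Recursion over the codes `< a`, from a step function that takes the list of earlier values. -/
theorem primrec_strongRec {σ : Type} [Primcodable σ] {f : α → ℕ → σ} {g : α → List σ → σ}
    (hg : Primrec fun p : α × List σ => g p.1 p.2)
    (h : ∀ x a, g x ((List.range a).map (f x)) = f x a) : Primrec fun p : α × ℕ => f p.1 p.2 :=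
  Primrec.nat_strong_rec f (g := fun x l => some (g x l)) (by unfold Primrec₂; fun_prop)
    fun x a => by rw [h]

theorem getD_map_range {σ : Type} (f : ℕ → σ) {a b : ℕ} (h : b < a) (d : σ) :
    ((List.range a).map f).getD b d = f b := by
  simp [h]

theorem primrec_val_ofCode :
    Primrec fun p : List ℕ × ℕ => (Term.ofCode p.2).val (env p.1) := by
  refine primrec_strongRec (f := fun l a => (Term.ofCode a).val (env l)) (g := fun l L =>
    if L.length.unpair.1 = 0 then env l L.length.unpair.2
    else if L.length.unpair.1 = 1 then 0
    else if L.length.unpair.1 = 2 then 1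
    else if L.length.unpair.1 = 3 then
      L.getD L.length.unpair.2.unpair.1 0 + L.getD L.length.unpair.2.unpair.2 0
    else L.getD L.length.unpair.2.unpair.1 0 * L.getD L.length.unpair.2.unpair.2 0)
    (by fun_prop) fun l a => ?_
  simp only [List.length_map, List.length_range]
  conv_rhs => rw [Term.ofCode]
  split_ifs with h1 h2 h3 h4
  · rfl
  · rfl
  · rfl
  · rw [getD_map_range _ (left_lt (by omega)), getD_map_range _ (right_lt (by omega))]; rfl
  · rw [getD_map_range _ (left_lt (by omega)), getD_map_range _ (right_lt (by omega))]; rfl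

@[fun_prop] theorem primrec_val {l : α → List ℕ} {a : α → ℕ} (hl : Primrec l) (ha : Primrec a) :
    Primrec fun x => (Term.ofCode (a x)).val (env (l x)) :=
  primrec_val_ofCode.comp (hl.pair ha)

theorem primrec_code_term : Primrec fun a => (Term.ofCode a).code := by
  refine (primrec_strongRec (f := fun (_ : Unit) a => (Term.ofCode a).code) (g := fun _ L =>
    if L.length.unpair.1 = 0 then Nat.pair 0 L.length.unpair.2
    else if L.length.unpair.1 = 1 then Nat.pair 1 0
    else if L.length.unpair.1 = 2 then Nat.pair 2 0
    else if L.length.unpair.1 = 3 then Nat.pair 3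
      (Nat.pair (L.getD L.length.unpair.2.unpair.1 0) (L.getD L.length.unpair.2.unpair.2 0))
    else Nat.pair 4
      (Nat.pair (L.getD L.length.unpair.2.unpair.1 0) (L.getD L.length.unpair.2.unpair.2 0)))
    (by fun_prop) fun l a => ?_).comp ((Primrec.const ()).pair .id)
  simp only [List.length_map, List.length_range]
  conv_rhs => rw [Term.ofCode]
  split_ifs with h1 h2 h3 h4
  · rfl
  · rfl
  · rfl
  · rw [getD_map_range _ (left_lt (by omega)), getD_map_range _ (right_lt (by omega))]; rfl
  · rw [getD_map_range _ (left_lt (by omega)), getD_map_range _ (right_lt (by omega))]; rfl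

theorem primrec_code_formula : Primrec fun a => (Formula.ofCode a).code := by
  have {f : Unit × List ℕ → ℕ} (hf : Primrec f) : Primrec fun p => (Term.ofCode (f p)).code :=
    primrec_code_term.comp hf
  refine (primrec_strongRec (f := fun (_ : Unit) a => (Formula.ofCode a).code) (g := fun _ L =>
    if L.length.unpair.1 < 2 then Nat.pair L.length.unpair.1
      (Nat.pair (Term.ofCode L.length.unpair.2.unpair.1).code
        (Term.ofCode L.length.unpair.2.unpair.2).code)
    else if L.length.unpair.1 = 2 then Nat.pair 2 (L.getD L.length.unpair.2 0)
    else if L.length.unpair.1 < 6 then Nat.pair L.length.unpair.1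
      (Nat.pair (L.getD L.length.unpair.2.unpair.1 0) (L.getD L.length.unpair.2.unpair.2 0))
    else Nat.pair (if L.length.unpair.1 = 6 then 6 else 7)
      (Nat.pair L.length.unpair.2.unpair.1 (L.getD L.length.unpair.2.unpair.2 0)))
    (by fun_prop) fun l a => ?_).comp ((Primrec.const ()).pair .id)
  simp only [List.length_map, List.length_range]
  conv_rhs => rw [Formula.ofCode]
  by_cases h : a.unpair.1 = 0
  · simp [h, Formula.code]
  have hr := getD_map_range (fun a => (Formula.ofCode a).code) (right_lt (a := a) (by omega)) 0
  have hl := getD_map_range (fun a => (Formula.ofCode a).code) (left_lt (a := a) (by omega)) 0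
  have hn := getD_map_range (fun a => (Formula.ofCode a).code) (unpair_right_lt (a := a) (by omega)) 0
  rw [hr, hl, hn]
  split_ifs <;> first | omega | simp [Formula.code, *]

theorem primrec_vars : Primrec fun p : ℕ × ℕ => decide (p.1 ∈ (Term.ofCode p.2).vars) := by
  refine primrec_strongRec (f := fun x a => decide (x ∈ (Term.ofCode a).vars)) (g := fun x L =>
    if L.length.unpair.1 = 0 then if x = L.length.unpair.2 then true else false
    else if L.length.unpair.1 = 1 then false
    else if L.length.unpair.1 = 2 then false
    else if L.getD L.length.unpair.2.unpair.1 false = true ∨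
      L.getD L.length.unpair.2.unpair.2 false = true then true else false)
    (by fun_prop) fun l a => ?_
  simp only [List.length_map, List.length_range]
  conv_rhs => rw [Term.ofCode]
  by_cases h : a.unpair.1 = 0
  · simp [h, Term.vars]
  have hr := getD_map_range (fun a => decide (l ∈ (Term.ofCode a).vars)) (right_lt (a := a) (by omega)) false
  have hl := getD_map_range (fun a => decide (l ∈ (Term.ofCode a).vars)) (left_lt (a := a) (by omega)) false
  rw [hr, hl]
  split_ifs <;> simp_all [Term.vars]

theorem primrec_freeVars : Primrec fun p : ℕ × ℕ => decide (p.1 ∈ (Formula.ofCode p.2).freeVars) := by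
  have := primrec_vars
  refine primrec_strongRec (f := fun x a => decide (x ∈ (Formula.ofCode a).freeVars)) (g := fun x L =>
    if L.length.unpair.1 < 2 then
      if decide (x ∈ (Term.ofCode L.length.unpair.2.unpair.1).vars) = true ∨
        decide (x ∈ (Term.ofCode L.length.unpair.2.unpair.2).vars) = true then true else false
    else if L.length.unpair.1 = 2 then L.getD L.length.unpair.2 false
    else if L.length.unpair.1 < 6 then
      if L.getD L.length.unpair.2.unpair.1 false = true ∨
        L.getD L.length.unpair.2.unpair.2 false = true then true else false
    else if ¬ x = L.length.unpair.2.unpair.1 ∧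
      L.getD L.length.unpair.2.unpair.2 false = true then true else false)
    ?_ fun l a => ?_
  · have h1 {f : ℕ × List Bool → ℕ} (hf : Primrec f) :
        Primrec fun p : ℕ × List Bool => decide (p.1 ∈ (Term.ofCode (f p)).vars) :=
      this.comp (Primrec.fst.pair hf)
    fun_prop
  simp only [List.length_map, List.length_range]
  conv_rhs => rw [Formula.ofCode]
  by_cases h : a.unpair.1 = 0
  · simp [h, Formula.freeVars]
  have hr := getD_map_range (fun a => decide (l ∈ (Formula.ofCode a).freeVars)) (right_lt (a := a) (by omega)) false
  have hl := getD_map_range (fun a => decide (l ∈ (Formula.ofCode a).freeVars)) (left_lt (a := a) (by omega)) false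
  have hn := getD_map_range (fun a => decide (l ∈ (Formula.ofCode a).freeVars)) (unpair_right_lt (a := a) (by omega)) false
  rw [hr, hl, hn]
  split_ifs <;> first
    | omega | (simp_all [Formula.freeVars]; done) | exact decide_eq_decide.2 Iff.rfl

/-- The decoder accepts every number, so genuine codes are those that it and `Formula.code`
reproduce. -/
def IsSentenceCode (n : ℕ) : Prop :=
  (Formula.ofCode n).code = n ∧ ∀ x, ¬ decide (x ∈ (Formula.ofCode n).freeVars) = true

theorem arith_isSentenceCode {S : Type} : Arith (S := S) fun _ n => IsSentenceCode n := by
  have h1 := primrec_code_formula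
  refine .and (.of_primrecPred (by fun_prop)) (.forall' (.of_primrecPred ?_))
  have : Primrec fun p : ℕ × ℕ => decide (p.2 ∈ (Formula.ofCode p.1).freeVars) :=
    primrec_freeVars.comp (g := fun p : ℕ × ℕ => (p.2, p.1)) (by fun_prop)
  fun_prop

theorem mem_narrowTruth_iff {n : ℕ} :
    n ∈ narrowTruth ↔ IsSentenceCode n ∧ NarrowTrue (Formula.ofCode n) := by
  constructor
  · rintro ⟨A, h1, h2, rfl⟩
    have h1 : A.freeVars = ∅ := h1
    rw [IsSentenceCode, Formula.ofCode_code]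
    exact ⟨⟨rfl, by simp [h1]⟩, h2⟩
  · rintro ⟨⟨h1, h2⟩, h3⟩
    refine ⟨_, ?_, h3, h1⟩
    simp only [decide_eq_true_eq] at h2
    exact Finset.eq_empty_of_forall_notMem h2

/-! ### The interactions inside an interaction -/

/-- `(0, n, r)`: component `n`, opened at time `r`; `(1, i, r)` and `(2, i, r)`: antecedent and
consequent in the instance `i`, launched at time `r`. -/
abbrev Path : Type := List (ℕ × ℕ × ℕ)

noncomputable def Run.inside (o : ℕ × ℕ × ℕ) (Γ : Run) : Run :=
  if o.1 = 0 then component Γ o.2.1 o.2.2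
  else if o.1 = 1 then antecedentRun (instanceRun Γ o.2.1 o.2.2)
  else consequentRun (instanceRun Γ o.2.1 o.2.2)

noncomputable def Run.along (Γ : Run) (π : Path) : Run := π.foldr Run.inside Γ

/-- Entry `q` of an instance launched at `r` is read off the first `r + q + 1` moves, so a finite
part determines `r` entries fewer than its length. -/
def Trace.instanceAt (i r : ℕ) (L : Trace) : Trace :=
  (List.range (L.length - r)).map fun q => historyEntry (L.take (r + q + 1)).reverse i q

def Trace.inside (o : ℕ × ℕ × ℕ) (L : Trace) : Trace :=
  if o.1 = 0 then Trace.component o.2.1 o.2.2 L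
  else if o.1 = 1 then (Trace.instanceAt o.2.1 o.2.2 L).map antecedentStep
  else (Trace.instanceAt o.2.1 o.2.2 L).map consequentStep

def Trace.along (L : Trace) (π : Path) : Trace := π.foldr Trace.inside L

@[fun_prop] theorem Trace.primrec_instanceAt {i r : α → ℕ} {L : α → Trace} (hi : Primrec i)
    (hr : Primrec r) (hL : Primrec L) : Primrec fun a => Trace.instanceAt (i a) (r a) (L a) := by
  unfold Trace.instanceAt; fun_prop

attribute [local irreducible] Trace.instanceAt in
@[fun_prop] theorem Trace.primrec_inside {o : α → ℕ × ℕ × ℕ} {L : α → Trace} (ho : Primrec o)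
    (hL : Primrec L) : Primrec fun a => Trace.inside (o a) (L a) := by
  unfold Trace.inside; fun_prop

@[fun_prop] theorem Trace.primrec_along {π : α → Path} {L : α → Trace} (hL : Primrec L)
    (hπ : Primrec π) : Primrec fun a => Trace.along (L a) (π a) := by
  unfold Trace.along; fun_prop

theorem prefix_instanceAt (Γ : Run) (i r N : ℕ) :
    Trace.instanceAt i r (Γ.prefix N) = Run.prefix (instanceRun Γ i r) (N - r) := by
  unfold Trace.instanceAt
  rw [Run.length_prefix, Run.prefix.eq_def (instanceRun Γ i r)]
  refine List.map_congr_left fun q hq => ?_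
  have hq := List.mem_range.1 hq
  have : (Γ.prefix N).take (r + q + 1) = Γ.prefix (r + q + 1) := by
    simp only [Run.prefix, ← List.map_take, List.take_range]
    rw [min_eq_left (by omega)]
  rw [this, historyEntry_reverse_prefix]
  rfl

theorem exists_prefix_inside (o : ℕ × ℕ × ℕ) :
    ∃ d, ∀ Γ N, Trace.inside o (Run.prefix Γ N) = (Run.inside o Γ).prefix (N - d) := by
  unfold Trace.inside Run.inside
  split_ifs
  · exact ⟨0, fun Γ N => (prefix_component ..).symm⟩
  · exact ⟨o.2.2, fun Γ N => by rw [prefix_instanceAt, prefix_antecedentRun]⟩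
  · exact ⟨o.2.2, fun Γ N => by rw [prefix_instanceAt, prefix_consequentRun]⟩

/-- Each nesting level delays knowledge by a constant, so a finite part of an inner interaction is
determined by a somewhat longer finite part of the whole. This turns first moves inside into
arithmetical statements. -/
theorem exists_prefix_along (π : Path) :
    ∃ d, ∀ Γ N, Trace.along (Run.prefix Γ N) π = (Run.along Γ π).prefix (N - d) := by
  induction π with
  | nil => exact ⟨0, fun _ _ => rfl⟩
  | cons o π ih =>
    obtain ⟨d, hd⟩ := ih
    obtain ⟨d', hd'⟩ := exists_prefix_inside o
    refine ⟨d + d', fun Γ N => ?_⟩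
    have : Trace.along (Run.prefix Γ N) (o :: π) = Trace.inside o (Trace.along (Run.prefix Γ N) π) :=
      rfl
    rw [this, hd, hd', Nat.sub_sub]
    rfl

/-- Codes for the sets of moves that occur in the definition of `Met`. -/
def MoveClass (κ : ℕ × ℕ) (m : Move) : Prop :=
  (κ.1 = 0 ∧ m = [κ.2]) ∨ (κ.1 = 1 ∧ (m = [0] ∨ m = [1])) ∨ (κ.1 = 2 ∧ m.length = 1) ∨
    (κ.1 = 3 ∧ m.length = 4 ∧ m.getD 0 0 = 0 ∧ m.getD 1 0 = κ.2)

/-- The version of `FirstMove` for finite parts of interactions. -/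
def Trace.FirstMove (L : Trace) (p : Role) (κ : ℕ × ℕ) (r : ℕ) (m : Move) : Prop :=
  MoveClass κ m ∧ L[r]? = some (p, m) ∧
    ∀ q < r, ¬ ((L.getD q blank).1 = p ∧ MoveClass κ (L.getD q blank).2)

@[fun_prop] theorem primrecPred_moveClass {κ : α → ℕ × ℕ} {m : α → Move} (hκ : Primrec κ)
    (hm : Primrec m) : PrimrecPred fun a => MoveClass (κ a) (m a) := by
  unfold MoveClass; fun_prop

@[fun_prop] theorem Trace.primrecPred_firstMove {L : α → Trace} {p : α → Role} {κ : α → ℕ × ℕ}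
    {r : α → ℕ} {m : α → Move} (hL : Primrec L) (hp : Primrec p) (hκ : Primrec κ) (hr : Primrec r)
    (hm : Primrec m) : PrimrecPred fun a => Trace.FirstMove (L a) (p a) (κ a) (r a) (m a) := by
  unfold Trace.FirstMove; fun_prop

theorem firstMove_prefix_iff {Γ : Run} {N : ℕ} {p : Role} {κ : ℕ × ℕ} {r : ℕ} {m : Move} :
    Trace.FirstMove (Γ.prefix N) p κ r m ↔ r < N ∧ FirstMove Γ p {m | MoveClass κ m} r m := by
  unfold Trace.FirstMove FirstMove
  by_cases h : r < N
  · rw [Γ.getElem?_prefix h]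
    simp only [h, Option.some.injEq, true_and, Set.mem_ofPred_eq]
    refine and_congr_right fun _ => and_congr_right fun _ => forall₂_congr fun q hq => ?_
    rw [Γ.getD_prefix (hq.trans h)]
    constructor
    · intro h1 m' h2 h3
      exact h1 ⟨by rw [h3], by rwa [h3]⟩
    · rintro h1 ⟨rfl, h2⟩
      exact h1 _ h2 rfl
  · rw [List.getElem?_eq_none (by simpa using h)]
    simp [h]

end NarrowTruth

namespace NarrowTruth

open Encodable Denumerable

variable {α : Type} [Primcodable α]

/-! ### Truth and requirements, by recursion on codes -/

/-- The times: `0` codes infinity, and `k + 1` codes `k`. -/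
def time : ℕ → ℕ∞
  | 0 => ⊤
  | k + 1 => k

theorem lt_time_iff {r t : ℕ} : (r : ℕ∞) < time t ↔ t = 0 ∨ r + 1 < t := by
  cases t with
  | zero => simp [time]
  | succ k => simp [time]

theorem time_eq_top_iff {t : ℕ} : time t = ⊤ ↔ t = 0 := by
  cases t <;> simp [time]

theorem forall_le_time_iff {t : ℕ} {p : ℕ∞ → Prop} :
    (∀ s ≤ time t, p s) ↔ ∀ s, t = 0 ∨ (¬ s = 0 ∧ s ≤ t) → p (time s) := by
  have h (s : ℕ) : time s ≤ time t ↔ t = 0 ∨ (¬ s = 0 ∧ s ≤ t) := by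
    cases t <;> cases s <;> simp [time]
  constructor
  · intro h' s hs
    exact h' _ ((h s).2 hs)
  · intro h' s hs
    obtain ⟨k, rfl⟩ : ∃ k, time k = s := by
      cases s with
      | top => exact ⟨0, rfl⟩
      | coe n => exact ⟨n + 1, rfl⟩
    exact h' k ((h k).1 hs)

/-- Tarski's clauses as a condition on an arbitrary relation `V`, so that being a truth predicate
becomes arithmetical in `V`. Tags above 6 all count as existential, in agreement with the decoder.
-/
def TruthStep (V : ℕ → List ℕ → Prop) (a : ℕ) (l : List ℕ) : Prop :=
  (a.unpair.1 = 0 → (Term.ofCode a.unpair.2.unpair.1).val (env l) =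
    (Term.ofCode a.unpair.2.unpair.2).val (env l)) ∧
  (a.unpair.1 = 1 → (Term.ofCode a.unpair.2.unpair.1).val (env l) <
    (Term.ofCode a.unpair.2.unpair.2).val (env l)) ∧
  (a.unpair.1 = 2 → ¬ V a.unpair.2 l) ∧
  (a.unpair.1 = 3 → V a.unpair.2.unpair.1 l ∧ V a.unpair.2.unpair.2 l) ∧
  (a.unpair.1 = 4 → V a.unpair.2.unpair.1 l ∨ V a.unpair.2.unpair.2 l) ∧
  (a.unpair.1 = 5 → V a.unpair.2.unpair.1 l → V a.unpair.2.unpair.2 l) ∧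
  (a.unpair.1 = 6 → ∀ n : ℕ, V a.unpair.2.unpair.2 (envUpdate l a.unpair.2.unpair.1 n)) ∧
  (6 < a.unpair.1 → ∃ n : ℕ, V a.unpair.2.unpair.2 (envUpdate l a.unpair.2.unpair.1 n))

/-- The clauses of `Met` with truth, the recursive values and first moves replaced by parameters
`V`, `M` and `F`. The subinteractions are named by extended paths, so `M` remains a relation between
numbers and lists. -/
def MetStep (V : ℕ → List ℕ → Prop) (M : ℕ → List ℕ → Path → ℕ → Prop)
    (F : Path → Role → ℕ × ℕ → ℕ → Move → Prop) (a : ℕ) (l : List ℕ) (π : Path) (t : ℕ) : Prop :=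
  V a l ∧
  (a.unpair.1 = 3 →
    (∀ r : ℕ, (t = 0 ∨ r + 1 < t) → F π .user (0, 0) r [0] →
      M a.unpair.2.unpair.1 l ((0, 0, r) :: π) t) ∧
    (∀ r : ℕ, (t = 0 ∨ r + 1 < t) → F π .user (0, 1) r [1] →
      M a.unpair.2.unpair.2 l ((0, 1, r) :: π) t)) ∧
  (a.unpair.1 = 4 → (t = 0 → ∃ r : ℕ, ∃ m : Move, F π .witness (1, 0) r m) ∧
    (∀ r : ℕ, (t = 0 ∨ r + 1 < t) → F π .witness (1, 0) r [0] →
      M a.unpair.2.unpair.1 l ((0, 0, r) :: π) t) ∧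
    (∀ r : ℕ, (t = 0 ∨ r + 1 < t) → F π .witness (1, 0) r [1] →
      M a.unpair.2.unpair.2 l ((0, 1, r) :: π) t)) ∧
  (a.unpair.1 = 5 → ∀ i j u r : ℕ, (t = 0 ∨ r + 1 < t) → F π .user (3, i) r [0, i, j, u] →
    ∀ s : ℕ, (t = 0 ∨ (¬ s = 0 ∧ s ≤ t)) → M a.unpair.2.unpair.1 l ((1, i, r) :: π) s →
      M a.unpair.2.unpair.2 l ((2, i, r) :: π) s) ∧
  (a.unpair.1 = 6 → ∀ n r : ℕ, (t = 0 ∨ r + 1 < t) → F π .user (0, n) r [n] →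
    M a.unpair.2.unpair.2 (envUpdate l a.unpair.2.unpair.1 n) ((0, n, r) :: π) t) ∧
  (6 < a.unpair.1 → (t = 0 → ∃ r : ℕ, ∃ m : Move, F π .witness (2, 0) r m) ∧
    ∀ n r : ℕ, (t = 0 ∨ r + 1 < t) → F π .witness (2, 0) r [n] →
      M a.unpair.2.unpair.2 (envUpdate l a.unpair.2.unpair.1 n) ((0, n, r) :: π) t)

/-- The clauses refer to smaller codes only, so they have at most one solution. -/
theorem iff_of_truthStep {V V' : ℕ → List ℕ → Prop} (h : ∀ a l, V a l ↔ TruthStep V a l)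
    (h' : ∀ a l, V' a l ↔ TruthStep V' a l) (a : ℕ) (l : List ℕ) : V a l ↔ V' a l := by
  induction a using Nat.strong_induction_on generalizing l with
  | _ a ih =>
    rw [h, h', TruthStep, TruthStep]
    by_cases h0 : a.unpair.1 = 0
    · simp [h0]
    · simp only [ih _ (unpair_right_lt (a := a) (by omega)), ih _ (left_lt (a := a) (by omega)),
        ih _ (right_lt (a := a) (by omega))]

theorem iff_of_metStep {V V' : ℕ → List ℕ → Prop} {M M' : ℕ → List ℕ → Path → ℕ → Prop}
    {F F' : Path → Role → ℕ × ℕ → ℕ → Move → Prop} (hV : ∀ a l, V a l ↔ V' a l)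
    (hF : ∀ π p κ r m, F π p κ r m ↔ F' π p κ r m)
    (h : ∀ a l π t, M a l π t ↔ MetStep V M F a l π t)
    (h' : ∀ a l π t, M' a l π t ↔ MetStep V' M' F' a l π t) (a : ℕ) (l : List ℕ) (π : Path)
    (t : ℕ) : M a l π t ↔ M' a l π t := by
  induction a using Nat.strong_induction_on generalizing l π t with
  | _ a ih =>
    rw [h, h', MetStep, MetStep]
    simp only [hV, hF]
    by_cases h0 : a.unpair.1 = 0
    · simp [h0]
    · simp only [ih _ (left_lt (a := a) (by omega)), ih _ (right_lt (a := a) (by omega))]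

theorem truthStep_arithTrue (a : ℕ) (l : List ℕ) :
    ArithTrue (Formula.ofCode a) (env l) ↔
      TruthStep (fun a l => ArithTrue (Formula.ofCode a) (env l)) a l := by
  conv_lhs => rw [Formula.ofCode]
  unfold TruthStep
  split_ifs with h0 h1 h2 h3 h4 h5 h6
  · simp [h0, ArithTrue, Formula.Sat]
  · simp [h1, ArithTrue, Formula.Sat]
  · simp [h2, ArithTrue, Formula.Sat]
  · simp [h3, ArithTrue, Formula.Sat]
  · simp [h4, ArithTrue, Formula.Sat]
  · simp [h5, ArithTrue, Formula.Sat]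
  · simp [h6, ArithTrue, Formula.Sat, env_update]
  · have h7 : 6 < a.unpair.1 := by omega
    simp [h0, h1, h2, h3, h4, h5, h6, h7, ArithTrue, Formula.Sat, env_update]

theorem setOf_moveClass_zero (n : ℕ) : {m | MoveClass (0, n) m} = {[n]} := by
  ext m; simp [MoveClass]

theorem setOf_moveClass_one (n : ℕ) : {m | MoveClass (1, n) m} = {[0], [1]} := by
  ext m; simp [MoveClass]

theorem setOf_moveClass_two (n : ℕ) : {m | MoveClass (2, n) m} = {m | ∃ n, m = [n]} := by
  ext m; simp [MoveClass, List.length_eq_one_iff]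

theorem setOf_moveClass_three (i : ℕ) :
    {m | MoveClass (3, i) m} = {m | ∃ j u, m = [0, i, j, u]} := by
  ext m
  have := isLaunch_iff (i := i) (x := (.user, m))
  simpa [IsLaunch, MoveClass] using this

theorem metStep_met (Γ : Run) (a : ℕ) (l : List ℕ) (π : Path) (t : ℕ) :
    Met (Formula.ofCode a) (env l) (Γ.along π) (time t) ↔
      MetStep (fun a l => ArithTrue (Formula.ofCode a) (env l))
        (fun a l π t => Met (Formula.ofCode a) (env l) (Γ.along π) (time t))
        (fun π p κ r m => FirstMove (Γ.along π) p {m | MoveClass κ m} r m) a l π t := by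
  have h0 (n r : ℕ) (π : Path) : Γ.along ((0, n, r) :: π) = component (Γ.along π) n r := rfl
  have h1 (n r : ℕ) (π : Path) :
    Γ.along ((1, n, r) :: π) = antecedentRun (instanceRun (Γ.along π) n r) := rfl
  have h2 (n r : ℕ) (π : Path) :
    Γ.along ((2, n, r) :: π) = consequentRun (instanceRun (Γ.along π) n r) := rfl
  unfold MetStep
  simp only [setOf_moveClass_zero, setOf_moveClass_one, setOf_moveClass_two, setOf_moveClass_three,
    h0, h1, h2, env_update]
  rw [Formula.ofCode]
  split_ifs with h0 h1 h2 h3 h4 h5 h6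
  · simp [h0, Met]
  · simp [h1, Met]
  · simp [h2, Met]
  · simp [h3, Met, lt_time_iff]
  · simp [h4, Met, lt_time_iff, time_eq_top_iff]
  · simp only [h5, Met, lt_time_iff, forall_le_time_iff, LaunchedAt]
    simp
  · simp [h6, Met, lt_time_iff]
  · have h7 : 6 < a.unpair.1 := by omega
    simp only [h3, h4, h5, h6, h7, Met, lt_time_iff, time_eq_top_iff]
    simp

/-! ### Guessed evaluations -/

/-- What is guessed: the moves of the user, the truth values, and the values of `Met`. -/
abbrev Guess : Type := (ℕ × Move) ⊕ (ℕ × List ℕ) ⊕ (ℕ × List ℕ × Path × ℕ)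

/-- The guess concerning the program with number `c`. -/
def guess (Y : Set ℕ) (c : ℕ) : Set Guess := {x | encode (c, x) ∈ Y}

section

variable (c : ℕ) (Z : Set Guess)

def GuessMove (q : ℕ) (m : Move) : Prop := Sum.inl (q, m) ∈ Z

def GuessTrue (a : ℕ) (l : List ℕ) : Prop := Sum.inr (Sum.inl (a, l)) ∈ Z

def GuessMet (a : ℕ) (l : List ℕ) (π : Path) (t : ℕ) : Prop :=
  Sum.inr (Sum.inr (a, l, π, t)) ∈ Z

/-- `h` is the beginning of the play of the program `c` against the guessed moves. -/
def GuessPlay (h : Trace) : Prop :=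
  ∀ q : ℕ, q < h.length →
    (q % 2 = 0 → (h.getD q blank).1 = .witness ∧
      encode (h.getD q blank).2 ∈ (ofNat Nat.Partrec.Code c).eval
        (encode ((List.range (q / 2)).map fun i => (h.getD (2 * i + 1) blank).2))) ∧
    (q % 2 = 1 → (h.getD q blank).1 = .user ∧ GuessMove Z (q / 2) (h.getD q blank).2)

/-- A finite beginning of the play suffices as evidence, so no quantifier over whole interactions is
needed. -/
def GuessFirst (π : Path) (p : Role) (κ : ℕ × ℕ) (r : ℕ) (m : Move) : Prop :=
  ∃ h : Trace, GuessPlay c Z h ∧ (h.along π).FirstMove p κ r m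

/-- The guessed moves form the graph of a function, and the other two relations solve their
recursion clauses. All this is arithmetical in `Z`. -/
def GuessCorrect : Prop :=
  (∀ q : ℕ, ∃ m : Move, GuessMove Z q m ∧ ∀ m' : Move, GuessMove Z q m' → m' = m) ∧
  (∀ (a : ℕ) (l : List ℕ), GuessTrue Z a l ↔ TruthStep (GuessTrue Z) a l) ∧
  (∀ (a : ℕ) (l : List ℕ) (π : Path) (t : ℕ),
    GuessMet Z a l π t ↔ MetStep (GuessTrue Z) (GuessMet Z) (GuessFirst c Z) a l π t)

end

def TotalCode (c : ℕ) : Prop :=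
  ∀ h : List Move, ∃ m : Move, encode m ∈ (ofNat Nat.Partrec.Code c).eval (encode h)

theorem arith_mem_guess {c : α → ℕ} {x : α → Guess} (hc : Primrec c) (hx : Primrec x) :
    Arith (S := Unit) fun I a => x a ∈ guess (I ()) (c a) :=
  Arith.mem_set () (f := fun a => encode (c a, x a)) (Primrec.to_comp (by fun_prop))

theorem arith_guessMove {c q : α → ℕ} {m : α → Move} (hc : Primrec c) (hq : Primrec q)
    (hm : Primrec m) : Arith (S := Unit) fun I a => GuessMove (guess (I ()) (c a)) (q a) (m a) :=
  arith_mem_guess hc (x := fun a => .inl (q a, m a)) (by fun_prop)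

theorem arith_guessTrue {c q : α → ℕ} {l : α → List ℕ} (hc : Primrec c) (hq : Primrec q)
    (hl : Primrec l) : Arith (S := Unit) fun I a => GuessTrue (guess (I ()) (c a)) (q a) (l a) :=
  arith_mem_guess hc (x := fun a => .inr (.inl (q a, l a))) (by fun_prop)

theorem arith_guessMet {c q t : α → ℕ} {l : α → List ℕ} {π : α → Path} (hc : Primrec c)
    (hq : Primrec q) (hl : Primrec l) (hπ : Primrec π) (ht : Primrec t) :
    Arith (S := Unit) fun I a => GuessMet (guess (I ()) (c a)) (q a) (l a) (π a) (t a) :=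
  arith_mem_guess hc (x := fun a => .inr (.inr (q a, l a, π a, t a))) (by fun_prop)

theorem arith_mem_eval {S : Type} {c x y : α → ℕ} (hc : Primrec c) (hx : Primrec x)
    (hy : Primrec y) :
    Arith (S := S) fun _ a => y a ∈ (ofNat Nat.Partrec.Code (c a)).eval (x a) :=
  Arith.mem_partrec (f := fun q : Nat.Partrec.Code × ℕ => q.1.eval q.2) Nat.Partrec.Code.eval_part
    (g := fun a => (ofNat Nat.Partrec.Code (c a), x a)) (Primrec.to_comp (by fun_prop))
    (Primrec.to_comp hy)

theorem arith_guessPlay {c : α → ℕ} {h : α → Trace} (hc : Primrec c) (hh : Primrec h) :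
    Arith (S := Unit) fun I a => GuessPlay (c a) (guess (I ()) (c a)) (h a) := by
  refine .forall' (.imp (.of_primrecPred (by fun_prop)) (.and
    (.imp (.of_primrecPred (by fun_prop)) (.and (.of_primrecPred (by fun_prop))
      (arith_mem_eval (by fun_prop) (by fun_prop) (by fun_prop))))
    (.imp (.of_primrecPred (by fun_prop)) (.and (.of_primrecPred (by fun_prop))
      (arith_guessMove (by fun_prop) (by fun_prop) (by fun_prop))))))

theorem arith_guessFirst {c r : α → ℕ} {π : α → Path} {p : α → Role} {κ : α → ℕ × ℕ}
    {m : α → Move} (hc : Primrec c) (hπ : Primrec π) (hp : Primrec p) (hκ : Primrec κ)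
    (hr : Primrec r) (hm : Primrec m) : Arith (S := Unit) fun I a =>
      GuessFirst (c a) (guess (I ()) (c a)) (π a) (p a) (κ a) (r a) (m a) :=
  .exists' (.and (arith_guessPlay (by fun_prop) (by fun_prop)) (.of_primrecPred (by fun_prop)))

theorem arith_truthStep {c q : α → ℕ} {l : α → List ℕ} (hc : Primrec c) (hq : Primrec q)
    (hl : Primrec l) : Arith (S := Unit) fun I a =>
      TruthStep (GuessTrue (guess (I ()) (c a))) (q a) (l a) := by
  unfold TruthStep
  repeat' first
    | exact arith_guessTrue (by fun_prop) (by fun_prop) (by fun_prop)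
    | apply Arith.and | apply Arith.or | apply Arith.not | apply Arith.forall'
    | apply Arith.exists' | exact .of_primrecPred (by fun_prop) | apply Arith.imp

theorem arith_metStep {c q t : α → ℕ} {l : α → List ℕ} {π : α → Path} (hc : Primrec c)
    (hq : Primrec q) (hl : Primrec l) (hπ : Primrec π) (ht : Primrec t) :
    Arith (S := Unit) fun I a => MetStep (GuessTrue (guess (I ()) (c a)))
      (GuessMet (guess (I ()) (c a))) (GuessFirst (c a) (guess (I ()) (c a)))
      (q a) (l a) (π a) (t a) := by
  unfold MetStep
  repeat' first
    | with_reducible apply Arith.and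
    | with_reducible apply Arith.imp
    | with_reducible apply Arith.forall'
    | with_reducible apply Arith.exists'
    | with_reducible apply arith_guessTrue
    | with_reducible apply arith_guessMet
    | with_reducible apply arith_guessFirst
    | with_reducible apply Arith.of_primrecPred
  all_goals fun_prop

theorem arith_guessCorrect :
    Arith (S := Unit) fun I c => GuessCorrect c (guess (I ()) c) := by
  refine .and (.forall' (.exists' (.and (arith_guessMove (by fun_prop) (by fun_prop) (by fun_prop))
    (.forall' (.imp (arith_guessMove (by fun_prop) (by fun_prop) (by fun_prop))
      (.of_primrecPred (by fun_prop)))))))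
    (.and (.forall' (.forall' (.iff (arith_guessTrue (by fun_prop) (by fun_prop) (by fun_prop))
      (arith_truthStep (by fun_prop) (by fun_prop) (by fun_prop)))))
    (.forall' (.forall' (.forall' (.forall' (.iff
      (arith_guessMet (by fun_prop) (by fun_prop) (by fun_prop) (by fun_prop) (by fun_prop))
      (arith_metStep (by fun_prop) (by fun_prop) (by fun_prop) (by fun_prop) (by fun_prop))))))))

theorem arith_totalCode {S : Type} : Arith (S := S) fun _ c => TotalCode c :=
  .forall' (.exists' (arith_mem_eval (by fun_prop) (by fun_prop) (by fun_prop)))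

/-! ### Correct guesses -/

section

variable {c : ℕ} {σ : Strategy} {X : ℕ → Move} {Z : Set Guess}

theorem map_play (h : Trace) {q : ℕ} (hh : ∀ q' < q, h.getD q' blank = play σ X q') :
    ((List.range (q / 2)).map fun i => (h.getD (2 * i + 1) blank).2) =
      (List.range (q / 2)).map X := by
  refine List.map_congr_left fun i hi => ?_
  have hi := List.mem_range.1 hi
  rw [hh _ (by omega), play_eq_user_iff.2 ⟨i, rfl, rfl⟩]

theorem guessPlay_iff (hσ : Computes (ofNat Nat.Partrec.Code c) σ)
    (hX : ∀ q m, GuessMove Z q m ↔ m = X q) {h : Trace} :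
    GuessPlay c Z h ↔ h = (play σ X).prefix h.length := by
  have key : h = (play σ X).prefix h.length ↔ ∀ q < h.length, h.getD q blank = play σ X q := by
    constructor
    · intro h1 q hq
      rw [h1, Run.getD_prefix _ hq]
    · intro h1
      refine List.ext_getElem (by simp) fun q hq _ => ?_
      have := h1 q hq
      rw [List.getD_eq_getElem _ _ hq] at this
      simpa [Run.prefix] using this
  rw [key]
  constructor
  · intro h1 q
    induction q using Nat.strong_induction_on with
    | _ q ih =>
      intro hq
      obtain ⟨h2, h3⟩ := h1 q hq
      rw [map_play h fun q' hq' => ih q' hq' (hq'.trans hq)] at h2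
      unfold play
      split_ifs with hq2
      · obtain ⟨h4, h5⟩ := h2 hq2
        exact Prod.ext h4 (encode_injective (Part.mem_unique h5 (hσ _)))
      · obtain ⟨h4, h5⟩ := h3 (by omega)
        exact Prod.ext h4 ((hX _ _).1 h5)
  · intro h1 q hq
    rw [map_play h fun q' hq' => h1 q' (hq'.trans hq), h1 q hq]
    unfold play
    constructor
    · intro hq2
      rw [if_pos hq2]
      exact ⟨rfl, hσ _⟩
    · intro hq2
      rw [if_neg (by omega)]
      exact ⟨rfl, (hX _ _).2 rfl⟩

theorem guessFirst_iff (hσ : Computes (ofNat Nat.Partrec.Code c) σ)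
    (hX : ∀ q m, GuessMove Z q m ↔ m = X q) (π : Path) (p : Role) (κ : ℕ × ℕ) (r : ℕ) (m : Move) :
    GuessFirst c Z π p κ r m ↔
      FirstMove ((play σ X).along π) p {m | MoveClass κ m} r m := by
  obtain ⟨d, hd⟩ := exists_prefix_along π
  unfold GuessFirst
  simp only [guessPlay_iff hσ hX]
  constructor
  · rintro ⟨h, h1, h2⟩
    rw [h1, hd, firstMove_prefix_iff] at h2
    exact h2.2
  · intro h
    -- `r + 1` entries of the inner interaction are needed, and the path delays them by `d`.
    refine ⟨(play σ X).prefix (r + 1 + d), by simp, ?_⟩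
    rw [hd, firstMove_prefix_iff]
    exact ⟨by omega, h⟩

/-- The correct guess. -/
def correctGuess (σ : Strategy) (X : ℕ → Move) : Set Guess :=
  {x | Sum.elim (fun p => p.2 = X p.1) (Sum.elim (fun p => ArithTrue (Formula.ofCode p.1) (env p.2))
    fun p => Met (Formula.ofCode p.1) (env p.2.1) ((play σ X).along p.2.2.1) (time p.2.2.2)) x}

theorem guessCorrect_correctGuess (hσ : Computes (ofNat Nat.Partrec.Code c) σ) :
    GuessCorrect c (correctGuess σ X) := by
  have h1 (q m) : GuessMove (correctGuess σ X) q m ↔ m = X q := Iff.rfl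
  refine ⟨fun q => ⟨X q, rfl, fun m h => h⟩, truthStep_arithTrue, fun a l π t => ?_⟩
  have h2 : GuessFirst c (correctGuess σ X) =
      fun π p κ r m => FirstMove ((play σ X).along π) p {m | MoveClass κ m} r m := by
    funext π p κ r m
    exact propext (guessFirst_iff hσ h1 π p κ r m)
  rw [h2]
  exact metStep_met (play σ X) a l π t

/-- The real is read off the guess. By uniqueness of the solutions of the clauses, the guessed
values then are the true ones. -/
theorem GuessCorrect.exists_met (hσ : Computes (ofNat Nat.Partrec.Code c) σ)
    (hZ : GuessCorrect c Z) : ∃ X : ℕ → Move, ∀ a l π t, GuessMet Z a l π t ↔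
      Met (Formula.ofCode a) (env l) ((play σ X).along π) (time t) := by
  obtain ⟨h1, h2, h3⟩ := hZ
  choose X hX hX' using h1
  refine ⟨X, iff_of_metStep (iff_of_truthStep h2 truthStep_arithTrue)
    (guessFirst_iff hσ fun q m => ⟨hX' q m, fun h => h ▸ hX q⟩) h3 (metStep_met (play σ X))⟩

end

theorem TotalCode.exists_computes {c : ℕ} (hc : TotalCode c) :
    ∃ σ, Computes (ofNat Nat.Partrec.Code c) σ := by
  choose σ hσ using hc
  exact ⟨σ, hσ⟩

/-- Exchange of `∃ c` with the set quantifier: if every total program fails, a choice of one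
defeating real for each of them is coded in a single `Y`, which refutes the right-hand side. -/
theorem mem_narrowTruth_iff_forall {n : ℕ} : n ∈ narrowTruth ↔ ∀ Y : Set ℕ,
    IsSentenceCode n ∧ ∃ c, TotalCode c ∧
      (GuessCorrect c (guess Y c) → GuessMet (guess Y c) n [] [] 0) := by
  rw [mem_narrowTruth_iff]
  constructor
  · rintro ⟨h1, c, σ, hσ, h⟩ Y
    have hσ : Computes (ofNat Nat.Partrec.Code (encode c)) σ := by rwa [ofNat_encode]
    refine ⟨h1, encode c, fun l => ⟨σ l, hσ l⟩, fun hY => ?_⟩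
    obtain ⟨X, hX⟩ := hY.exists_met hσ
    exact (hX n [] [] 0).2 (h X)
  · intro h
    refine ⟨(h ∅).1, ?_⟩
    by_contra hn
    have (c : ℕ) (hc : TotalCode c) : ∃ (σ : Strategy) (X : ℕ → Move),
        Computes (ofNat Nat.Partrec.Code c) σ ∧
          ¬ Met (Formula.ofCode n) (fun _ => 0) (play σ X) ⊤ := by
      obtain ⟨σ, hσ⟩ := hc.exists_computes
      by_contra h'
      refine hn ⟨_, σ, hσ, fun X => ?_⟩
      by_contra hX
      exact h' ⟨σ, X, hσ, hX⟩
    choose σ X hσ hX using this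
    -- The section of `Y` at each total `c` is the correct guess for the real that defeats `c`.
    let Y : Set ℕ := {k | ∃ (c : ℕ) (hc : TotalCode c) (x : Guess),
      k = encode (c, x) ∧ x ∈ correctGuess (σ c hc) (X c hc)}
    obtain ⟨-, c, hc, h'⟩ := h Y
    have hY : guess Y c = correctGuess (σ c hc) (X c hc) := by
      ext x
      constructor
      · rintro ⟨c', hc', x', h1, h2⟩
        obtain ⟨rfl, rfl⟩ := Prod.mk.inj (encode_injective h1)
        exact h2
      · intro h1
        exact ⟨c, hc, x, rfl, h1⟩
    rw [hY] at h'
    exact hX c hc (h' (guessCorrect_correctGuess (hσ c hc)))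

theorem isPi11_narrowTruth : IsPi11 narrowTruth := by
  have h : Arith (S := Unit) fun I n => IsSentenceCode n ∧ ∃ c, TotalCode c ∧
      (GuessCorrect c (guess (I ()) c) → GuessMet (guess (I ()) c) n [] [] 0) :=
    .and arith_isSentenceCode (.exists' (.and
      (arith_totalCode.comp (f := fun p : ℕ × ℕ => p.2) (Primrec.to_comp (by fun_prop)))
      (.imp (arith_guessCorrect.comp (f := fun p : ℕ × ℕ => p.2) (Primrec.to_comp (by fun_prop)))
        (arith_guessMet (by fun_prop) (by fun_prop) (by fun_prop) (by fun_prop) (by fun_prop)))))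
  obtain ⟨φ, h1, h2⟩ := h.exists_formula
  refine ⟨φ, h1, fun n => ?_⟩
  rw [mem_narrowTruth_iff_forall]
  exact forall_congr' fun Y => (h2 (fun _ => Y) n).symm

end NarrowTruth

theorem theorem8 : NarrowTruth.IsPi11Complete NarrowTruth.narrowTruth :=
  ⟨NarrowTruth.isPi11_narrowTruth, fun _ hR => NarrowTruth.manyOneReducible_narrowTruth hR⟩
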